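/- Let $d\ge 1$. A test function is a bounded measurable function $f:\mathbb R^d\to\mathbb R$ with compact support, and $\hat f(u)=\int e^{-i\langle u,t\rangle}f(t)\,dt$. Let $\mathsf M$ be a random $L^2$ wide-sense stationary signed measure on $\mathbb R^d$, i.e. a linear, countably additive family of real square integrable random variables $I_{\mathsf M}(f)=\int f\,d\mathsf M$, indexed by the test functions, on a probability space $(\Omega,\mathbf P)$, such that the mean and the variance of $I_{\mathsf M}(f)$ are unchanged when $f$ is translated. Let $\mathsf S$ be its spectral measure, i.e. an even non-negative measure on $\mathbb R^d$ with $\operatorname{Var}(I_{\mathsf M}(f))=\int|\hat f|^2\,d\mathsf S$ for every test function $f$, and let $\mathsf s$ be the density of the absolutely continuous part of $\mathsf S$. Rigidity. For $A\subset\mathbb R^d$ bounded and measurable and $\gamma$ bounded and measurable on $A$, $\mathsf M$ is linearly $\gamma$-rigid on $A$ if there are test functions $h_n$ vanishing on $A$ such that $I_{\mathsf M}(h_n)\to I_{\mathsf M}(\gamma 1_A)$ almost surely and in $L^2(\mathbf P)$. It is linearly maximally rigid on $A$ if it is linearly $\gamma$-rigid on $A$ for every test function $\gamma$, and, for a multi-index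 $\mathbf k\in\mathbb N^d$, linearly $\mathbf k$-rigid on $A$ if it is linearly $\gamma$-rigid on $A$ for $\gamma(t)=t^{\mathbf k}=\prod_i t_i^{\mathbf k_i}$. Poles (with $1/0=\infty$). For $u_0\in\mathbb R^d$ and $\mathbf k\in\mathbb N^d$, $u_0$ is a pole of order $\mathbf k$ of $\mathsf s^{-1}$ if every polynomial $Q(u)=\sum_{\mathbf m}a_{\mathbf m}u^{\mathbf m}$ such that $\int_{B(u_0,\varepsilon)}|Q(u-u_0)|^2\,\mathsf s(u)^{-1}du<\infty$ for some $\varepsilon>0$ satisfies $a_{\mathbf k}=0$. A pole is a pole of order $\mathbf 0$; it has finite order if $\int_{B(u_0,\varepsilon)}\|u-u_0\|^{2q}\,\mathsf s(u)^{-1}du<\infty$ for some $\varepsilon>0$ and $q\in\mathbb N$. The density $\mathsf s$ is simple if $\mathsf s^{-1}$ has finitely many poles, all of finite order, and there are $\varepsilon,c>0$ and $p\in\mathbb N$ such that $\mathsf s(u)\ge c(1+\|u\|)^{-p}$ for almost every $u$ at distance at least $\varepsilon$ from all the poles. Proposition. Assume that $\mathsf s$ is simple. Then for every $\eta>0$,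 $\mathsf M$ is not linearly maximally rigid on $B(0,\eta)$. Moreover, for every $\mathbf k\in\mathbb N^d$ and every $\eta>0$, $\mathsf M$ is linearly $\mathbf k$-rigid on $B(0,\eta)$ if and only if $0$ is a pole of order $\mathbf k$ of $\mathsf s^{-1}$. -/

import Mathlib

open MeasureTheory ProbabilityTheory Filter Topology
open scoped ENNReal

namespace LinearRigidity

/-- The Euclidean space `ℝ^d`. -/
abbrev E (d : ℕ) : Type := EuclideanSpace ℝ (Fin d)

/-- The class `C_c^b(ℝ^d)` of test functions: measurable, bounded, compactly supported. -/
structure IsTest {d : ℕ} (f : E d → ℝ) : Prop where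
  measurable : Measurable f
  bounded : ∃ C : ℝ, ∀ x, |f x| ≤ C
  compactSupport : HasCompactSupport f

/-- A random `L²` signed measure on `ℝ^d` over the probability space `(Ω, P)`: a collection of real
square integrable random variables `I f`, indexed by the test functions `f`, which is linear and
countably additive (values of `I` outside of the test functions play no role). Countable additivity
is asked for sums of non-negative test functions, with convergence in probability only, which is
implied by almost sure convergence as well as by convergence in `L²`. -/
structure RandomSignedMeasure (d : ℕ) {Ω : Type*} [MeasurableSpace Ω] (P : Measure Ω) where
  /-- the random variable `I f = ∫ f dM` -/
  I : (E d → ℝ) → Ω → ℝ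
  memLp : ∀ f, IsTest f → MemLp (I f) 2 P
  linear : ∀ (a b : ℝ) (f g : E d → ℝ), IsTest f → IsTest g →
    I (fun x => a * f x + b * g x) =ᵐ[P] fun ω => a * I f ω + b * I g ω
  sigma_additive : ∀ (f : ℕ → E d → ℝ) (g : E d → ℝ), (∀ n, IsTest (f n)) → IsTest g →
    (∀ n x, 0 ≤ f n x) → (∀ x, HasSum (fun n => f n x) (g x)) →
    TendstoInMeasure P (fun N ω => ∑ n ∈ Finset.range N, I (f n) ω) atTop (I g)

/-- `f̂(u) = ∫ e^{-i⟨u,t⟩} f(t) dt`. -/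
noncomputable def fourier {d : ℕ} (f : E d → ℝ) (u : E d) : ℂ :=
  ∫ t, Complex.exp (-(Complex.I * ((inner ℝ u t : ℝ) : ℂ))) * ((f t : ℝ) : ℂ)

namespace RandomSignedMeasure

variable {d : ℕ} {Ω : Type*} [MeasurableSpace Ω] {P : Measure Ω}

/-- Wide-sense stationarity: the means and the variances of the linear statistics are invariant
under translations. -/
def IsStationary (M : RandomSignedMeasure d P) : Prop :=
  ∀ (x : E d) (f : E d → ℝ), IsTest f →
    (∫ ω, M.I (fun y => f (y + x)) ω ∂P) = (∫ ω, M.I f ω ∂P) ∧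
    variance (M.I (fun y => f (y + x))) P = variance (M.I f) P

/-- `S` is the spectral measure of `M`: an even non-negative measure such that
`Var (I f) = ∫ |f̂|² dS` for all test functions `f`. -/
def IsSpectralMeasure (M : RandomSignedMeasure d P) (S : Measure (E d)) : Prop :=
  S.map (fun u => -u) = S ∧
  ∀ f : E d → ℝ, IsTest f →
    ∫⁻ u, ‖fourier f u‖ₑ ^ 2 ∂S = ENNReal.ofReal (variance (M.I f) P)

/-- Linear `γ`-rigidity of `M` on `A`: `∫_A γ dM` is the limit, almost surely and in `L²`, of
linear statistics `I (h n)`, where the `h n` are test functions that vanish on `A`. -/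
def IsLinRigid (M : RandomSignedMeasure d P) (γ : E d → ℝ) (A : Set (E d)) : Prop :=
  ∃ h : ℕ → E d → ℝ, (∀ n, IsTest (h n) ∧ ∀ x ∈ A, h n x = 0) ∧
    (∀ᵐ ω ∂P, Tendsto (fun n => M.I (h n) ω) atTop (𝓝 (M.I (A.indicator γ) ω))) ∧
    Tendsto (fun n => eLpNorm (fun ω => M.I (h n) ω - M.I (A.indicator γ) ω) 2 P) atTop (𝓝 0)

/-- Linear maximal rigidity on `A`: linear `γ`-rigidity on `A` for all test functions `γ`. -/
def IsLinMaxRigid (M : RandomSignedMeasure d P) (A : Set (E d)) : Prop :=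
  ∀ γ : E d → ℝ, IsTest γ → M.IsLinRigid γ A

/-- Linear `k`-rigidity on `A`, for a multi-index `k`: linear rigidity for `γ(t) = t^k`. -/
def IsLinRigidOfOrder (M : RandomSignedMeasure d P) (k : Fin d →₀ ℕ) (A : Set (E d)) : Prop :=
  M.IsLinRigid (fun t => ∏ i, t i ^ k i) A

end RandomSignedMeasure

/-- The spectral density: the density of the absolutely continuous part of the spectral measure. -/
noncomputable def spectralDensity {d : ℕ} (S : Measure (E d)) : E d → ℝ≥0∞ :=
  S.rnDeriv volume

/-- `u₀` is a pole of order `k` of `s⁻¹` (with `1/0 = ∞`): every polynomial `Q` such that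
`|Q(u - u₀)|² s(u)⁻¹` is integrable in some neighbourhood of `u₀` has a vanishing coefficient at the
monomial of exponent `k`. -/
def HasPole {d : ℕ} (s : E d → ℝ≥0∞) (u₀ : E d) (k : Fin d →₀ ℕ) : Prop :=
  ∀ Q : MvPolynomial (Fin d) ℂ,
    (∃ ε : ℝ, 0 < ε ∧ ∫⁻ u in Metric.ball u₀ ε,
      ‖MvPolynomial.eval (fun i => (((u - u₀) i : ℝ) : ℂ)) Q‖ₑ ^ 2 * (s u)⁻¹ < ∞) →
    Q.coeff k = 0

/-- The poles of `s⁻¹`: the points that are poles of order `0`. -/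
def poles {d : ℕ} (s : E d → ℝ≥0∞) : Set (E d) := {u₀ | HasPole s u₀ 0}

/-- The pole `u₀` of `s⁻¹` has finite order: `‖u - u₀‖^{2q} s(u)⁻¹` is integrable around `u₀` for
some `q`. -/
def HasFiniteOrder {d : ℕ} (s : E d → ℝ≥0∞) (u₀ : E d) : Prop :=
  ∃ (ε : ℝ) (q : ℕ), 0 < ε ∧
    ∫⁻ u in Metric.ball u₀ ε, ‖u - u₀‖ₑ ^ (2 * q) * (s u)⁻¹ < ∞

/-- `s` is simple: `s⁻¹` has finitely many poles, all of finite order, and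
`s(u) ≥ c (1 + ‖u‖)^{-p}` at distance at least `ε` from the poles, for some `ε, c > 0` and `p`
(almost everywhere, as a density is only defined up to null sets). -/
def IsSimple {d : ℕ} (s : E d → ℝ≥0∞) : Prop :=
  (poles s).Finite ∧ (∀ u₀ ∈ poles s, HasFiniteOrder s u₀) ∧
  ∃ (ε c : ℝ) (p : ℕ), 0 < ε ∧ 0 < c ∧
    ∀ᵐ u : E d, (∀ u₀ ∈ poles s, ε ≤ dist u u₀) →
      ENNReal.ofReal (c * ((1 + ‖u‖) ^ p)⁻¹) ≤ s u

end LinearRigidity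

/-! The mean of `M.I f` is a translation invariant, countably additive functional of `f`, hence `m *
∫ f`, so that `E |M.I f|² = ∫ |f̂|² dκ` with `κ = S + m² δ₀` (`exists_second_moment`). Rigidity for
`γ = t^k 1_B`, with `B` the ball, thus asks whether `γ̂` lies in the closure in `L²(κ)` of the
transforms of test functions vanishing on `B`; almost sure convergence is then obtained along a
subsequence.

A pole gives rigidity, by duality. Let `g ∈ L²(κ)` annihilate these transforms, and let `T f = ∫ f̂
g dκ`, which only sees `f` on `B`. Its transform `ψ v = T (e^{i⟨v,·⟩} 1_B)` is smooth, with Taylor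
coefficients at `0` that are nonzero multiples of the numbers `T (t^m 1_B)`. By uniqueness of
Fourier transforms, `ψ` is a constant times `s g` almost everywhere near `0`
(`specTransform_ae_eq`), so `|ψ|² / s` is integrable there, being dominated by a multiple of `|g|²
s`. As `s⁻¹` has finite order at `0`, a high order Taylor polynomial of `ψ` inherits this
integrability. The pole condition kills its coefficient at `k`, that is `T γ = 0`
(`specFun_ballMonomial_eq_zero`).

Without a pole there is an obstruction. Some polynomial `Q` with nonzero coefficient at `k` makes
`|Q|² / s` integrable near `0`. Multiplying it by a monomial, and by a polynomial that cancels the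
other poles without vanishing at `0`, gives `p` whose only coefficient at exponents `≤ k` is the one
at `k`, with `|p|² / s` locally integrable everywhere. Applying the matching differential operator
to a bump function gives a smooth `χ` supported inside `B`, with `χ̂ = p φ̂`, `∫ |χ̂|² / s < ∞` and
`∫ t^k χ ≠ 0`. If `h` vanishes on `B`, Parseval makes `∫ (ĥ - γ̂) χ̂` a nonzero constant independent
of `h`, and the weighted Cauchy-Schwarz inequality bounds it by `Var (I h - I γ)`, which therefore
cannot tend to `0` (`not_isLinRigidOfOrder`).

Finite order at `0` means that large powers of a coordinate are admissible polynomials, so some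
order `k` is not a pole; maximal rigidity would imply rigidity of that order. -/

namespace LinearRigidity

/-! ### Complex test functions and their Fourier transforms. -/

section ComplexTest

variable {d : ℕ}

/-- Complex test functions, with explicit bounds on the support and on the values. -/
structure CTest (R C : ℝ) (f : E d → ℂ) : Prop where
  meas : Measurable f
  bdd : ∀ x, ‖f x‖ ≤ C
  supp : ∀ x, R < ‖x‖ → f x = 0

/-- The character `t ↦ e^{i⟨v,t⟩}`. -/
noncomputable def chr (v t : E d) : ℂ := Complex.exp (Complex.I * ((inner ℝ v t : ℝ) : ℂ))

/-- The Fourier transform of complex functions, normalized as `fourier`. -/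
noncomputable def cft (f : E d → ℂ) (u : E d) : ℂ := ∫ t, chr (-u) t * f t

lemma fourier_eq_cft (f : E d → ℝ) : fourier f = cft (fun t => (f t : ℂ)) := by
  ext u
  simp [fourier, cft, chr]

lemma norm_chr (v t : E d) : ‖chr v t‖ = 1 := by
  rw [chr, mul_comm, Complex.norm_exp_ofReal_mul_I]

lemma continuous_chr : Continuous (fun p : E d × E d => chr p.1 p.2) := by
  unfold chr; fun_prop

lemma continuous_chr_right (v : E d) : Continuous (chr v) := by
  unfold chr; fun_prop

lemma continuous_chr_left (t : E d) : Continuous (fun v => chr v t) := by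
  unfold chr; fun_prop

lemma chr_add_right (v s t : E d) : chr v (s + t) = chr v s * chr v t := by
  simp [chr, inner_add_right, mul_add, Complex.exp_add]

lemma chr_add_left (v w t : E d) : chr (v + w) t = chr v t * chr w t := by
  simp [chr, inner_add_left, mul_add, Complex.exp_add]

@[simp] lemma chr_zero_left (t : E d) : chr 0 t = 1 := by simp [chr]

lemma chr_comm (v t : E d) : chr v t = chr t v := by simp [chr, real_inner_comm]

lemma conj_chr (v t : E d) : (starRingEnd ℂ) (chr v t) = chr (-v) t := by
  simp [chr, ← Complex.exp_conj]

lemma CTest.integrable {R C : ℝ} {f : E d → ℂ} (hf : CTest R C f) : Integrable f := by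
  have h : IntegrableOn f (Metric.closedBall 0 R) :=
    Measure.integrableOn_of_bounded (M := C) (measure_closedBall_lt_top).ne
      hf.meas.aestronglyMeasurable (ae_of_all _ hf.bdd)
  refine h.integrable_of_forall_notMem_eq_zero fun x hx => hf.supp x ?_
  simpa using hx

lemma integrable_chr_mul {f : E d → ℂ} (hf : Integrable f) (u : E d) :
    Integrable (fun t => chr u t * f t) :=
  hf.bdd_mul (continuous_chr_right u).aestronglyMeasurable
    (ae_of_all _ fun t => (norm_chr u t).le)

lemma norm_cft_le (f : E d → ℂ) (u : E d) : ‖cft f u‖ ≤ ∫ t, ‖f t‖ := by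
  refine (norm_integral_le_integral_norm _).trans_eq ?_
  simp [norm_chr]

lemma CTest.norm_cft_le {R C : ℝ} {f : E d → ℂ} (hf : CTest R C f) (u : E d) :
    ‖cft f u‖ ≤ C * volume.real (Metric.closedBall (0 : E d) R) := by
  refine (LinearRigidity.norm_cft_le f u).trans ?_
  have hz : ∀ x, x ∉ Metric.closedBall (0 : E d) R → ‖f x‖ = 0 := fun x hx => by
    rw [hf.supp x (by simpa using hx), norm_zero]
  rw [← setIntegral_eq_integral_of_forall_compl_eq_zero hz]
  refine (le_abs_self _).trans ?_
  rw [← Real.norm_eq_abs]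
  exact norm_setIntegral_le_of_norm_le_const measure_closedBall_lt_top
    (fun x _ => by simpa using hf.bdd x)

lemma continuous_cft {f : E d → ℂ} (hf : Integrable f) : Continuous (cft f) := by
  refine continuous_of_dominated (bound := fun t => ‖f t‖) (fun u => ?_) (fun u => ?_) hf.norm ?_
  · exact (integrable_chr_mul hf (-u)).aestronglyMeasurable
  · simp [norm_chr]
  · exact ae_of_all _ fun t => ((continuous_chr_left t).comp continuous_neg).mul continuous_const

lemma cft_add {f g : E d → ℂ} (hf : Integrable f) (hg : Integrable g) (u : E d) :
    cft (fun t => f t + g t) u = cft f u + cft g u := by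
  simp only [cft, mul_add]
  exact integral_add (integrable_chr_mul hf _) (integrable_chr_mul hg _)

lemma cft_sub {f g : E d → ℂ} (hf : Integrable f) (hg : Integrable g) (u : E d) :
    cft (fun t => f t - g t) u = cft f u - cft g u := by
  simp only [cft, mul_sub]
  exact integral_sub (integrable_chr_mul hf _) (integrable_chr_mul hg _)

lemma cft_const_mul (c : ℂ) (f : E d → ℂ) (u : E d) :
    cft (fun t => c * f t) u = c * cft f u := by
  simp only [cft]
  rw [← integral_const_mul]
  congr 1; ext t; ring

lemma cft_sum {ι : Type*} (s : Finset ι) {f : ι → E d → ℂ} (hf : ∀ i ∈ s, Integrable (f i))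
    (u : E d) : cft (fun t => ∑ i ∈ s, f i t) u = ∑ i ∈ s, cft (f i) u := by
  simp only [cft, Finset.mul_sum]
  exact integral_finsetSum _ fun i hi => integrable_chr_mul (hf i hi) _

lemma cft_translate (f : E d → ℂ) (a u : E d) :
    cft (fun t => f (t - a)) u = chr (-u) a * cft f u := by
  simp only [cft]
  rw [← integral_const_mul, ← integral_add_right_eq_self _ a]
  congr 1; ext t
  rw [add_sub_cancel_right, chr_add_right]; ring

lemma cft_modulate (f : E d → ℂ) (v u : E d) :
    cft (fun t => chr v t * f t) u = cft f (u - v) := by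
  simp only [cft]
  congr 1; ext t
  rw [neg_sub, sub_eq_add_neg, chr_add_left]; ring

lemma CTest.const_mul {R C : ℝ} {f : E d → ℂ} (hf : CTest R C f) (c : ℂ) :
    CTest R (‖c‖ * C) (fun t => c * f t) :=
  ⟨hf.meas.const_mul c, fun x => by
    rw [norm_mul]; exact mul_le_mul_of_nonneg_left (hf.bdd x) (norm_nonneg _),
    fun x hx => by simp [hf.supp x hx]⟩

lemma CTest.add {R C R' C' : ℝ} {f g : E d → ℂ} (hf : CTest R C f) (hg : CTest R' C' g) :
    CTest (max R R') (C + C') (fun t => f t + g t) :=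
  ⟨hf.meas.add hg.meas, fun x => (norm_add_le _ _).trans (add_le_add (hf.bdd x) (hg.bdd x)),
    fun x hx => by
      simp [hf.supp x ((le_max_left _ _).trans_lt hx), hg.supp x ((le_max_right _ _).trans_lt hx)]⟩

lemma CTest.sub {R C R' C' : ℝ} {f g : E d → ℂ} (hf : CTest R C f) (hg : CTest R' C' g) :
    CTest (max R R') (C + C') (fun t => f t - g t) :=
  ⟨hf.meas.sub hg.meas, fun x => (norm_sub_le _ _).trans (add_le_add (hf.bdd x) (hg.bdd x)),
    fun x hx => by
      simp [hf.supp x ((le_max_left _ _).trans_lt hx), hg.supp x ((le_max_right _ _).trans_lt hx)]⟩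

lemma CTest.bdd_mul {R C B : ℝ} {f g : E d → ℂ} (hf : CTest R C f) (hg : Measurable g)
    (hB : ∀ x, ‖x‖ ≤ R → ‖g x‖ ≤ B) (hB0 : 0 ≤ B) : CTest R (B * C) (fun t => g t * f t) := by
  refine ⟨hg.mul hf.meas, fun x => ?_, fun x hx => by simp [hf.supp x hx]⟩
  have hC : 0 ≤ C := (norm_nonneg _).trans (hf.bdd x)
  rcases le_or_gt ‖x‖ R with h | h
  · rw [norm_mul]; exact mul_le_mul (hB x h) (hf.bdd x) (norm_nonneg _) hB0
  · rw [hf.supp x h]; simpa using mul_nonneg hB0 hC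

lemma CTest.chr_mul {R C : ℝ} {f : E d → ℂ} (hf : CTest R C f) (v : E d) :
    CTest R C (fun t => chr v t * f t) :=
  ⟨(continuous_chr_right v).measurable.mul hf.meas, fun x => by simpa [norm_chr] using hf.bdd x,
    fun x hx => by simp [hf.supp x hx]⟩

lemma CTest.translate {R C : ℝ} {f : E d → ℂ} (hf : CTest R C f) (a : E d) :
    CTest (R + ‖a‖) C (fun t => f (t - a)) :=
  ⟨hf.meas.comp (measurable_id.sub_const a), fun x => hf.bdd _, fun x hx => hf.supp _ (by
    have := norm_sub_norm_le x a; linarith)⟩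

/-- Measures for which the Fourier transforms of all test functions are square integrable. -/
def Adm (κ : Measure (E d)) : Prop := ∀ R C (f : E d → ℂ), CTest R C f → MemLp (cft f) 2 κ

/-! ### Continuity of the Fourier transform from `L^∞` of a ball to `L²(κ)`. -/

section Bound

variable {R : ℝ}

/-- A representative of an `L^∞` function on a ball that is a test function. -/
noncomputable def ballRep (φ : Lp ℂ ∞ (volume.restrict (Metric.closedBall (0 : E d) R))) :
    E d → ℂ :=
  Set.indicator {x | ‖x‖ ≤ R ∧ ‖φ x‖ ≤ ‖φ‖} φ

lemma ctest_ballRep (φ : Lp ℂ ∞ (volume.restrict (Metric.closedBall (0 : E d) R))) :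
    CTest R ‖φ‖ (ballRep φ) := by
  have hm : Measurable φ := (Lp.stronglyMeasurable φ).measurable
  refine ⟨?_, fun x => ?_, fun x hx => ?_⟩
  · refine hm.indicator ?_
    exact (measurableSet_le measurable_norm measurable_const).inter
      (measurableSet_le hm.norm measurable_const)
  · unfold ballRep
    by_cases h : x ∈ {x | ‖x‖ ≤ R ∧ ‖φ x‖ ≤ ‖φ‖}
    · rw [Set.indicator_of_mem h]; exact h.2
    · rw [Set.indicator_of_notMem h]; simp
  · exact Set.indicator_of_notMem (fun h => absurd h.1 (not_le.2 hx)) _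

lemma ballRep_ae (φ : Lp ℂ ∞ (volume.restrict (Metric.closedBall (0 : E d) R))) :
    ballRep φ =ᵐ[volume.restrict (Metric.closedBall (0 : E d) R)] φ := by
  have h1 : ∀ᵐ x ∂(volume.restrict (Metric.closedBall (0 : E d) R)), ‖φ x‖ ≤ ‖φ‖ := by
    have := ae_le_eLpNormEssSup (f := φ) (μ := volume.restrict (Metric.closedBall (0 : E d) R))
    filter_upwards [this] with x hx
    rw [← eLpNorm_exponent_top, ← Lp.enorm_def] at hx
    simpa [enorm_le_iff_norm_le] using hx
  filter_upwards [h1, ae_restrict_mem measurableSet_closedBall] with x hx hx'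
  have hmem : x ∈ {x | ‖x‖ ≤ R ∧ ‖φ x‖ ≤ ‖φ‖} := ⟨by simpa using hx', hx⟩
  exact Set.indicator_of_mem hmem _

lemma cft_ballRep (φ : Lp ℂ ∞ (volume.restrict (Metric.closedBall (0 : E d) R))) (u : E d) :
    cft (ballRep φ) u = ∫ t in Metric.closedBall (0 : E d) R, chr (-u) t * φ t := by
  unfold cft
  rw [← setIntegral_eq_integral_of_forall_compl_eq_zero (s := Metric.closedBall (0 : E d) R)]
  · refine integral_congr_ae ?_
    filter_upwards [ballRep_ae φ] with x hx
    rw [hx]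
  · intro x hx
    rw [(ctest_ballRep φ).supp x (by simpa using hx), mul_zero]

lemma integrable_ballLp (φ : Lp ℂ ∞ (volume.restrict (Metric.closedBall (0 : E d) R))) (u : E d) :
    Integrable (fun t => chr u t * φ t) (volume.restrict (Metric.closedBall (0 : E d) R)) := by
  have := (integrable_chr_mul (ctest_ballRep φ).integrable u).integrableOn
    (s := Metric.closedBall (0 : E d) R)
  refine Integrable.congr this ?_
  filter_upwards [ballRep_ae φ] with x hx
  rw [hx]

lemma cft_ballRep_add (φ ψ : Lp ℂ ∞ (volume.restrict (Metric.closedBall (0 : E d) R))) (u : E d) :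
    cft (ballRep (φ + ψ)) u = cft (ballRep φ) u + cft (ballRep ψ) u := by
  simp only [cft_ballRep]
  rw [← integral_add (integrable_ballLp φ _) (integrable_ballLp ψ _)]
  refine integral_congr_ae ?_
  filter_upwards [Lp.coeFn_add φ ψ] with x hx
  rw [hx, Pi.add_apply, mul_add]

lemma cft_ballRep_smul (c : ℂ) (φ : Lp ℂ ∞ (volume.restrict (Metric.closedBall (0 : E d) R)))
    (u : E d) : cft (ballRep (c • φ)) u = c * cft (ballRep φ) u := by
  simp only [cft_ballRep]
  rw [← integral_const_mul]
  refine integral_congr_ae ?_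
  filter_upwards [Lp.coeFn_smul c φ] with x hx
  rw [hx, Pi.smul_apply, smul_eq_mul]; ring

/-- Closed graph theorem: `Adm` says only that the Fourier transform maps `L^∞` of a ball into
`L²(κ)`, but its graph is closed because uniform convergence on the ball forces pointwise
convergence of the transforms. The uniform bound is used for functionals on test functions and for
variances. -/
lemma Adm.exists_bound {κ : Measure (E d)} (hκ : Adm κ) (R : ℝ) :
    ∃ K : ℝ, 0 ≤ K ∧ ∀ C (f : E d → ℂ), CTest R C f →
      eLpNorm (cft f) 2 κ ≤ ENNReal.ofReal (K * C) := by
  let T : Lp ℂ ∞ (volume.restrict (Metric.closedBall (0 : E d) R)) →ₗ[ℂ] Lp ℂ 2 κ :=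
    { toFun := fun φ => (hκ _ _ _ (ctest_ballRep φ)).toLp
      map_add' := fun φ ψ => by
        rw [← MemLp.toLp_add]
        exact MemLp.toLp_congr _ _ (ae_of_all _ fun u => cft_ballRep_add φ ψ u)
      map_smul' := fun c φ => by
        rw [RingHom.id_apply, ← MemLp.toLp_const_smul]
        exact MemLp.toLp_congr _ _ (ae_of_all _ fun u => cft_ballRep_smul c φ u) }
  have hT : ∀ φ, T φ =ᵐ[κ] cft (ballRep φ) := fun φ =>
    MemLp.coeFn_toLp (hκ _ _ _ (ctest_ballRep φ))
  have hcont : Continuous T := by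
    refine T.continuous_of_seq_closed_graph fun w x y hw hy => ?_
    -- The `L²` limit is also an almost everywhere limit along a subsequence, so it must agree with
    -- the pointwise limit.
    obtain ⟨ns, hns, hae⟩ := (tendstoInMeasure_of_tendsto_Lp hy).exists_seq_tendsto_ae
    have hpt : ∀ u, Tendsto (fun n => cft (ballRep (w n)) u) atTop (𝓝 (cft (ballRep x) u)) := by
      intro u
      rw [tendsto_iff_norm_sub_tendsto_zero]
      have h0 : Tendsto (fun n => ‖w n - x‖ * volume.real (Metric.closedBall (0 : E d) R)) atTop
          (𝓝 0) := by
        simpa using (tendsto_iff_norm_sub_tendsto_zero.1 hw).mul_const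
          (volume.real (Metric.closedBall (0 : E d) R))
      refine squeeze_zero (fun _ => norm_nonneg _) (fun n => ?_) h0
      have h1 : cft (ballRep (w n)) u - cft (ballRep x) u = cft (ballRep (w n - x)) u := by
        have := cft_ballRep_add (w n - x) x u
        rw [sub_add_cancel] at this
        rw [this]; ring
      rw [h1]
      exact (ctest_ballRep _).norm_cft_le u
    apply Lp.ext
    have hall : ∀ᵐ u ∂κ, ∀ n, T (w n) u = cft (ballRep (w n)) u :=
      ae_all_iff.2 fun n => hT (w n)
    filter_upwards [hae, hall, hT x] with u h1 h2 h3
    rw [h3]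
    refine tendsto_nhds_unique h1 ?_
    simp only [Function.comp_def, h2]
    exact (hpt u).comp hns.tendsto_atTop
  let T' : Lp ℂ ∞ (volume.restrict (Metric.closedBall (0 : E d) R)) →L[ℂ] Lp ℂ 2 κ := ⟨T, hcont⟩
  refine ⟨‖T'‖, norm_nonneg _, fun C f hf => ?_⟩
  have hC : 0 ≤ C := (norm_nonneg _).trans (hf.bdd 0)
  have hm : MemLp f ∞ (volume.restrict (Metric.closedBall (0 : E d) R)) :=
    memLp_top_of_bound hf.meas.aestronglyMeasurable C (ae_of_all _ hf.bdd)
  have hφ : ‖hm.toLp‖ ≤ C := by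
    rw [Lp.norm_toLp, eLpNorm_exponent_top]
    refine ENNReal.toReal_le_of_le_ofReal hC ?_
    refine eLpNormEssSup_le_of_ae_bound (ae_of_all _ hf.bdd)
  have hfe : cft (ballRep hm.toLp) = cft f := by
    ext u
    have h0 : cft f u = ∫ t in Metric.closedBall (0 : E d) R, chr (-u) t * f t :=
      (setIntegral_eq_integral_of_forall_compl_eq_zero fun x hx => by
        rw [hf.supp x (by simpa using hx), mul_zero]).symm
    rw [cft_ballRep, h0]
    refine integral_congr_ae ?_
    filter_upwards [hm.coeFn_toLp] with x hx
    rw [hx]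
  have h1 : ‖T' hm.toLp‖ ≤ ‖T'‖ * C :=
    (T'.le_opNorm _).trans (mul_le_mul_of_nonneg_left hφ (norm_nonneg _))
  have h2 : eLpNorm (cft f) 2 κ = ‖T' hm.toLp‖ₑ := by
    rw [Lp.enorm_def, ← hfe]
    exact (eLpNorm_congr_ae (hT _)).symm
  rw [h2, ← ofReal_norm]
  exact ENNReal.ofReal_le_ofReal h1

end Bound

end ComplexTest

/-! ### Uniqueness of Fourier transforms of integrable densities. -/

section Uniqueness

variable {d : ℕ}

lemma integral_withDensity_ofReal {α : Type*} [MeasurableSpace α] {μ : Measure α} {a : α → ℝ}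
    (ha : AEMeasurable a μ) (ha0 : ∀ x, 0 ≤ a x) (h : α → ℂ) :
    ∫ x, h x ∂(μ.withDensity fun x => ENNReal.ofReal (a x)) = ∫ x, (a x : ℂ) * h x ∂μ := by
  rw [integral_withDensity_eq_integral_toReal_smul₀ ha.ennreal_ofReal
    (ae_of_all _ fun x => ENNReal.ofReal_lt_top)]
  refine integral_congr_ae (ae_of_all _ fun x => ?_)
  simp [ENNReal.toReal_ofReal (ha0 x)]

lemma isFiniteMeasure_withDensity_ofReal_of_integrable {α : Type*} [MeasurableSpace α]
    {μ : Measure α} {a : α → ℝ} (ha : Integrable a μ) :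
    IsFiniteMeasure (μ.withDensity fun x => ENNReal.ofReal (a x)) :=
  isFiniteMeasure_withDensity_ofReal ha.2

/-- Signed densities reduce to the uniqueness theorem for characteristic functions of finite
positive measures: adding `|G₁| μ₁ + |G₂| μ₂` to both sides of `G₁ μ₁ = G₂ μ₂` leaves only
nonnegative densities. -/
lemma setIntegral_eq_of_char_real {μ₁ μ₂ : Measure (E d)} {G₁ G₂ : E d → ℝ}
    (h₁ : Integrable G₁ μ₁) (h₂ : Integrable G₂ μ₂)
    (h : ∀ a, ∫ u, chr a u * (G₁ u : ℂ) ∂μ₁ = ∫ u, chr a u * (G₂ u : ℂ) ∂μ₂)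
    {B : Set (E d)} (hB : MeasurableSet B) :
    ∫ u in B, G₁ u ∂μ₁ = ∫ u in B, G₂ u ∂μ₂ := by
  have a1 : Integrable (fun x => |G₁ x| + G₁ x) μ₁ := h₁.abs.add h₁
  have a2 : Integrable (fun x => |G₂ x| + G₂ x) μ₂ := h₂.abs.add h₂
  have n1 : ∀ x, 0 ≤ |G₁ x| + G₁ x := fun x => by linarith [neg_abs_le (G₁ x)]
  have n2 : ∀ x, 0 ≤ |G₂ x| + G₂ x := fun x => by linarith [neg_abs_le (G₂ x)]
  have f1 := isFiniteMeasure_withDensity_ofReal_of_integrable a1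
  have f2 := isFiniteMeasure_withDensity_ofReal_of_integrable a2
  have f3 := isFiniteMeasure_withDensity_ofReal_of_integrable h₁.abs
  have f4 := isFiniteMeasure_withDensity_ofReal_of_integrable h₂.abs
  have key : (μ₁.withDensity fun x => ENNReal.ofReal (|G₁ x| + G₁ x)) +
      (μ₂.withDensity fun x => ENNReal.ofReal (|G₂ x|)) =
      (μ₁.withDensity fun x => ENNReal.ofReal (|G₁ x|)) +
      (μ₂.withDensity fun x => ENNReal.ofReal (|G₂ x| + G₂ x)) := by
    refine Measure.ext_of_charFun (funext fun t => ?_)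
    have hc : ∀ x : E d, Complex.exp ((inner ℝ x t : ℝ) * Complex.I) = chr t x := fun x => by
      rw [chr, mul_comm, real_inner_comm]
    have hint : ∀ (ν : Measure (E d)) [IsFiniteMeasure ν], Integrable (fun x => chr t x) ν :=
      fun ν _ => (integrable_const (1 : ℝ)).mono'
        (continuous_chr_right t).aestronglyMeasurable (ae_of_all _ fun x => (norm_chr t x).le)
    have hi : ∀ {μ : Measure (E d)} {G : E d → ℝ}, Integrable G μ →
        Integrable (fun x => (G x : ℂ) * chr t x) μ := fun hG =>
      hG.ofReal.mul_bdd (c := 1) (continuous_chr_right t).aestronglyMeasurable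
        (ae_of_all _ fun x => (norm_chr t x).le)
    simp only [charFun_apply, hc]
    rw [integral_add_measure (hint _) (hint _), integral_add_measure (hint _) (hint _),
      integral_withDensity_ofReal a1.aemeasurable n1,
      integral_withDensity_ofReal a2.aemeasurable n2,
      integral_withDensity_ofReal h₁.abs.aemeasurable (fun _ => abs_nonneg _),
      integral_withDensity_ofReal h₂.abs.aemeasurable (fun _ => abs_nonneg _)]
    have e1 : ∫ x, ((|G₁ x| + G₁ x : ℝ) : ℂ) * chr t x ∂μ₁ =
        ∫ x, ((|G₁ x| : ℝ) : ℂ) * chr t x ∂μ₁ + ∫ x, chr t x * (G₁ x : ℂ) ∂μ₁ := by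
      rw [← integral_add (hi h₁.abs) (by simpa only [mul_comm] using hi h₁)]
      congr 1; ext x; push_cast; ring
    have e2 : ∫ x, ((|G₂ x| + G₂ x : ℝ) : ℂ) * chr t x ∂μ₂ =
        ∫ x, ((|G₂ x| : ℝ) : ℂ) * chr t x ∂μ₂ + ∫ x, chr t x * (G₂ x : ℂ) ∂μ₂ := by
      rw [← integral_add (hi h₂.abs) (by simpa only [mul_comm] using hi h₂)]
      congr 1; ext x; push_cast; ring
    rw [e1, e2, h t]; ring
  have hBk := congrArg (fun ν => (ν B).toReal) key
  have hw : ∀ {μ : Measure (E d)} {a : E d → ℝ}, Integrable a μ → (∀ x, 0 ≤ a x) →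
      ((μ.withDensity fun x => ENNReal.ofReal (a x)) B).toReal = ∫ x in B, a x ∂μ := by
    intro μ a ha ha0
    rw [withDensity_apply _ hB, integral_eq_lintegral_of_nonneg_ae (ae_of_all _ ha0)
      ha.aestronglyMeasurable.restrict]
  simp only [Measure.add_apply] at hBk
  rw [ENNReal.toReal_add (measure_ne_top _ _) (measure_ne_top _ _),
    ENNReal.toReal_add (measure_ne_top _ _) (measure_ne_top _ _), hw a1 n1, hw a2 n2,
    hw h₁.abs (fun _ => abs_nonneg _), hw h₂.abs (fun _ => abs_nonneg _),
    integral_add h₁.abs.integrableOn h₁.integrableOn,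
    integral_add h₂.abs.integrableOn h₂.integrableOn] at hBk
  linarith

/-- Integrable complex densities are determined by their Fourier transforms. -/
lemma setIntegral_eq_of_char {μ₁ μ₂ : Measure (E d)} {G₁ G₂ : E d → ℂ}
    (h₁ : Integrable G₁ μ₁) (h₂ : Integrable G₂ μ₂)
    (h : ∀ a, ∫ u, chr a u * G₁ u ∂μ₁ = ∫ u, chr a u * G₂ u ∂μ₂)
    {B : Set (E d)} (hB : MeasurableSet B) :
    ∫ u in B, G₁ u ∂μ₁ = ∫ u in B, G₂ u ∂μ₂ := by
  have hi : ∀ {μ : Measure (E d)} {G : E d → ℂ} (a : E d), Integrable G μ →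
      Integrable (fun x => chr a x * G x) μ := fun a hG =>
    hG.bdd_mul (continuous_chr_right a).aestronglyMeasurable
      (ae_of_all _ fun x => (norm_chr a x).le)
  have hconj : ∀ (μ : Measure (E d)) (G : E d → ℂ) (a : E d),
      ∫ u, chr a u * (starRingEnd ℂ) (G u) ∂μ = (starRingEnd ℂ) (∫ u, chr (-a) u * G u ∂μ) := by
    intro μ G a
    rw [← integral_conj]
    congr 1; ext u
    rw [map_mul, conj_chr, neg_neg]
  have hcon : ∀ a, ∫ u, chr a u * (starRingEnd ℂ) (G₁ u) ∂μ₁ =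
      ∫ u, chr a u * (starRingEnd ℂ) (G₂ u) ∂μ₂ := fun a => by rw [hconj, hconj, h]
  have hIc : ∀ {μ : Measure (E d)} {G : E d → ℂ}, Integrable G μ →
      Integrable (fun x => (starRingEnd ℂ) (G x)) μ := fun hG =>
    (Complex.conjLIE.toContinuousLinearEquiv.toContinuousLinearMap.integrable_comp hG)
  have hre : ∫ u in B, (G₁ u).re ∂μ₁ = ∫ u in B, (G₂ u).re ∂μ₂ := by
    refine setIntegral_eq_of_char_real h₁.re h₂.re (fun a => ?_) hB
    have e : ∀ {μ : Measure (E d)} {G : E d → ℂ}, Integrable G μ →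
        ∫ u, chr a u * ((G u).re : ℂ) ∂μ =
        (1 / 2) * (∫ u, chr a u * G u ∂μ + ∫ u, chr a u * (starRingEnd ℂ) (G u) ∂μ) := by
      intro μ G hG
      rw [← integral_add (hi a hG) (hi a (hIc hG)), ← integral_const_mul]
      congr 1; ext u
      rw [Complex.re_eq_add_conj]; ring
    exact (e h₁).trans ((by rw [h, hcon]) : _ = _).symm.symm |>.trans (e h₂).symm
  have him : ∫ u in B, (G₁ u).im ∂μ₁ = ∫ u in B, (G₂ u).im ∂μ₂ := by
    refine setIntegral_eq_of_char_real h₁.im h₂.im (fun a => ?_) hB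
    have e : ∀ {μ : Measure (E d)} {G : E d → ℂ}, Integrable G μ →
        ∫ u, chr a u * ((G u).im : ℂ) ∂μ =
        (1 / (2 * Complex.I)) *
          (∫ u, chr a u * G u ∂μ - ∫ u, chr a u * (starRingEnd ℂ) (G u) ∂μ) := by
      intro μ G hG
      rw [← integral_sub (hi a hG) (hi a (hIc hG)), ← integral_const_mul]
      congr 1; ext u
      rw [Complex.im_eq_sub_conj]; ring
    exact (e h₁).trans ((by rw [h, hcon]) : _ = _).symm.symm |>.trans (e h₂).symm
  have hri : ∀ {μ : Measure (E d)} {G : E d → ℂ}, Integrable G μ →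
      ∫ u in B, G u ∂μ = ((∫ u in B, (G u).re ∂μ : ℝ) : ℂ) +
        ((∫ u in B, (G u).im ∂μ : ℝ) : ℂ) * Complex.I := fun hG =>
    (integral_re_add_im (𝕜 := ℂ) hG.integrableOn).symm
  rw [hri h₁, hri h₂, hre, him]

end Uniqueness

/-! ### Local finiteness of admissible measures. -/

section Local

variable {d : ℕ} {κ : Measure (E d)}

lemma ctest_indicator_ball (η : ℝ) :
    CTest η 1 ((Metric.ball (0 : E d) η).indicator fun _ => (1 : ℂ)) :=
  ⟨measurable_const.indicator measurableSet_ball, fun x => by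
    by_cases h : x ∈ Metric.ball (0 : E d) η <;> simp [h], fun x hx => by
    rw [Set.indicator_of_notMem]; simpa using hx.le⟩

/-- Modulating the indicator of a ball translates its transform, which stays away from `0` near the
new centre `x`. Square integrability and Chebyshev's inequality then bound the mass near `x`. -/
lemma Adm.isLocallyFiniteMeasure (hκ : Adm κ) : IsLocallyFiniteMeasure κ := by
  set f : E d → ℂ := (Metric.ball (0 : E d) 1).indicator fun _ => (1 : ℂ) with hf
  have hft := ctest_indicator_ball (d := d) 1
  rw [← hf] at hft
  have h0 : cft f 0 ≠ 0 := by
    have : cft f 0 = ((volume.real (Metric.ball (0 : E d) 1) : ℝ) : ℂ) := by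
      simp only [cft, neg_zero, chr_zero_left, one_mul, hf]
      rw [integral_indicator measurableSet_ball]
      simp
    rw [this]
    have : 0 < volume.real (Metric.ball (0 : E d) 1) :=
      ENNReal.toReal_pos (Metric.measure_ball_pos _ _ one_pos).ne' measure_ball_lt_top.ne
    exact_mod_cast this.ne'
  have hc := continuous_cft hft.integrable
  have hpos : 0 < ‖cft f 0‖ / 2 := by positivity
  obtain ⟨ρ, hρ, hball⟩ := Metric.continuous_iff.1 hc 0 (‖cft f 0‖ / 2) hpos
  refine ⟨fun x => ⟨Metric.ball x ρ, Metric.ball_mem_nhds x hρ, ?_⟩⟩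
  have hm := hκ _ _ _ (hft.chr_mul x)
  have hlt := hm.meas_ge_lt_top two_ne_zero ENNReal.ofNat_ne_top
    (ε := Real.toNNReal (‖cft f 0‖ / 2)) (by simpa using hpos)
  refine lt_of_le_of_lt (measure_mono fun u hu => ?_) hlt
  have h1 := hball (u - x) (by simpa [dist_eq_norm] using hu)
  rw [dist_eq_norm] at h1
  have h2 := norm_sub_norm_le (cft f 0) (cft f (u - x))
  rw [norm_sub_rev] at h2
  change (_ : NNReal) ≤ _
  rw [Real.toNNReal_le_iff_le_coe, cft_modulate, coe_nnnorm]
  linarith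

end Local

/-! ### The functionals `f ↦ ∫ f̂ g dκ` and their transforms. -/

section Functional

variable {d : ℕ} {κ : Measure (E d)}

/-- The linear functional `f ↦ ∫ f̂ g dκ`. -/
noncomputable def specFun (κ : Measure (E d)) (g : E d → ℂ) (f : E d → ℂ) : ℂ :=
  ∫ u, cft f u * g u ∂κ

lemma Adm.integrable_mul (hκ : Adm κ) {g : E d → ℂ} (hg : MemLp g 2 κ) {R C : ℝ} {f : E d → ℂ}
    (hf : CTest R C f) : Integrable (fun u => cft f u * g u) κ :=
  (hκ _ _ _ hf).integrable_mul hg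

lemma specFun_sub (hκ : Adm κ) {g : E d → ℂ} (hg : MemLp g 2 κ) {R C R' C' : ℝ} {f f' : E d → ℂ}
    (hf : CTest R C f) (hf' : CTest R' C' f') :
    specFun κ g (fun t => f t - f' t) = specFun κ g f - specFun κ g f' := by
  unfold specFun
  rw [← integral_sub (hκ.integrable_mul hg hf) (hκ.integrable_mul hg hf')]
  congr 1; ext u
  rw [cft_sub hf.integrable hf'.integrable]; ring

lemma specFun_const_mul (g : E d → ℂ) (c : ℂ) (f : E d → ℂ) :
    specFun κ g (fun t => c * f t) = c * specFun κ g f := by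
  unfold specFun
  rw [← integral_const_mul]
  congr 1; ext u
  rw [cft_const_mul]; ring

lemma specFun_sum (hκ : Adm κ) {g : E d → ℂ} (hg : MemLp g 2 κ) {ι : Type*} (s : Finset ι)
    {R C : ι → ℝ} {f : ι → E d → ℂ} (hf : ∀ i, CTest (R i) (C i) (f i)) :
    specFun κ g (fun t => ∑ i ∈ s, f i t) = ∑ i ∈ s, specFun κ g (f i) := by
  unfold specFun
  rw [← integral_finsetSum _ fun i _ => hκ.integrable_mul hg (hf i)]
  congr 1; ext u
  rw [cft_sum _ fun i _ => (hf i).integrable, Finset.sum_mul]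

/-- Cauchy-Schwarz on top of `Adm.exists_bound`. The absolute value stays inside the integral
because this form is what Fubini requires in `specFun_eq_integral`. -/
lemma Adm.exists_bound_abs (hκ : Adm κ) {g : E d → ℂ} (hg : MemLp g 2 κ) (R : ℝ) :
    ∃ K : ℝ, 0 ≤ K ∧ ∀ C (f : E d → ℂ), CTest R C f →
      ∫ u, ‖cft f u * g u‖ ∂κ ≤ K * C := by
  obtain ⟨K, hK, h⟩ := hκ.exists_bound R
  refine ⟨K * (eLpNorm g 2 κ).toReal, by positivity, fun C f hf => ?_⟩
  have hC : 0 ≤ C := (norm_nonneg _).trans (hf.bdd 0)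
  have hint := hκ.integrable_mul hg hf
  have h1 : ENNReal.ofReal (∫ u, ‖cft f u * g u‖ ∂κ) ≤
      ENNReal.ofReal (K * (eLpNorm g 2 κ).toReal * C) := by
    rw [ofReal_integral_norm_eq_lintegral_enorm hint, ← eLpNorm_one_eq_lintegral_enorm]
    have h2 := eLpNorm_smul_le_mul_eLpNorm (p := 2) (q := 2) (r := 1) hg.1 (hκ _ _ _ hf).1
    refine (le_trans h2 (mul_le_mul_left (h C f hf) _)).trans_eq ?_
    rw [← ENNReal.ofReal_toReal hg.2.ne, ← ENNReal.ofReal_mul (by positivity),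
      ENNReal.toReal_ofReal ENNReal.toReal_nonneg]
    congr 1; ring
  exact (ENNReal.ofReal_le_ofReal_iff (by positivity)).1 h1

lemma Adm.exists_bound_specFun (hκ : Adm κ) {g : E d → ℂ} (hg : MemLp g 2 κ) (R : ℝ) :
    ∃ K : ℝ, 0 ≤ K ∧ ∀ C (f : E d → ℂ), CTest R C f → ‖specFun κ g f‖ ≤ K * C := by
  obtain ⟨K, hK, h⟩ := hκ.exists_bound_abs hg R
  exact ⟨K, hK, fun C f hf => (norm_integral_le_integral_norm _).trans (h C f hf)⟩

/-- The Fourier transform of the functional `specFun`, restricted to the ball of radius `η`. -/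
noncomputable def specTransform (κ : Measure (E d)) (g : E d → ℂ) (η : ℝ) (v : E d) : ℂ :=
  specFun κ g fun t => chr v t * (Metric.ball (0 : E d) η).indicator (fun _ => (1 : ℂ)) t

lemma Adm.exists_norm_specTransform_le (hκ : Adm κ) {g : E d → ℂ} (hg : MemLp g 2 κ) (η : ℝ) :
    ∃ B : ℝ, ∀ v, ‖specTransform κ g η v‖ ≤ B := by
  obtain ⟨K, hK, h⟩ := hκ.exists_bound_specFun hg η
  exact ⟨K * 1, fun v => h 1 _ ((ctest_indicator_ball η).chr_mul v)⟩

lemma measurable_specTransform [SFinite κ] {g : E d → ℂ} (hg : Measurable g) (η : ℝ) :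
    Measurable (specTransform κ g η) := by
  have : specTransform κ g η = fun v => ∫ u,
      cft ((Metric.ball (0 : E d) η).indicator fun _ => (1 : ℂ)) (u - v) * g u ∂κ := by
    ext v
    simp only [specTransform, specFun, cft_modulate]
  rw [this]
  have hc := (continuous_cft (ctest_indicator_ball (d := d) η).integrable).measurable
  have : Measurable (fun p : E d × E d =>
      cft ((Metric.ball (0 : E d) η).indicator fun _ => (1 : ℂ)) (p.2 - p.1) * g p.2) :=
    (hc.comp (measurable_snd.sub measurable_fst)).mul (hg.comp measurable_snd)
  exact (this.stronglyMeasurable.integral_prod_right (ν := κ)).measurable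

/-- A functional vanishing on functions that vanish on the ball is given, on smooth functions, by
the density `specTransform`. -/
lemma specFun_eq_integral [SFinite κ] (hκ : Adm κ) {g : E d → ℂ} (hg : MemLp g 2 κ)
    (hgm : Measurable g) {η : ℝ}
    (hkill : ∀ R C (f : E d → ℂ), CTest R C f → (∀ x ∈ Metric.ball (0 : E d) η, f x = 0) →
      specFun κ g f = 0)
    {R C : ℝ} {f : E d → ℂ} (hf : CTest R C f) {F : E d → ℂ} (hF : Integrable F) (hFm : Measurable F)
    {c : ℂ} (hinv : ∀ t, f t = c * ∫ v, chr v t * F v) :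
    specFun κ g f = c * ∫ v, F v * specTransform κ g η v := by
  set χ : E d → ℂ := (Metric.ball (0 : E d) η).indicator fun _ => (1 : ℂ) with hχ
  have hχt : CTest η 1 χ := ctest_indicator_ball η
  have hχf : CTest R (1 * C) (fun t => χ t * f t) :=
    hf.bdd_mul hχt.meas (fun x _ => hχt.bdd x) zero_le_one
  -- The functional does not see `f` off the ball, so `f` may be cut off by the indicator `χ` before
  -- Fourier inversion is inserted.
  have h1 : specFun κ g f = specFun κ g (fun t => χ t * f t) := by
    have h2 := hkill _ _ _ (hf.sub hχf) (fun x hx => by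
      rw [hχ, Set.indicator_of_mem hx]; ring)
    rw [specFun_sub hκ hg hf hχf, sub_eq_zero] at h2
    exact h2
  have h3 : ∀ u, cft (fun t => χ t * f t) u = c * ∫ v, F v * cft χ (u - v) := by
    intro u
    have e1 : cft (fun t => χ t * f t) u =
        c * ∫ t, ∫ v, chr (-u) t * χ t * (chr v t * F v) := by
      rw [← integral_const_mul, cft]
      congr 1; ext t
      rw [hinv t, integral_const_mul]; ring
    have hprod : Integrable (fun p : E d × E d => χ p.1 * F p.2) (volume.prod volume) :=
      hχt.integrable.mul_prod hF
    have hint : Integrable (Function.uncurry fun t v => chr (-u) t * χ t * (chr v t * F v))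
        (volume.prod volume) := by
      have hm : AEStronglyMeasurable (fun p : E d × E d => chr (-u) p.1 * chr p.2 p.1)
          (volume.prod volume) := by
        refine Continuous.aestronglyMeasurable ?_
        exact ((continuous_chr_right _).comp continuous_fst).mul
          (continuous_chr.comp (continuous_snd.prodMk continuous_fst))
      have := hprod.bdd_mul (c := 1) hm (ae_of_all _ fun p => by simp [norm_chr])
      refine this.congr (ae_of_all _ fun p => ?_)
      simp only [Function.uncurry]; ring
    rw [e1, integral_integral_swap hint]
    congr 2; ext v
    rw [← cft_modulate, cft, ← integral_const_mul]
    congr 1; ext t; ring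
  rw [h1, specFun]
  have e2 : ∫ u, cft (fun t => χ t * f t) u * g u ∂κ =
      c * ∫ u, (∫ v, F v * (cft χ (u - v) * g u)) ∂κ := by
    rw [← integral_const_mul]
    congr 1; ext u
    rw [h3, mul_assoc, ← integral_mul_const]
    congr 2; ext v; ring
  have hχc := (continuous_cft hχt.integrable).measurable
  obtain ⟨K, hK, hbd⟩ := hκ.exists_bound_abs hg η
  have hcv : ∀ v, (fun u => cft χ (u - v) * g u) = fun u => cft (fun t => chr v t * χ t) u * g u :=
    fun v => by ext u; rw [cft_modulate]
  have hint2 : Integrable (Function.uncurry fun v u => F v * (cft χ (u - v) * g u))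
      (volume.prod κ) := by
    have hm : Measurable (Function.uncurry fun v u => F v * (cft χ (u - v) * g u)) :=
      (hFm.comp measurable_fst).mul
        ((hχc.comp (measurable_snd.sub measurable_fst)).mul (hgm.comp measurable_snd))
    rw [integrable_prod_iff hm.aestronglyMeasurable]
    refine ⟨ae_of_all _ fun v => ?_, ?_⟩
    · simp only [Function.uncurry]
      refine Integrable.const_mul ?_ _
      rw [hcv]
      exact hκ.integrable_mul hg (hχt.chr_mul v)
    · refine (hF.norm.mul_const (K * 1)).mono' ?_ (ae_of_all _ fun v => ?_)
      · exact hm.norm.stronglyMeasurable.integral_prod_right.aestronglyMeasurable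
      · simp only [Function.uncurry, norm_mul (F v)]
        rw [integral_const_mul, norm_mul, norm_norm]
        refine mul_le_mul_of_nonneg_left ?_ (norm_nonneg _)
        rw [Real.norm_of_nonneg (integral_nonneg fun _ => norm_nonneg _)]
        have := hbd 1 _ (hχt.chr_mul v)
        simpa only [cft_modulate] using this
  rw [e2, ← integral_integral_swap hint2]
  congr 2; ext v
  rw [integral_const_mul, specTransform, specFun, hcv]

end Functional

/-! ### Fourier inversion for Schwartz functions, and bump functions. -/

section Inversion

open scoped FourierTransform SchwartzMap

variable {d : ℕ}

lemma cft_eq_fourier (f : E d → ℂ) (u : E d) : cft f u = 𝓕 f ((2 * Real.pi)⁻¹ • u) := by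
  rw [Real.fourier_eq', cft]
  congr 1; ext t
  rw [chr, smul_eq_mul, inner_smul_right, inner_neg_left, real_inner_comm]
  congr 2
  have : (Real.pi : ℂ) ≠ 0 := by exact_mod_cast Real.pi_ne_zero
  push_cast
  field_simp

lemma integrable_cft_schwartz (φ : 𝓢(E d, ℂ)) : Integrable (cft φ) := by
  have h : cft φ = fun u => (𝓕 φ : 𝓢(E d, ℂ)) ((2 * Real.pi)⁻¹ • u) := by
    ext u; rw [cft_eq_fourier, SchwartzMap.fourier_coe]
  rw [h]
  exact (SchwartzMap.integrable _).comp_smul (by positivity)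

lemma schwartz_eq_integral_cft (φ : 𝓢(E d, ℂ)) (t : E d) :
    φ t = ((((2 * Real.pi) ^ d)⁻¹ : ℝ) : ℂ) * ∫ v, chr v t * cft φ v := by
  have h1 : φ t = 𝓕⁻ (𝓕 (φ : E d → ℂ)) t := by
    rw [Continuous.fourierInv_fourier_eq φ.continuous φ.integrable]
    rw [← SchwartzMap.fourier_coe]; exact SchwartzMap.integrable _
  have h2 := Measure.integral_comp_smul (volume : Measure (E d))
    (fun w => chr ((2 * Real.pi) • w) t * 𝓕 (φ : E d → ℂ) w) (2 * Real.pi)⁻¹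
  have h3 : ∀ v : E d, (2 * Real.pi) • (2 * Real.pi)⁻¹ • v = v := fun v => by
    rw [smul_smul, mul_inv_cancel₀ (by positivity), one_smul]
  simp only [h3, ← cft_eq_fourier] at h2
  rw [h2, h1, Real.fourierInv_eq']
  have hd : Module.finrank ℝ (E d) = d := by simp
  rw [hd, abs_of_pos (by positivity), Complex.real_smul, ← mul_assoc, ← Complex.ofReal_mul]
  have : ((2 * Real.pi) ^ d)⁻¹ * ((2 * Real.pi)⁻¹ ^ d)⁻¹ = 1 := by
    rw [inv_pow, inv_inv]; exact inv_mul_cancel₀ (by positivity)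
  rw [this, Complex.ofReal_one, one_mul]
  congr 1; ext w
  rw [chr, smul_eq_mul, inner_smul_left, real_inner_comm]
  congr 2
  simp
  ring

lemma exists_bump (d : ℕ) {r : ℝ} (hr : 0 < r) : ∃ φ : 𝓢(E d, ℂ),
    tsupport φ ⊆ Metric.closedBall 0 r ∧ CTest r 1 φ ∧ ∫ t, φ t ≠ 0 := by
  let b : ContDiffBump (0 : E d) := ⟨r / 2, r, by positivity, by linarith⟩
  have hc : HasCompactSupport (fun x => ((b x : ℝ) : ℂ)) :=
    b.hasCompactSupport.comp_left (g := Complex.ofReal) Complex.ofReal_zero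
  have hs : ContDiff ℝ ((⊤ : ℕ∞) : WithTop ℕ∞) (fun x => ((b x : ℝ) : ℂ)) :=
    Complex.ofRealCLM.contDiff.comp b.contDiff
  refine ⟨hc.toSchwartzMap hs, ?_, ⟨?_, ?_, ?_⟩, ?_⟩
  · have : (hc.toSchwartzMap hs : E d → ℂ) = fun x => ((b x : ℝ) : ℂ) := by ext; simp
    rw [this]
    refine (closure_mono (fun x hx => ?_)).trans b.tsupport_eq.subset
    rw [Function.mem_support] at hx ⊢
    exact fun h => hx (by simp [h])
  · exact (hc.toSchwartzMap hs).continuous.measurable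
  · intro x
    simpa [abs_of_nonneg b.nonneg] using b.le_one
  · intro x hx
    have : b x = 0 := b.zero_of_le_dist (by simpa using hx.le)
    simp [this]
  · have h := b.integral_pos (μ := volume)
    have : ∫ t, (hc.toSchwartzMap hs) t = ((∫ t, b t : ℝ) : ℂ) := by
      rw [← integral_complex_ofReal]; rfl
    rw [this]
    exact_mod_cast h.ne'

end Inversion

/-! ### The transform of an annihilating functional is proportional to `s g` near the origin. -/

section Density

open scoped FourierTransform SchwartzMap

variable {d : ℕ} {κ : Measure (E d)}

/-- Near the origin, a functional that vanishes on functions that vanish on a ball has, with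
respect to Lebesgue measure, its transform as a density. -/
lemma specTransform_ae_eq [SFinite κ] (hκ : Adm κ) {g : E d → ℂ} (hg : MemLp g 2 κ)
    (hgm : Measurable g) {η : ℝ}
    (hkill : ∀ R C (f : E d → ℂ), CTest R C f → (∀ x ∈ Metric.ball (0 : E d) η, f x = 0) →
      specFun κ g f = 0)
    {s : E d → ℝ≥0∞} (hs : Measurable s) (hfin : ∀ᵐ v : E d, s v < ∞)
    {N : Set (E d)} (hNm : MeasurableSet N) (hN : volume N = 0)
    (hdec : κ.restrict Nᶜ = (volume.withDensity s).restrict Nᶜ) :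
    ∃ ρ : ℝ, 0 < ρ ∧ ∃ c : ℂ, c ≠ 0 ∧ ∀ᵐ v : E d, v ∈ Metric.ball (0 : E d) ρ →
      c * specTransform κ g η v = ((s v).toReal : ℂ) * g v := by
  obtain ⟨φ, -, hφ, hφ0⟩ := exists_bump d one_pos
  set F := cft φ with hFdef
  have hFi : Integrable F := integrable_cft_schwartz φ
  have hFc : Continuous F := continuous_cft φ.integrable
  have hF0 : F 0 ≠ 0 := by simpa [hFdef, cft] using hφ0
  set c : ℂ := ((((2 * Real.pi) ^ d)⁻¹ : ℝ) : ℂ) with hc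
  have hc0 : c ≠ 0 := by
    rw [hc]; exact_mod_cast (by positivity : ((2 * Real.pi) ^ d)⁻¹ ≠ 0)
  have hψm : Measurable (specTransform κ g η) := measurable_specTransform hgm η
  obtain ⟨B, hB⟩ := hκ.exists_norm_specTransform_le hg η
  have hG1 : Integrable (fun u => F u * g u) κ := hκ.integrable_mul hg hφ
  have hG2 : Integrable (fun v => c * (F v * specTransform κ g η v)) :=
    (hFi.mul_bdd (c := B) hψm.aestronglyMeasurable (ae_of_all _ hB)).const_mul c
  -- Translating `φ` multiplies its transform by a character. Applied to all translates,
  -- `specFun_eq_integral` says that `F g κ` and `c F ψ dv` have the same Fourier transform.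
  have htr : ∀ a, ∫ u, chr a u * (F u * g u) ∂κ =
      ∫ v, chr a v * (c * (F v * specTransform κ g η v)) := by
    intro a
    have hneg : ∀ u : E d, chr (-u) (-a) = chr a u := fun u => by
      rw [chr_comm a u]; simp [chr]
    have hFa : ∀ u, cft (fun t => φ (t - -a)) u = chr a u * F u := fun u => by
      rw [cft_translate, hneg]
    have hFai : Integrable (fun u => chr a u * F u) := integrable_chr_mul hFi a
    have hmeas : Measurable (fun u => chr a u * F u) :=
      (continuous_chr_right a).measurable.mul hFc.measurable
    have h1 := specFun_eq_integral hκ hg hgm hkill (hφ.translate (-a)) hFai hmeas (c := c)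
      (fun t => by
        rw [schwartz_eq_integral_cft φ (t - -a)]
        congr 2; ext v
        rw [sub_neg_eq_add, chr_add_right, chr_comm v a, chr_comm a v]
        rw [chr_comm v a]; ring)
    rw [specFun] at h1
    simp only [hFa] at h1
    rw [← integral_const_mul] at h1
    calc ∫ u, chr a u * (F u * g u) ∂κ = ∫ u, chr a u * F u * g u ∂κ := by
          congr 1; ext u; ring
      _ = _ := h1
      _ = _ := by congr 1; ext v; ring
  have hset := fun (B : Set (E d)) (hB : MeasurableSet B) =>
    setIntegral_eq_of_char hG1 hG2 htr hB
  have hNae : ∀ᵐ v : E d, v ∈ Nᶜ := by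
    rw [ae_iff]; simpa using hN
  have hG1' : Integrable (fun u => F u * g u) (volume.withDensity s) := by
    have h1 : IntegrableOn (fun u => F u * g u) Nᶜ κ := hG1.integrableOn
    rw [IntegrableOn, hdec] at h1
    have h2 : (volume.withDensity s).restrict Nᶜ = volume.withDensity s := by
      refine Measure.restrict_eq_self_of_ae_mem ?_
      refine (withDensity_absolutelyContinuous _ s).ae_le ?_
      exact hNae
    rwa [h2] at h1
  have hG3 : Integrable (fun v => ((s v).toReal : ℂ) * (F v * g v)) := by
    rw [integrable_withDensity_iff_integrable_smul' hs hfin] at hG1'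
    refine hG1'.congr (ae_of_all _ fun v => ?_)
    simp
  -- The two measures are compared off the null set `N`, where `κ` has density `s`.
  have hae := Integrable.ae_eq_of_forall_setIntegral_eq _ _ hG2 hG3 (fun B hB _ => by
    have e0 : (volume : Measure (E d)).restrict (B ∩ Nᶜ) = volume.restrict B := by
      rw [← Measure.restrict_restrict hB, Measure.restrict_eq_self_of_ae_mem hNae]
    rw [← e0, ← hset _ (hB.inter hNm.compl),
      ← Measure.restrict_restrict hB, hdec, Measure.restrict_restrict hB,
      setIntegral_withDensity_eq_setIntegral_toReal_smul₀ hs.aemeasurable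
        (ae_restrict_of_ae hfin) _ (hB.inter hNm.compl)]
    refine integral_congr_ae (ae_of_all _ fun v => ?_)
    simp)
  -- The factor `F` can be divided out near `0` since `F 0 = ∫ φ ≠ 0`.
  obtain ⟨ρ, hρ, hball⟩ := Metric.mem_nhds_iff.1 (hFc.continuousAt.eventually_ne hF0)
  refine ⟨ρ, hρ, c, hc0, ?_⟩
  filter_upwards [hae] with v hv hvρ
  have hFv : F v ≠ 0 := hball hvρ
  refine mul_left_cancel₀ hFv ?_
  linear_combination hv

/-- From `c ψ = s g` near the origin, `|c|² |ψ|² s⁻¹ = (s s⁻¹) s |g|² ≤ s |g|²`, and the right side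
has integral at most `∫ |g|² dκ`. The inequality `s s⁻¹ ≤ 1` also covers the points where `s`
vanishes. -/
lemma lintegral_specTransform_div_lt_top [SFinite κ] (hκ : Adm κ) {g : E d → ℂ} (hg : MemLp g 2 κ)
    (hgm : Measurable g) {η : ℝ}
    (hkill : ∀ R C (f : E d → ℂ), CTest R C f → (∀ x ∈ Metric.ball (0 : E d) η, f x = 0) →
      specFun κ g f = 0)
    {s : E d → ℝ≥0∞} (hs : Measurable s) (hfin : ∀ᵐ v : E d, s v < ∞)
    {N : Set (E d)} (hNm : MeasurableSet N) (hN : volume N = 0)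
    (hdec : κ.restrict Nᶜ = (volume.withDensity s).restrict Nᶜ) :
    ∃ ρ : ℝ, 0 < ρ ∧
      ∫⁻ v in Metric.ball (0 : E d) ρ, ‖specTransform κ g η v‖ₑ ^ 2 * (s v)⁻¹ < ∞ := by
  obtain ⟨ρ, hρ, c, hc, hae⟩ := specTransform_ae_eq hκ hg hgm hkill hs hfin hNm hN hdec
  refine ⟨ρ, hρ, ?_⟩
  have hNae : ∀ᵐ v : E d, v ∈ Nᶜ := by
    rw [ae_iff]; simpa using hN
  have h1 : ∫⁻ v, s v * ‖g v‖ₑ ^ 2 < ∞ := by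
    have h2 : ∫⁻ v in Nᶜ, ‖g v‖ₑ ^ 2 ∂κ < ∞ := by
      refine (setLIntegral_le_lintegral _ _).trans_lt ?_
      have := (eLpNorm_lt_top_iff_lintegral_rpow_enorm_lt_top two_ne_zero
        ENNReal.ofNat_ne_top).1 hg.2
      simpa using this
    have h3 : ∫⁻ v in Nᶜ, ‖g v‖ₑ ^ 2 ∂κ = ∫⁻ v, s v * ‖g v‖ₑ ^ 2 := by
      rw [hdec, restrict_withDensity hNm.compl,
        lintegral_withDensity_eq_lintegral_mul _ hs (hgm.enorm.pow_const 2),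
        Measure.restrict_eq_self_of_ae_mem hNae]
      rfl
    rwa [← h3]
  have hle : ∫⁻ v in Metric.ball (0 : E d) ρ, ‖specTransform κ g η v‖ₑ ^ 2 * (s v)⁻¹ ≤
      ∫⁻ v, (‖c‖ₑ ^ 2)⁻¹ * (s v * ‖g v‖ₑ ^ 2) := by
    refine (lintegral_mono_ae ?_).trans (setLIntegral_le_lintegral _ _)
    filter_upwards [ae_restrict_of_ae hae, ae_restrict_of_ae hfin,
      ae_restrict_mem measurableSet_ball] with v h4 h5 h6
    have h7 : ‖c‖ₑ * ‖specTransform κ g η v‖ₑ = s v * ‖g v‖ₑ := by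
      rw [← enorm_mul, h4 h6, enorm_mul]
      congr 1
      rw [← ofReal_norm, Complex.norm_real, Real.norm_of_nonneg ENNReal.toReal_nonneg,
        ENNReal.ofReal_toReal h5.ne]
    have hc1 : ‖c‖ₑ ^ 2 ≠ 0 := by simpa using hc
    have hc2 : ‖c‖ₑ ^ 2 ≠ ∞ := by simp
    rw [mul_comm (‖c‖ₑ ^ 2)⁻¹, ← div_eq_mul_inv (s v * _), ENNReal.le_div_iff_mul_le (Or.inl hc1) (Or.inl hc2)]
    have h8 : ‖specTransform κ g η v‖ₑ ^ 2 * (s v)⁻¹ * ‖c‖ₑ ^ 2 =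
        (s v * (s v)⁻¹) * (s v * ‖g v‖ₑ ^ 2) := by
      calc _ = (‖c‖ₑ * ‖specTransform κ g η v‖ₑ) ^ 2 * (s v)⁻¹ := by ring
        _ = _ := by rw [h7]; ring
    rw [h8]
    exact mul_le_of_le_one_left zero_le (ENNReal.mul_inv_le_one _)
  refine hle.trans_lt ?_
  rw [lintegral_const_mul _ (by exact hs.mul (hgm.enorm.pow_const 2))]
  exact ENNReal.mul_lt_top (ENNReal.inv_lt_top.2 (pos_iff_ne_zero.2 (by simpa using hc))) h1

end Density

/-! ### Taylor expansion at the origin, and the effect of a pole on annihilating functionals. -/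

section Taylor

variable {d : ℕ}

lemma norm_prod_sub_prod_le {ι : Type*} (s : Finset ι) (a b : ι → ℂ) {M δ : ℝ} (hM : 1 ≤ M)
    (ha : ∀ i, ‖a i‖ ≤ M) (hb : ∀ i, ‖b i‖ ≤ M) (hab : ∀ i, ‖a i - b i‖ ≤ δ) :
    ‖∏ i ∈ s, a i - ∏ i ∈ s, b i‖ ≤ s.card * M ^ s.card * δ := by
  classical
  have hM0 : 0 ≤ M := zero_le_one.trans hM
  induction s using Finset.induction_on with
  | empty => simp
  | insert i s hi ih =>
    have hδ : 0 ≤ δ := (norm_nonneg _).trans (hab i)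
    rw [Finset.prod_insert hi, Finset.prod_insert hi, Finset.card_insert_of_notMem hi]
    have hp : ‖∏ j ∈ s, b j‖ ≤ M ^ s.card := by
      rw [norm_prod]
      exact (Finset.prod_le_prod (fun _ _ => norm_nonneg _) fun j _ => hb j).trans_eq
        (by simp)
    calc ‖a i * ∏ j ∈ s, a j - b i * ∏ j ∈ s, b j‖
        = ‖a i * (∏ j ∈ s, a j - ∏ j ∈ s, b j) + (a i - b i) * ∏ j ∈ s, b j‖ := by
          congr 1; ring
      _ ≤ M * (s.card * M ^ s.card * δ) + δ * M ^ s.card := by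
          refine (norm_add_le _ _).trans (add_le_add ?_ ?_)
          · rw [norm_mul]; exact mul_le_mul (ha i) ih (norm_nonneg _) hM0
          · rw [norm_mul]; exact mul_le_mul (hab i) hp (norm_nonneg _) hδ
      _ ≤ M * (s.card * M ^ s.card * δ) + δ * M ^ (s.card + 1) := by
          gcongr
          exact Nat.le_succ _
      _ = _ := by push_cast; ring

/-- The truncated exponential series. -/
noncomputable def expPoly (n : ℕ) (z : ℂ) : ℂ := ∑ m ∈ Finset.range n, z ^ m / m.factorial

lemma chr_eq_prod (v t : E d) : chr v t = ∏ i, Complex.exp (Complex.I * (v i * t i : ℝ)) := by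
  rw [chr, ← Complex.exp_sum, ← Finset.mul_sum]
  congr 2
  rw [PiLp.inner_apply]
  push_cast
  refine Finset.sum_congr rfl fun i _ => ?_
  simp [mul_comm]

lemma abs_apply_le_norm (v : E d) (i : Fin d) : |v i| ≤ ‖v‖ := by
  simpa using PiLp.norm_apply_le v i

/-- The character is a product of one-variable exponentials, each truncated separately. The
truncation therefore runs over a box of multi-indices and its error comes from telescoping the
product; `1 + η ^ n * exp η` bounds both the exponentials and their truncations. -/
lemma exists_norm_chr_sub_le (d n : ℕ) {η : ℝ} (hη : 0 < η) :
    ∃ C : ℝ, 0 ≤ C ∧ ∀ v t : E d, ‖v‖ ≤ 1 → ‖t‖ ≤ η →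
      ‖chr v t - ∏ i, expPoly n (Complex.I * (v i * t i : ℝ))‖ ≤ C * ‖v‖ ^ n := by
  refine ⟨d * (1 + η ^ n * Real.exp η) ^ d * (η ^ n * Real.exp η), by positivity,
    fun v t hv ht => ?_⟩
  have h1 : ∀ i, ‖Complex.I * (v i * t i : ℝ)‖ ≤ ‖v‖ * η := fun i => by
    rw [norm_mul, Complex.norm_I, one_mul, Complex.norm_real, norm_mul]
    exact mul_le_mul (abs_apply_le_norm v i) ((abs_apply_le_norm t i).trans ht)
      (norm_nonneg _) (norm_nonneg _)
  have h2 : ∀ i, ‖Complex.exp (Complex.I * (v i * t i : ℝ)) -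
      expPoly n (Complex.I * (v i * t i : ℝ))‖ ≤ ‖v‖ ^ n * (η ^ n * Real.exp η) := fun i => by
    refine (Complex.norm_exp_sub_sum_le_norm_mul_exp _ _).trans ?_
    calc _ ≤ (‖v‖ * η) ^ n * Real.exp η := by
          gcongr
          · exact h1 i
          · exact (h1 i).trans (mul_le_of_le_one_left hη.le hv)
      _ = _ := by ring
  have h3 : ∀ i, ‖Complex.exp (Complex.I * (v i * t i : ℝ))‖ = 1 := fun i => by
    rw [mul_comm, Complex.norm_exp_ofReal_mul_I]
  have hpos : 0 ≤ η ^ n * Real.exp η := by positivity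
  rw [chr_eq_prod]
  have := norm_prod_sub_prod_le Finset.univ
    (fun i => Complex.exp (Complex.I * (v i * t i : ℝ)))
    (fun i => expPoly n (Complex.I * (v i * t i : ℝ))) (M := 1 + η ^ n * Real.exp η)
    (by linarith) (fun i => by rw [h3]; linarith) (fun i => ?_) h2
  · refine this.trans_eq ?_
    rw [Finset.card_univ, Fintype.card_fin]; ring
  · have h4 := norm_sub_norm_le (expPoly n (Complex.I * (v i * t i : ℝ)))
      (Complex.exp (Complex.I * (v i * t i : ℝ)))
    rw [norm_sub_rev, h3] at h4
    have h5 := h2 i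
    have h6 : ‖v‖ ^ n * (η ^ n * Real.exp η) ≤ η ^ n * Real.exp η :=
      mul_le_of_le_one_left hpos (pow_le_one₀ (norm_nonneg _) hv)
    linarith

/-- The Taylor coefficient of the exponential of a sum. -/
noncomputable def expCoeff (m : Fin d → ℕ) : ℂ := ∏ i, Complex.I ^ m i / (m i).factorial

lemma expCoeff_ne_zero (m : Fin d → ℕ) : expCoeff m ≠ 0 :=
  Finset.prod_ne_zero_iff.2 fun i _ => div_ne_zero (pow_ne_zero _ Complex.I_ne_zero)
    (by exact_mod_cast (Nat.factorial_pos _).ne')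

lemma prod_expPoly (n : ℕ) (v t : E d) :
    ∏ i, expPoly n (Complex.I * (v i * t i : ℝ)) =
      ∑ m ∈ Fintype.piFinset fun _ : Fin d => Finset.range n,
        (∏ i, (v i : ℂ) ^ m i) * expCoeff m * ∏ i, (t i : ℂ) ^ m i := by
  simp only [expPoly]
  rw [Finset.prod_univ_sum]
  refine Finset.sum_congr rfl fun m _ => ?_
  rw [expCoeff, ← Finset.prod_mul_distrib, ← Finset.prod_mul_distrib]
  refine Finset.prod_congr rfl fun i _ => ?_
  push_cast
  ring

/-- The monomial `t ^ m`, cut off outside of the ball of radius `η`. -/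
noncomputable def ballMonomial (η : ℝ) (m : Fin d → ℕ) : E d → ℂ :=
  (Metric.ball (0 : E d) η).indicator fun t => ∏ i, (t i : ℂ) ^ m i

lemma ballMonomial_eq (η : ℝ) (m : Fin d → ℕ) (t : E d) : ballMonomial η m t =
    (∏ i, (t i : ℂ) ^ m i) * (Metric.ball (0 : E d) η).indicator (fun _ => (1 : ℂ)) t := by
  unfold ballMonomial
  by_cases h : t ∈ Metric.ball (0 : E d) η <;> simp [h]

lemma measurable_monomial (m : Fin d → ℕ) : Measurable fun t : E d => ∏ i, (t i : ℂ) ^ m i := by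
  fun_prop

lemma ctest_ballMonomial {η : ℝ} (hη : 0 < η) (m : Fin d → ℕ) :
    ∃ C, CTest η C (ballMonomial η m) := by
  have h := (ctest_indicator_ball (d := d) η).bdd_mul (measurable_monomial m)
    (B := ∏ i, η ^ m i) (fun x hx => ?_) (by positivity)
  · exact ⟨_, (funext (ballMonomial_eq η m) : ballMonomial η m = _) ▸ h⟩
  · rw [norm_prod]
    refine Finset.prod_le_prod (fun _ _ => norm_nonneg _) fun i _ => ?_
    rw [norm_pow, Complex.norm_real]
    exact pow_le_pow_left₀ (norm_nonneg _) ((abs_apply_le_norm x i).trans hx) _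

/-- The Taylor polynomial of `specTransform`. -/
noncomputable def taylorPoly (κ : Measure (E d)) (g : E d → ℂ) (η : ℝ) (n : ℕ) :
    MvPolynomial (Fin d) ℂ :=
  ∑ m ∈ Fintype.piFinset fun _ : Fin d => Finset.range n,
    MvPolynomial.monomial (Finsupp.equivFunOnFinite.symm m)
      (expCoeff m * specFun κ g (ballMonomial η m))

lemma eval_taylorPoly (κ : Measure (E d)) (g : E d → ℂ) (η : ℝ) (n : ℕ) (v : E d) :
    MvPolynomial.eval (fun i => ((v i : ℝ) : ℂ)) (taylorPoly κ g η n) =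
      ∑ m ∈ Fintype.piFinset fun _ : Fin d => Finset.range n,
        (∏ i, (v i : ℂ) ^ m i) * expCoeff m * specFun κ g (ballMonomial η m) := by
  rw [taylorPoly, map_sum]
  refine Finset.sum_congr rfl fun m _ => ?_
  rw [MvPolynomial.eval_monomial, Finsupp.prod_fintype _ _ (by simp)]
  simp only [Finsupp.equivFunOnFinite_symm_apply_apply]
  ring

lemma coeff_taylorPoly (κ : Measure (E d)) (g : E d → ℂ) (η : ℝ) {n : ℕ} (k : Fin d →₀ ℕ)
    (hk : ∀ i, k i < n) :
    (taylorPoly κ g η n).coeff k = expCoeff k * specFun κ g (ballMonomial η k) := by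
  classical
  rw [taylorPoly, MvPolynomial.coeff_sum, Finset.sum_eq_single (k : Fin d → ℕ)]
  · rw [MvPolynomial.coeff_monomial, if_pos]
    ext; simp
  · intro m _ hm
    rw [MvPolynomial.coeff_monomial, if_neg]
    intro h
    apply hm
    rw [← h]; ext; simp
  · intro h
    exact absurd (Fintype.mem_piFinset.2 fun i => Finset.mem_range.2 (hk i)) h

variable {κ : Measure (E d)}

/-- The functional is bounded for the sup norm on the ball, so it carries the uniform Taylor
remainder of the character over to `specTransform`. -/
lemma exists_norm_specTransform_sub_le (hκ : Adm κ) {g : E d → ℂ} (hg : MemLp g 2 κ) {η : ℝ}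
    (hη : 0 < η) (n : ℕ) :
    ∃ C : ℝ, 0 ≤ C ∧ ∀ v : E d, ‖v‖ ≤ 1 → ‖specTransform κ g η v -
      MvPolynomial.eval (fun i => ((v i : ℝ) : ℂ)) (taylorPoly κ g η n)‖ ≤ C * ‖v‖ ^ n := by
  obtain ⟨C, hC, hrem⟩ := exists_norm_chr_sub_le d n hη
  obtain ⟨K, hK, hbd⟩ := hκ.exists_bound_specFun hg η
  refine ⟨K * C, by positivity, fun v hv => ?_⟩
  set χ : E d → ℂ := (Metric.ball (0 : E d) η).indicator fun _ => (1 : ℂ) with hχ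
  choose B hB using fun m : Fin d → ℕ => ctest_ballMonomial hη m
  have hχt : CTest η 1 χ := ctest_indicator_ball η
  have hterm : ∀ m : Fin d → ℕ, CTest η (‖(∏ i, (v i : ℂ) ^ m i) * expCoeff m‖ * B m)
      (fun t => (∏ i, (v i : ℂ) ^ m i) * expCoeff m * ballMonomial η m t) :=
    fun m => (hB m).const_mul _
  have hpoly : (fun t => ∑ m ∈ Fintype.piFinset fun _ : Fin d => Finset.range n,
      (∏ i, (v i : ℂ) ^ m i) * expCoeff m * ballMonomial η m t) =
      fun t => (∏ i, expPoly n (Complex.I * (v i * t i : ℝ))) * χ t := by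
    ext t
    rw [prod_expPoly, Finset.sum_mul]
    refine Finset.sum_congr rfl fun m _ => ?_
    rw [ballMonomial_eq]; ring
  have hmeas : Measurable fun t : E d =>
      chr v t - ∏ i, expPoly n (Complex.I * (v i * t i : ℝ)) := by
    refine (continuous_chr_right v).measurable.sub ?_
    unfold expPoly
    fun_prop
  have hdiff : CTest η (C * ‖v‖ ^ n * 1) (fun t =>
      (chr v t - ∏ i, expPoly n (Complex.I * (v i * t i : ℝ))) * χ t) :=
    hχt.bdd_mul hmeas (fun t ht => hrem v t hv ht) (by positivity)
  have hp : CTest η (C * ‖v‖ ^ n * 1 + 1) (fun t =>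
      (∏ i, expPoly n (Complex.I * (v i * t i : ℝ))) * χ t) := by
    have h := (hχt.chr_mul v).sub hdiff
    rw [max_self, add_comm] at h
    convert h using 2 with t
    ring
  have e1 : MvPolynomial.eval (fun i => ((v i : ℝ) : ℂ)) (taylorPoly κ g η n) =
      specFun κ g (fun t => (∏ i, expPoly n (Complex.I * (v i * t i : ℝ))) * χ t) := by
    rw [eval_taylorPoly, ← hpoly, specFun_sum hκ hg _ hterm]
    refine Finset.sum_congr rfl fun m _ => ?_
    rw [specFun_const_mul]
  rw [e1, specTransform, ← hχ, ← specFun_sub hκ hg (hχt.chr_mul v) hp]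
  have h2 := hbd _ _ hdiff
  calc _ = ‖specFun κ g (fun t =>
      (chr v t - ∏ i, expPoly n (Complex.I * (v i * t i : ℝ))) * χ t)‖ := by
        congr 2; ext t; ring
    _ ≤ _ := h2
    _ = _ := by ring

/-- At a pole of order `k`, functionals that vanish on functions that vanish on a ball also vanish
on the monomial of exponent `k`. -/
lemma specFun_ballMonomial_eq_zero [SFinite κ] (hκ : Adm κ) {g : E d → ℂ} (hg : MemLp g 2 κ)
    (hgm : Measurable g) {η : ℝ} (hη : 0 < η)
    (hkill : ∀ R C (f : E d → ℂ), CTest R C f → (∀ x ∈ Metric.ball (0 : E d) η, f x = 0) →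
      specFun κ g f = 0)
    {s : E d → ℝ≥0∞} (hs : Measurable s) (hfin : ∀ᵐ v : E d, s v < ∞)
    {N : Set (E d)} (hNm : MeasurableSet N) (hN : volume N = 0)
    (hdec : κ.restrict Nᶜ = (volume.withDensity s).restrict Nᶜ)
    (hord : HasFiniteOrder s 0) (k : Fin d →₀ ℕ) (hk : HasPole s 0 k) :
    specFun κ g (ballMonomial η k) = 0 := by
  obtain ⟨ρ, hρ, hψ⟩ :=
    lintegral_specTransform_div_lt_top hκ hg hgm hkill hs hfin hNm hN hdec
  obtain ⟨ε, q, hε, hq⟩ := hord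
  -- Large enough for the box of exponents to contain `k`, and for the remainder `‖v‖ ^ n` to be
  -- dominated by `‖v‖ ^ q`, whose square is integrable against `s⁻¹`.
  set n := q + ∑ i, k i + 1 with hn
  have hkn : ∀ i, k i < n := fun i => by
    have := Finset.single_le_sum (f := fun i => k i) (fun _ _ => Nat.zero_le _)
      (Finset.mem_univ i)
    omega
  obtain ⟨C, hC, hrem⟩ := exists_norm_specTransform_sub_le hκ hg hη n
  have hcoef := hk (taylorPoly κ g η n) ⟨min (min ρ ε) 1, by positivity, ?_⟩
  · rw [coeff_taylorPoly κ g η k hkn] at hcoef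
    exact (mul_eq_zero.1 hcoef).resolve_left (expCoeff_ne_zero _)
  set r := min (min ρ ε) 1
  have hr1 : r ≤ ρ := (min_le_left _ _).trans (min_le_left _ _)
  have hr2 : r ≤ ε := (min_le_left _ _).trans (min_le_right _ _)
  have hr3 : r ≤ 1 := min_le_right _ _
  have hψm : Measurable (specTransform κ g η) := measurable_specTransform hgm η
  have hA : ∫⁻ v in Metric.ball (0 : E d) r, 2 * (‖specTransform κ g η v‖ₑ ^ 2 * (s v)⁻¹) < ∞ := by
    rw [lintegral_const_mul _ (by exact (hψm.enorm.pow_const 2).mul hs.inv)]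
    exact ENNReal.mul_lt_top ENNReal.ofNat_lt_top
      ((lintegral_mono_set (Metric.ball_subset_ball hr1)).trans_lt hψ)
  have hB : ∫⁻ v in Metric.ball (0 : E d) r,
      2 * ENNReal.ofReal C ^ 2 * (‖v - 0‖ₑ ^ (2 * q) * (s v)⁻¹) < ∞ := by
    rw [lintegral_const_mul _ (by fun_prop)]
    exact ENNReal.mul_lt_top (ENNReal.mul_lt_top ENNReal.ofNat_lt_top (by simp))
      ((lintegral_mono_set (Metric.ball_subset_ball hr2)).trans_lt hq)
  have hle : ∀ v ∈ Metric.ball (0 : E d) r,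
      ‖MvPolynomial.eval (fun i => (((v - 0) i : ℝ) : ℂ)) (taylorPoly κ g η n)‖ₑ ^ 2 * (s v)⁻¹ ≤
      2 * (‖specTransform κ g η v‖ₑ ^ 2 * (s v)⁻¹) +
        2 * ENNReal.ofReal C ^ 2 * (‖v - 0‖ₑ ^ (2 * q) * (s v)⁻¹) := by
    intro v hv
    have hv1 : ‖v‖ ≤ 1 := (by simpa using hv : ‖v‖ < r).le.trans hr3
    have h1 := hrem v hv1
    simp only [sub_zero]
    set P := MvPolynomial.eval (fun i => ((v i : ℝ) : ℂ)) (taylorPoly κ g η n)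
    have h2 : ‖P‖ ^ 2 ≤ 2 * ‖specTransform κ g η v‖ ^ 2 + 2 * C ^ 2 * ‖v‖ ^ (2 * q) := by
      have h3 : ‖P‖ ≤ ‖specTransform κ g η v‖ + C * ‖v‖ ^ q := by
        have h4 := norm_sub_norm_le P (specTransform κ g η v)
        rw [norm_sub_rev] at h4
        have h5 : C * ‖v‖ ^ n ≤ C * ‖v‖ ^ q :=
          mul_le_mul_of_nonneg_left (pow_le_pow_of_le_one (norm_nonneg _) hv1 (by omega)) hC
        linarith
      calc ‖P‖ ^ 2 ≤ (‖specTransform κ g η v‖ + C * ‖v‖ ^ q) ^ 2 := by gcongr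
        _ ≤ 2 * (‖specTransform κ g η v‖ ^ 2 + (C * ‖v‖ ^ q) ^ 2) := add_sq_le
        _ = _ := by ring
    have h3 : ‖P‖ₑ ^ 2 ≤ 2 * ‖specTransform κ g η v‖ₑ ^ 2 +
        2 * ENNReal.ofReal C ^ 2 * ‖v‖ₑ ^ (2 * q) := by
      have := ENNReal.ofReal_le_ofReal h2
      rw [ENNReal.ofReal_add (by positivity) (by positivity), ENNReal.ofReal_mul (by positivity),
        ENNReal.ofReal_mul (by positivity), ENNReal.ofReal_mul (by positivity),
        ENNReal.ofReal_pow (by positivity), ENNReal.ofReal_pow (by positivity),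
        ENNReal.ofReal_pow (by positivity), ENNReal.ofReal_pow (by positivity)] at this
      simpa [ofReal_norm] using this
    calc _ ≤ (2 * ‖specTransform κ g η v‖ₑ ^ 2 +
        2 * ENNReal.ofReal C ^ 2 * ‖v‖ₑ ^ (2 * q)) * (s v)⁻¹ := by gcongr
      _ = _ := by ring
  refine (setLIntegral_mono' measurableSet_ball hle).trans_lt ?_
  rw [lintegral_add_left (by fun_prop)]
  exact ENNReal.add_lt_top.2 ⟨hA, hB⟩

end Taylor

/-! ### Closure properties of real test functions. -/

section RealTest

variable {d : ℕ}

lemma IsTest.of_bound {f : E d → ℝ} (hm : Measurable f) {C R : ℝ} (hC : ∀ x, |f x| ≤ C)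
    (hR : ∀ x, R < ‖x‖ → f x = 0) : IsTest f :=
  ⟨hm, ⟨C, hC⟩, HasCompactSupport.intro (isCompact_closedBall (0 : E d) R) fun x hx =>
    hR x (by simpa using hx)⟩

lemma IsTest.exists_radius {f : E d → ℝ} (hf : IsTest f) : ∃ R : ℝ, 0 < R ∧ ∀ x, R < ‖x‖ → f x = 0 := by
  obtain ⟨R, hR0, hR⟩ := hf.compactSupport.isCompact.isBounded.subset_closedBall_lt 0 (0 : E d)
  refine ⟨R, hR0, fun x hx => image_eq_zero_of_notMem_tsupport fun h => ?_⟩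
  have := hR h
  rw [mem_closedBall_zero_iff] at this
  linarith

lemma IsTest.exists_ctest {f : E d → ℝ} (hf : IsTest f) :
    ∃ R C : ℝ, CTest R C fun t => (f t : ℂ) := by
  obtain ⟨R, -, hR⟩ := hf.exists_radius
  obtain ⟨C, hC⟩ := hf.bounded
  exact ⟨R, C, Complex.measurable_ofReal.comp hf.measurable, fun x => by simpa using hC x,
    fun x hx => by simp [hR x hx]⟩

lemma IsTest.integrable_ofReal {f : E d → ℝ} (hf : IsTest f) :
    Integrable fun t => (f t : ℂ) := by
  obtain ⟨R, C, h⟩ := hf.exists_ctest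
  exact h.integrable

lemma IsTest.integrable {f : E d → ℝ} (hf : IsTest f) : Integrable f := by
  obtain ⟨R, C, h⟩ := hf.exists_ctest
  simpa using h.integrable.re

lemma IsTest.lin {f g : E d → ℝ} (hf : IsTest f) (hg : IsTest g) (a b : ℝ) :
    IsTest fun x => a * f x + b * g x := by
  obtain ⟨R, -, hR⟩ := hf.exists_radius
  obtain ⟨R', -, hR'⟩ := hg.exists_radius
  obtain ⟨C, hC⟩ := hf.bounded
  obtain ⟨C', hC'⟩ := hg.bounded
  refine IsTest.of_bound ((hf.measurable.const_mul a).add (hg.measurable.const_mul b))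
    (C := |a| * C + |b| * C') (R := max R R') (fun x => ?_) fun x hx => ?_
  · refine (abs_add_le _ _).trans ?_
    rw [abs_mul, abs_mul]
    gcongr
    · exact hC x
    · exact hC' x
  · rw [hR x ((le_max_left _ _).trans_lt hx), hR' x ((le_max_right _ _).trans_lt hx)]; ring

lemma IsTest.sub {f g : E d → ℝ} (hf : IsTest f) (hg : IsTest g) : IsTest fun x => f x - g x := by
  simpa [sub_eq_add_neg] using hf.lin hg 1 (-1)

lemma IsTest.zero : IsTest (fun _ : E d => (0 : ℝ)) :=
  IsTest.of_bound measurable_const (C := 0) (R := 0) (by simp) (by simp)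

lemma IsTest.sum {f : ℕ → E d → ℝ} (hf : ∀ n, IsTest (f n)) (N : ℕ) :
    IsTest fun x => ∑ n ∈ Finset.range N, f n x := by
  induction N with
  | zero => simpa using IsTest.zero
  | succ N ih =>
    simp only [Finset.sum_range_succ]
    simpa using ih.lin (hf N) 1 1

lemma isTest_indicator {A : Set (E d)} (hA : MeasurableSet A) {R : ℝ}
    (hR : A ⊆ Metric.closedBall 0 R) : IsTest (A.indicator fun _ => (1 : ℝ)) :=
  IsTest.of_bound (measurable_const.indicator hA) (C := 1) (R := R)
    (fun x => by by_cases h : x ∈ A <;> simp [h])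
    fun x hx => Set.indicator_of_notMem (fun h => by
      have := hR h
      rw [mem_closedBall_zero_iff] at this
      linarith) _

end RealTest

/-! ### Translation invariant countably additive functionals are multiples of Lebesgue measure. -/

section Invariant

variable {d : ℕ}

/-- Translation invariant, countably additive linear functionals on test functions. -/
structure IsInvariantFunctional (μ : (E d → ℝ) → ℝ) : Prop where
  lin : ∀ (a b : ℝ) (f g : E d → ℝ), IsTest f → IsTest g →
    μ (fun x => a * f x + b * g x) = a * μ f + b * μ g
  translate : ∀ (x : E d) (f : E d → ℝ), IsTest f → μ (fun y => f (y + x)) = μ f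
  sigma : ∀ (f : ℕ → E d → ℝ) (g : E d → ℝ), (∀ n, IsTest (f n)) → IsTest g →
    (∀ n x, 0 ≤ f n x) → (∀ x, HasSum (fun n => f n x) (g x)) →
    Tendsto (fun N => ∑ n ∈ Finset.range N, μ (f n)) atTop (𝓝 (μ g))

namespace IsInvariantFunctional

variable {μ : (E d → ℝ) → ℝ}

lemma map_zero (hμ : IsInvariantFunctional μ) : μ (fun _ => 0) = 0 := by
  simpa using hμ.lin 0 0 _ _ IsTest.zero IsTest.zero

/-- A signed measure needs unconditional summation, whereas `sigma` only provides limits of ordered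
partial sums. Replacing some of the sets by `∅` makes every subseries converge, in particular those
of the nonnegative and of the nonpositive terms, which gives absolute summability. -/
lemma hasSum_indicator (hμ : IsInvariantFunctional μ) {R : ℝ} {A : ℕ → Set (E d)}
    (hA : ∀ n, MeasurableSet (A n)) (hR : ∀ n, A n ⊆ Metric.closedBall 0 R)
    (hd : Pairwise (Function.onFun Disjoint A)) :
    HasSum (fun n => μ ((A n).indicator fun _ => 1)) (μ ((⋃ n, A n).indicator fun _ => 1)) := by
  have key : ∀ B : ℕ → Set (E d), (∀ n, MeasurableSet (B n)) → (∀ n, B n ⊆ A n) →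
      Tendsto (fun N => ∑ n ∈ Finset.range N, μ ((B n).indicator fun _ => 1)) atTop
        (𝓝 (μ ((⋃ n, B n).indicator fun _ => 1))) := by
    intro B hBm hBA
    refine hμ.sigma _ _ (fun n => isTest_indicator (hBm n) ((hBA n).trans (hR n)))
      (isTest_indicator (MeasurableSet.iUnion hBm)
        (Set.iUnion_subset fun n => (hBA n).trans (hR n)))
      (fun n x => Set.indicator_nonneg (fun _ _ => zero_le_one) _) fun x => ?_
    by_cases hx : ∃ n, x ∈ B n
    · obtain ⟨n, hn⟩ := hx
      rw [Set.indicator_of_mem (Set.mem_iUnion.2 ⟨n, hn⟩)]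
      have := hasSum_single (f := fun m => (B m).indicator (fun _ => (1 : ℝ)) x) n
        fun m hm => Set.indicator_of_notMem (fun hxm =>
          Set.disjoint_left.1 (hd hm) (hBA m hxm) (hBA n hn)) _
      simpa [hn] using this
    · push Not at hx
      rw [Set.indicator_of_notMem (by simpa using hx)]
      simp [hx]
  set a : ℕ → ℝ := fun n => μ ((A n).indicator fun _ => 1) with ha
  have hsel : ∀ p : ℕ → Prop, ∃ l, Tendsto
      (fun N => ∑ n ∈ Finset.range N, (by classical exact if p n then a n else 0)) atTop (𝓝 l) := by
    classical
    intro p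
    have := key (fun n => if p n then A n else ∅)
      (fun n => by by_cases h : p n <;> simp [h, hA n])
      (fun n => by by_cases h : p n <;> simp [h])
    refine ⟨_, this.congr fun N => Finset.sum_congr rfl fun n _ => ?_⟩
    by_cases h : p n
    · simp [h, ha]
    · simp [h, hμ.map_zero]
  have hpos : Summable fun n => max (a n) 0 := by
    obtain ⟨l, hl⟩ := hsel fun n => 0 ≤ a n
    refine ((hasSum_iff_tendsto_nat_of_nonneg (fun n => le_max_right _ _) l).2
      (hl.congr fun N => Finset.sum_congr rfl fun n _ => ?_)).summable
    split_ifs with h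
    · rw [max_eq_left h]
    · rw [max_eq_right (not_le.1 h).le]
  have hneg : Summable fun n => max (-a n) 0 := by
    obtain ⟨l, hl⟩ := hsel fun n => a n ≤ 0
    refine ((hasSum_iff_tendsto_nat_of_nonneg (fun n => le_max_right _ _) (-l)).2
      (hl.neg.congr fun N => ?_)).summable
    rw [← Finset.sum_neg_distrib]
    refine Finset.sum_congr rfl fun n _ => ?_
    split_ifs with h
    · rw [max_eq_left (by linarith)]
    · rw [max_eq_right (by linarith), neg_zero]
  have hsum : Summable a := (hpos.sub hneg).congr fun n => by
    rcases le_total 0 (a n) with h | h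
    · rw [max_eq_left h, max_eq_right (by linarith), sub_zero]
    · rw [max_eq_right h, max_eq_left (by linarith)]; ring
  have := hsum.hasSum
  rwa [tendsto_nhds_unique this.tendsto_sum_nat (key A hA fun n => subset_rfl)] at this

/-- Jordan decomposition of the signed measure that the functional induces on a ball. Restricting to
a ball keeps it finite; `p` and `q` need not be translation invariant. -/
lemma exists_measures (hμ : IsInvariantFunctional μ) (R : ℝ) :
    ∃ p q : Measure (E d), IsFiniteMeasure p ∧ IsFiniteMeasure q ∧
      ∀ A, MeasurableSet A → A ⊆ Metric.closedBall 0 R →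
        μ (A.indicator fun _ => 1) = p.real A - q.real A := by
  classical
  let ν : SignedMeasure (E d) :=
    { measureOf' := fun A => if MeasurableSet A then
        μ ((A ∩ Metric.closedBall 0 R).indicator fun _ => 1) else 0
      empty' := by simp [hμ.map_zero]
      not_measurable' := fun A hA => by simp [hA]
      m_iUnion' := fun A hA hd => by
        simp only [hA, MeasurableSet.iUnion hA, if_true, Set.iUnion_inter]
        exact hμ.hasSum_indicator (fun n => (hA n).inter measurableSet_closedBall)
          (fun n => Set.inter_subset_right)
          fun i j hij => (hd hij).mono Set.inter_subset_left Set.inter_subset_left }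
  refine ⟨ν.toJordanDecomposition.posPart, ν.toJordanDecomposition.negPart, inferInstance,
    inferInstance, fun A hA hAR => ?_⟩
  have h1 : ν A = μ (A.indicator fun _ => 1) := by
    change (if MeasurableSet A then _ else _) = _
    rw [if_pos hA, Set.inter_eq_left.2 hAR]
  rw [← h1]
  conv_lhs => rw [← ν.toSignedMeasure_toJordanDecomposition]
  rw [JordanDecomposition.toSignedMeasure, Measure.toSignedMeasure_sub_apply hA]

/-- Fubini for `1_B(x) 1_A(y + x)` against `dx dp(y)`, with the substitution `z = y + x`; the
symmetry of `B` turns `z - y` into `y - z`. -/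
lemma lintegral_measure_translate_comm (p : Measure (E d)) [IsFiniteMeasure p] {A B : Set (E d)}
    (hA : MeasurableSet A) (hB : MeasurableSet B) (hBs : ∀ x, x ∈ B ↔ -x ∈ B) :
    ∫⁻ x in B, p {y | y + x ∈ A} = ∫⁻ z in A, p {y | y - z ∈ B} := by
  have hmeas1 : Measurable (Function.uncurry fun x y : E d =>
      B.indicator (fun _ => (1 : ℝ≥0∞)) x * A.indicator (fun _ => (1 : ℝ≥0∞)) (y + x)) :=
    ((measurable_const.indicator hB).comp measurable_fst).mul
      ((measurable_const.indicator hA).comp (measurable_snd.add measurable_fst))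
  have hmeas2 : Measurable (Function.uncurry fun y z : E d =>
      B.indicator (fun _ => (1 : ℝ≥0∞)) (z - y) * A.indicator (fun _ => (1 : ℝ≥0∞)) z) :=
    ((measurable_const.indicator hB).comp (measurable_snd.sub measurable_fst)).mul
      ((measurable_const.indicator hA).comp measurable_snd)
  calc ∫⁻ x in B, p {y | y + x ∈ A}
      = ∫⁻ x, ∫⁻ y, B.indicator (fun _ => (1 : ℝ≥0∞)) x *
          A.indicator (fun _ => (1 : ℝ≥0∞)) (y + x) ∂p := by
        rw [← lintegral_indicator hB]
        congr 1; ext x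
        have hm : MeasurableSet {y | y + x ∈ A} := (measurable_id.add_const x) hA
        have hAm : Measurable fun y => A.indicator (fun _ => (1 : ℝ≥0∞)) (y + x) :=
          (measurable_const.indicator hA).comp (measurable_id.add_const x)
        rw [lintegral_const_mul _ hAm]
        have : (fun y => A.indicator (fun _ => (1 : ℝ≥0∞)) (y + x)) =
            {y | y + x ∈ A}.indicator fun _ => 1 := rfl
        rw [this, lintegral_indicator hm]
        by_cases hx : x ∈ B <;> simp [hx]
    _ = ∫⁻ y, (∫⁻ x, B.indicator (fun _ => (1 : ℝ≥0∞)) x *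
          A.indicator (fun _ => (1 : ℝ≥0∞)) (y + x)) ∂p :=
        lintegral_lintegral_swap hmeas1.aemeasurable
    _ = ∫⁻ y, (∫⁻ z, B.indicator (fun _ => (1 : ℝ≥0∞)) (z - y) *
          A.indicator (fun _ => (1 : ℝ≥0∞)) z) ∂p := by
        congr 1; ext y
        have h := lintegral_add_left_eq_self (μ := volume) (fun z =>
          B.indicator (fun _ => (1 : ℝ≥0∞)) (z - y) * A.indicator (fun _ => (1 : ℝ≥0∞)) z) y
        rw [← h]
        simp only [add_sub_cancel_left]
    _ = ∫⁻ z, (∫⁻ y, B.indicator (fun _ => (1 : ℝ≥0∞)) (z - y) *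
          A.indicator (fun _ => (1 : ℝ≥0∞)) z ∂p) :=
        lintegral_lintegral_swap hmeas2.aemeasurable
    _ = ∫⁻ z in A, p {y | y - z ∈ B} := by
        rw [← lintegral_indicator hA]
        congr 1; ext z
        have hm : MeasurableSet {y | y - z ∈ B} := (measurable_id.sub_const z) hB
        have : (fun y => B.indicator (fun _ => (1 : ℝ≥0∞)) (z - y)) =
            {y | y - z ∈ B}.indicator fun _ => 1 := by
          ext y
          have h := hBs (z - y)
          rw [neg_sub] at h
          by_cases hy : y - z ∈ B
          · rw [Set.indicator_of_mem (h.2 hy), Set.indicator_of_mem (by exact hy)]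
          · rw [Set.indicator_of_notMem (fun h' => hy (h.1 h')), Set.indicator_of_notMem (by exact hy)]
        rw [lintegral_mul_const _ (by rw [this]; exact measurable_const.indicator hm), this,
          lintegral_indicator hm]
        by_cases hz : z ∈ A <;> simp [hz]

/-- The uniqueness argument for Haar measure: by invariance each side is a difference of the
integrals exchanged in `lintegral_measure_translate_comm`, one for `p` and one for `q`. The radius
`R + r` contains every translate involved. -/
lemma indicator_mul_eq (hμ : IsInvariantFunctional μ) {A B : Set (E d)} (hA : MeasurableSet A)
    (hB : MeasurableSet B) {R r : ℝ} (hAR : A ⊆ Metric.closedBall 0 R)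
    (hBr : B ⊆ Metric.closedBall 0 r) (hBs : ∀ x, x ∈ B ↔ -x ∈ B) :
    μ (A.indicator fun _ => 1) * volume.real B = μ (B.indicator fun _ => 1) * volume.real A := by
  obtain ⟨p, q, hp, hq, hpq⟩ := hμ.exists_measures (R + r)
  have hAf : volume A ≠ ∞ := ((measure_mono hAR).trans_lt measure_closedBall_lt_top).ne
  have hBf : volume B ≠ ∞ := ((measure_mono hBr).trans_lt measure_closedBall_lt_top).ne
  have hgen : ∀ (C D : Set (E d)), volume C ≠ ∞ → MeasurableSet C →
      ∀ (T : E d → Set (E d)) (m : ℝ), MeasurableSet {z : E d × E d | z.2 ∈ T z.1} →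
      (∀ x ∈ C, p.real (T x) - q.real (T x) = m) →
      m * volume.real C = (∫⁻ x in C, p (T x)).toReal - (∫⁻ x in C, q (T x)).toReal := by
    intro C D hC hCm T m hT hm
    have hi : ∀ (p : Measure (E d)) [IsFiniteMeasure p],
        Measurable (fun x => p (T x)) ∧ IntegrableOn (fun x => p.real (T x)) C ∧
        ∫ x in C, p.real (T x) = (∫⁻ x in C, p (T x)).toReal := by
      intro p _
      have hm : Measurable (fun x => p (T x)) := measurable_measure_prodMk_left hT
      refine ⟨hm, Measure.integrableOn_of_bounded (M := p.real Set.univ) hC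
        hm.ennreal_toReal.aestronglyMeasurable (ae_of_all _ fun x => ?_), ?_⟩
      · rw [Real.norm_of_nonneg measureReal_nonneg]
        exact measureReal_mono (Set.subset_univ _)
      · exact integral_toReal hm.aemeasurable (ae_of_all _ fun x => measure_lt_top _ _)
    rw [← (hi p).2.2, ← (hi q).2.2, ← integral_sub (hi p).2.1 (hi q).2.1,
      setIntegral_congr_fun hCm hm]
    simp [mul_comm]
  have h1 := hgen B A hBf hB (fun x => {y | y + x ∈ A}) (μ (A.indicator fun _ => 1))
    ((measurable_snd.add measurable_fst) hA) (fun x hx => by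
      rw [← hμ.translate x _ (isTest_indicator hA hAR)]
      refine (hpq {y | y + x ∈ A} ((measurable_id.add_const x) hA) fun y hy => ?_).symm
      have h2 := hAR hy
      have h3 := hBr hx
      have h4 := norm_sub_le (y + x) x
      rw [add_sub_cancel_right] at h4
      rw [mem_closedBall_zero_iff] at *
      linarith)
  have h2 := hgen A B hAf hA (fun z => {y | y - z ∈ B}) (μ (B.indicator fun _ => 1))
    ((measurable_snd.sub measurable_fst) hB) (fun z hz => by
      rw [← hμ.translate (-z) _ (isTest_indicator hB hBr)]
      refine (hpq {y | y - z ∈ B} ((measurable_id.sub_const z) hB) fun y hy => ?_).symm.trans ?_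
      · have h2 := hBr hy
        have h3 := hAR hz
        have h4 := norm_add_le (y - z) z
        rw [sub_add_cancel] at h4
        rw [mem_closedBall_zero_iff] at *
        linarith
      · congr 1)
  rw [h1, h2, lintegral_measure_translate_comm p hA hB hBs,
    lintegral_measure_translate_comm q hA hB hBs]

lemma exists_indicator_eq (hμ : IsInvariantFunctional μ) :
    ∃ m : ℝ, ∀ A, MeasurableSet A → ∀ R, A ⊆ Metric.closedBall 0 R →
      μ (A.indicator fun _ => 1) = m * volume.real A := by
  have hpos : 0 < volume.real (Metric.closedBall (0 : E d) 1) :=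
    ENNReal.toReal_pos (Metric.measure_closedBall_pos _ _ one_pos).ne'
      measure_closedBall_lt_top.ne
  refine ⟨μ ((Metric.closedBall (0 : E d) 1).indicator fun _ => 1) /
    volume.real (Metric.closedBall (0 : E d) 1), fun A hA R hR => ?_⟩
  have := hμ.indicator_mul_eq hA measurableSet_closedBall hR (subset_refl _) (r := 1)
    (fun x => by simp)
  field_simp
  linarith

lemma map_sum (hμ : IsInvariantFunctional μ) {ι : Type*} (s : Finset ι) {c : ι → ℝ}
    {f : ι → E d → ℝ} (hf : ∀ i, IsTest (f i)) :
    IsTest (fun x => ∑ i ∈ s, c i * f i x) ∧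
      μ (fun x => ∑ i ∈ s, c i * f i x) = ∑ i ∈ s, c i * μ (f i) := by
  classical
  induction s using Finset.induction_on with
  | empty => simpa using ⟨IsTest.zero, hμ.map_zero⟩
  | insert i s hi ih =>
    simp only [Finset.sum_insert hi]
    refine ⟨by simpa using (hf i).lin ih.1 (c i) 1, ?_⟩
    have := hμ.lin (c i) 1 _ _ (hf i) ih.1
    simp only [one_mul] at this
    rw [this, ih.2]

/-- Passes from indicators to nonnegative simple functions by linearity, to nonnegative test
functions as countable sums of simple functions, and to all test functions by positive and negative
parts. -/
lemma exists_eq_integral (hμ : IsInvariantFunctional μ) :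
    ∃ m : ℝ, ∀ f, IsTest f → μ f = m * ∫ x, f x := by
  obtain ⟨m, hm⟩ := hμ.exists_indicator_eq
  refine ⟨m, ?_⟩
  have hsimple : ∀ (g : SimpleFunc (E d) NNReal) (R : ℝ), (∀ x, R < ‖x‖ → g x = 0) →
      IsTest (fun x => (g x : ℝ)) ∧ μ (fun x => (g x : ℝ)) = m * ∫ x, (g x : ℝ) := by
    intro g R hR
    have hB : ∀ y : NNReal, MeasurableSet (g ⁻¹' {y} ∩ Metric.closedBall 0 R) := fun y =>
      (g.measurableSet_fiber y).inter measurableSet_closedBall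
    have hg : (fun x => (g x : ℝ)) = fun x => ∑ y ∈ g.range,
        (y : ℝ) * (g ⁻¹' {y} ∩ Metric.closedBall 0 R).indicator (fun _ => (1 : ℝ)) x := by
      ext x
      rw [Finset.sum_eq_single (g x)]
      · by_cases hx : R < ‖x‖
        · simp [hR x hx]
        · rw [Set.indicator_of_mem, mul_one]
          exact ⟨rfl, by simpa using hx⟩
      · intro y _ hy
        rw [Set.indicator_of_notMem, mul_zero]
        exact fun h => hy h.1.symm
      · intro h
        exact absurd (SimpleFunc.mem_range_self g x) h
    have hT := fun y : NNReal => isTest_indicator (hB y) Set.inter_subset_right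
    have h1 := hμ.map_sum g.range (c := fun y => (y : ℝ)) hT
    rw [hg]
    refine ⟨h1.1, h1.2.trans ?_⟩
    rw [integral_finsetSum _ fun y _ => (hT y).integrable.const_mul _, Finset.mul_sum]
    refine Finset.sum_congr rfl fun y _ => ?_
    rw [integral_const_mul, hm _ (hB y) R Set.inter_subset_right,
      integral_indicator (hB y)]
    simp only [integral_const, smul_eq_mul, mul_one, measureReal_restrict_apply_univ]
    ring
  have hnonneg : ∀ f, IsTest f → (∀ x, 0 ≤ f x) → μ f = m * ∫ x, f x := by
    intro f hf hf0
    obtain ⟨R, -, hR⟩ := hf.exists_radius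
    set F : E d → ℝ≥0∞ := fun x => ENNReal.ofReal (f x) with hF
    have hFm : Measurable F := hf.measurable.ennreal_ofReal
    set D := SimpleFunc.eapproxDiff F with hD
    have htsum : ∀ x, ∑' n, (D n x : ℝ≥0∞) = F x := SimpleFunc.tsum_eapproxDiff F hFm
    have hD0 : ∀ n x, R < ‖x‖ → D n x = 0 := by
      intro n x hx
      have h1 : (D n x : ℝ≥0∞) ≤ F x := by rw [← htsum x]; exact ENNReal.le_tsum n
      simpa [hF, hR x hx] using h1
    have hsum : ∀ x, HasSum (fun n => (D n x : ℝ)) (f x) := by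
      intro x
      have h1 : HasSum (fun n => D n x) (Real.toNNReal (f x)) := by
        rw [← ENNReal.hasSum_coe]
        have := (ENNReal.summable (f := fun n => (D n x : ℝ≥0∞))).hasSum
        rwa [htsum x] at this
      have h2 := NNReal.hasSum_coe.2 h1
      rwa [Real.coe_toNNReal _ (hf0 x)] at h2
    have hS := fun n => hsimple (D n) R (hD0 n)
    have h1 := hμ.sigma (fun n x => (D n x : ℝ)) f (fun n => (hS n).1) hf
      (fun n x => NNReal.coe_nonneg _) hsum
    refine tendsto_nhds_unique h1 ?_
    simp only [fun n => (hS n).2]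
    simp only [← Finset.mul_sum, ← integral_finsetSum _ fun n _ => (hS n).1.integrable]
    refine Tendsto.const_mul m ?_
    refine tendsto_integral_of_dominated_convergence f (fun N => ?_) hf.integrable
      (fun N => ae_of_all _ fun x => ?_) (ae_of_all _ fun x => (hsum x).tendsto_sum_nat)
    · exact (IsTest.sum (fun n => (hS n).1) N).integrable.aestronglyMeasurable
    · rw [Real.norm_of_nonneg (Finset.sum_nonneg fun n _ => NNReal.coe_nonneg _)]
      exact sum_le_hasSum _ (fun n _ => NNReal.coe_nonneg _) (hsum x)
  intro f hf
  obtain ⟨R, -, hR⟩ := hf.exists_radius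
  obtain ⟨C, hC⟩ := hf.bounded
  have hC0 : 0 ≤ C := (abs_nonneg _).trans (hC 0)
  have hp : IsTest fun x => max (f x) 0 :=
    IsTest.of_bound (hf.measurable.max measurable_const) (C := C) (R := R)
      (fun x => by
        rw [abs_of_nonneg (le_max_right _ _)]
        exact max_le ((le_abs_self _).trans (hC x)) hC0)
      fun x hx => by simp [hR x hx]
  have hn : IsTest fun x => max (-f x) 0 :=
    IsTest.of_bound (hf.measurable.neg.max measurable_const) (C := C) (R := R)
      (fun x => by
        rw [abs_of_nonneg (le_max_right _ _)]
        exact max_le ((neg_le_abs _).trans (hC x)) hC0)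
      fun x hx => by simp [hR x hx]
  have he : f = fun x => 1 * max (f x) 0 + (-1) * max (-f x) 0 := by
    ext x
    rcases le_total 0 (f x) with h | h
    · rw [max_eq_left h, max_eq_right (by linarith)]; ring
    · rw [max_eq_right h, max_eq_left (by linarith)]; ring
  have h1 := hμ.lin 1 (-1) _ _ hp hn
  rw [← he, hnonneg _ hp fun _ => le_max_right _ _, hnonneg _ hn fun _ => le_max_right _ _] at h1
  rw [h1]
  conv_rhs => rw [he]
  rw [integral_add (hp.integrable.const_mul _) (hn.integrable.const_mul _), integral_const_mul,
    integral_const_mul]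
  ring

end IsInvariantFunctional

end Invariant

/-! ### Square integrals, and convergence of means from convergence in probability. -/

section SquareIntegrals

variable {α F : Type*} [MeasurableSpace α] {μ : Measure α} [NormedAddCommGroup F]

lemma eLpNorm_two_sq (f : α → F) : eLpNorm f 2 μ ^ 2 = ∫⁻ x, ‖f x‖ₑ ^ 2 ∂μ := by
  rw [eLpNorm_eq_lintegral_rpow_enorm_toReal two_ne_zero ENNReal.ofNat_ne_top,
    ← ENNReal.rpow_natCast, ← ENNReal.rpow_mul]
  simp

lemma memLp_two_of_lintegral {f : α → F} (hf : AEStronglyMeasurable f μ)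
    (h : ∫⁻ x, ‖f x‖ₑ ^ 2 ∂μ ≠ ∞) : MemLp f 2 μ := by
  refine ⟨hf, ?_⟩
  rw [← eLpNorm_two_sq] at h
  exact lt_top_iff_ne_top.2 fun h' => h (by simp [h'])

/-- Convergence in probability with bounded variances implies convergence of the means. -/
lemma tendsto_integral_of_variance_le {P : Measure α} [IsProbabilityMeasure P] {Y : ℕ → α → ℝ}
    (hY : ∀ n, MemLp (Y n) 2 P) {V : ℝ} (hV : ∀ n, variance (Y n) P ≤ V)
    (h : TendstoInMeasure P Y atTop fun _ => 0) :
    Tendsto (fun n => ∫ ω, Y n ω ∂P) atTop (𝓝 0) := by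
  have hV0 : 0 ≤ V := (variance_nonneg _ _).trans (hV 0)
  rw [tendstoInMeasure_iff_measureReal_norm] at h
  rw [Metric.tendsto_atTop]
  intro ε hε
  -- Chosen so that the final estimate `|a| ≤ 2 * δ * (V + 2)` is less than `ε`.
  set δ : ℝ := ε / (2 * (V + 3)) with hδ
  have hδ0 : 0 < δ := by positivity
  -- The bound `1 / 2` lets `|a| * p` be absorbed into the left side of `h2`; the bound `δ ^ 2`
  -- makes `p / δ` at most `δ`.
  have h1 := (h δ hδ0).eventually (gt_mem_nhds (show (0 : ℝ) < min (1 / 2) (δ ^ 2) by positivity))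
  obtain ⟨n₀, hn₀⟩ := eventually_atTop.1 h1
  refine ⟨n₀, fun n hn => ?_⟩
  have hp := hn₀ n hn
  simp only [sub_zero] at hp
  set B := {x | δ ≤ ‖Y n x‖} with hB
  set p := P.real B with hpdef
  have hp1 : p < 1 / 2 := hp.trans_le (min_le_left _ _)
  have hp2 : p < δ ^ 2 := hp.trans_le (min_le_right _ _)
  set a := ∫ ω, Y n ω ∂P with ha
  have hYi : Integrable (Y n) P := (hY n).integrable one_le_two
  have hsq : Integrable (fun ω => (Y n ω - a) ^ 2) P := ((hY n).sub (memLp_const a)).integrable_sq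
  have hvar : ∫ ω, (Y n ω - a) ^ 2 ∂P ≤ V := by
    rw [← variance_eq_integral hYi.aemeasurable]; exact hV n
  have hBm : NullMeasurableSet B P :=
    nullMeasurableSet_le aemeasurable_const hYi.aemeasurable.norm
  have hBi : Integrable (B.indicator fun _ => (1 : ℝ)) P :=
    (integrable_const _).indicator₀ hBm
  have hBv : ∫ ω, B.indicator (fun _ => (1 : ℝ)) ω ∂P = p := by
    rw [integral_indicator₀ hBm]; simp [hpdef]
  have hbound : ∀ ω, ‖Y n ω‖ ≤
      δ + (|a| + 1 / δ) * B.indicator (fun _ => (1 : ℝ)) ω + δ * (Y n ω - a) ^ 2 := by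
    intro ω
    by_cases hω : ω ∈ B
    · rw [Set.indicator_of_mem hω]
      have e1 : |Y n ω - a| ≤ 1 / δ + δ * (Y n ω - a) ^ 2 := by
        rw [← sq_abs (Y n ω - a)]
        set z := |Y n ω - a|
        have : 1 / δ + δ * z ^ 2 - z = (1 / δ) * ((δ * z - 1 / 2) ^ 2 + 3 / 4) := by
          field_simp; ring
        have : 0 ≤ 1 / δ + δ * z ^ 2 - z := by rw [this]; positivity
        linarith
      have e2 : |Y n ω| ≤ |Y n ω - a| + |a| := by
        have := abs_add_le (Y n ω - a) a
        rwa [sub_add_cancel] at this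
      rw [Real.norm_eq_abs]
      linarith
    · rw [Set.indicator_of_notMem hω]
      have : ‖Y n ω‖ < δ := not_le.1 hω
      have : 0 ≤ δ * (Y n ω - a) ^ 2 := by positivity
      linarith
  have hint : Integrable (fun ω => δ + (|a| + 1 / δ) * B.indicator (fun _ => (1 : ℝ)) ω +
      δ * (Y n ω - a) ^ 2) P :=
    ((integrable_const δ).add (hBi.const_mul _)).add (hsq.const_mul δ)
  have h2 : |a| ≤ δ + (|a| + 1 / δ) * p + δ * V := by
    calc |a| ≤ ∫ ω, ‖Y n ω‖ ∂P := norm_integral_le_integral_norm (Y n)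
      _ ≤ ∫ ω, (δ + (|a| + 1 / δ) * B.indicator (fun _ => (1 : ℝ)) ω +
          δ * (Y n ω - a) ^ 2) ∂P := integral_mono hYi.norm hint hbound
      _ = δ + (|a| + 1 / δ) * p + δ * ∫ ω, (Y n ω - a) ^ 2 ∂P := by
          have hi : Integrable (fun ω => δ + (|a| + 1 / δ) * B.indicator (fun _ => (1 : ℝ)) ω) P :=
            (integrable_const δ).add (hBi.const_mul _)
          rw [integral_add hi (hsq.const_mul δ), integral_add (integrable_const δ) (hBi.const_mul _), integral_const_mul,
            integral_const_mul, hBv]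
          simp
      _ ≤ _ := by gcongr
  have h3 : 1 / δ * p ≤ δ := by
    rw [div_mul_eq_mul_div, one_mul, div_le_iff₀ hδ0]; nlinarith
  have h4 : |a| * p ≤ |a| * (1 / 2) := mul_le_mul_of_nonneg_left hp1.le (abs_nonneg _)
  have h5 : |a| ≤ 2 * (δ * (V + 2)) := by nlinarith
  have h6 : 2 * (δ * (V + 2)) < ε := by
    have : ε = 2 * (δ * (V + 3)) := by rw [hδ]; field_simp
    rw [this]; nlinarith
  rw [Real.dist_eq, sub_zero]
  linarith

end SquareIntegrals

/-! ### Second moments, and rigidity from a pole by duality. -/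

section Random

variable {d : ℕ} {Ω : Type*} [MeasurableSpace Ω] {P : Measure Ω}

namespace RandomSignedMeasure

lemma I_zero (M : RandomSignedMeasure d P) : M.I (fun _ => 0) =ᵐ[P] fun _ => 0 := by
  simpa using M.linear 0 0 _ _ IsTest.zero IsTest.zero

lemma I_sub (M : RandomSignedMeasure d P) {f g : E d → ℝ} (hf : IsTest f) (hg : IsTest g) :
    M.I (fun x => f x - g x) =ᵐ[P] fun ω => M.I f ω - M.I g ω := by
  simpa [sub_eq_add_neg] using M.linear 1 (-1) f g hf hg

lemma I_sum (M : RandomSignedMeasure d P) {f : ℕ → E d → ℝ} (hf : ∀ n, IsTest (f n)) (N : ℕ) :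
    M.I (fun x => ∑ n ∈ Finset.range N, f n x) =ᵐ[P]
      fun ω => ∑ n ∈ Finset.range N, M.I (f n) ω := by
  induction N with
  | zero => simpa using M.I_zero
  | succ N ih =>
    simp only [Finset.sum_range_succ]
    have := M.linear 1 1 _ _ (IsTest.sum hf N) (hf N)
    simp only [one_mul] at this
    filter_upwards [this, ih] with ω h1 h2
    rw [h1, h2]

lemma adm_of_isSpectralMeasure {M : RandomSignedMeasure d P} {S : Measure (E d)}
    (hS : M.IsSpectralMeasure S) : Adm S := by
  have hreal : ∀ f : E d → ℝ, IsTest f → MemLp (cft fun t => (f t : ℂ)) 2 S := by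
    intro f hf
    obtain ⟨R, C, h⟩ := hf.exists_ctest
    refine memLp_two_of_lintegral (continuous_cft h.integrable).aestronglyMeasurable ?_
    rw [← fourier_eq_cft, hS.2 f hf]
    exact ENNReal.ofReal_ne_top
  intro R C f hf
  have hre : IsTest fun t => (f t).re :=
    IsTest.of_bound (Complex.measurable_re.comp hf.meas) (C := C) (R := R)
      (fun x => (Complex.abs_re_le_norm _).trans (hf.bdd x)) fun x hx => by simp [hf.supp x hx]
  have him : IsTest fun t => (f t).im :=
    IsTest.of_bound (Complex.measurable_im.comp hf.meas) (C := C) (R := R)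
      (fun x => (Complex.abs_im_le_norm _).trans (hf.bdd x)) fun x hx => by simp [hf.supp x hx]
  have h1 := (hreal _ hre).add ((hreal _ him).const_mul Complex.I)
  refine h1.ae_eq (ae_of_all _ fun u => ?_)
  rw [Pi.add_apply, ← cft_const_mul, ← cft_add hre.integrable_ofReal
    (him.integrable_ofReal.const_mul _)]
  congr 1; ext t
  rw [mul_comm, Complex.re_add_im]

/-- The closed graph bound read through the spectral measure. Its uniformity over test functions
with common support and sup bounds controls the remainders of countably additive sums. -/
lemma exists_variance_le {M : RandomSignedMeasure d P} {S : Measure (E d)}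
    (hS : M.IsSpectralMeasure S) (R C : ℝ) :
    ∃ V : ℝ, ∀ f : E d → ℝ, Measurable f → (∀ x, |f x| ≤ C) → (∀ x, R < ‖x‖ → f x = 0) →
      variance (M.I f) P ≤ V := by
  obtain ⟨K, hK, h⟩ := (adm_of_isSpectralMeasure hS).exists_bound R
  refine ⟨(K * C) ^ 2, fun f hfm hfC hfR => ?_⟩
  have hf : IsTest f := IsTest.of_bound hfm hfC hfR
  have hC : 0 ≤ C := (abs_nonneg _).trans (hfC 0)
  have hc : CTest R C fun t => (f t : ℂ) :=
    ⟨Complex.measurable_ofReal.comp hfm, fun x => by simpa using hfC x,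
      fun x hx => by simp [hfR x hx]⟩
  rw [← ENNReal.ofReal_le_ofReal_iff (by positivity), ← hS.2 f hf, fourier_eq_cft,
    ← eLpNorm_two_sq, ENNReal.ofReal_pow (by positivity)]
  exact pow_le_pow_left' (h C _ hc) 2

/-- Approximation in `L²` suffices, since an `L²` convergent sequence converges almost surely along
a subsequence. -/
lemma isLinRigid_of_approx {M : RandomSignedMeasure d P} {γ : E d → ℝ} {A : Set (E d)}
    (h : ∀ ε : ℝ≥0∞, 0 < ε → ∃ f, IsTest f ∧ (∀ x ∈ A, f x = 0) ∧
      eLpNorm (fun ω => M.I f ω - M.I (A.indicator γ) ω) 2 P < ε)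
    (hγ : IsTest (A.indicator γ)) : M.IsLinRigid γ A := by
  have hpos : ∀ n : ℕ, (0 : ℝ≥0∞) < (n + 1 : ℝ≥0∞)⁻¹ := fun n =>
    ENNReal.inv_pos.2 (by simp)
  choose f hf hfA hfε using fun n : ℕ => h _ (hpos n)
  have hlim : Tendsto (fun n => eLpNorm (fun ω => M.I (f n) ω - M.I (A.indicator γ) ω) 2 P)
      atTop (𝓝 0) := by
    refine tendsto_of_tendsto_of_tendsto_of_le_of_le tendsto_const_nhds
      (g := fun _ => 0) (h := fun n : ℕ => (n + 1 : ℝ≥0∞)⁻¹) ?_ (fun _ => zero_le)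
      (fun n => (hfε n).le)
    have := (tendsto_add_atTop_iff_nat 1).2 ENNReal.tendsto_inv_nat_nhds_zero
    simpa using this
  obtain ⟨ns, hns, hae⟩ := (tendstoInMeasure_of_tendsto_eLpNorm two_ne_zero
    (fun n => (M.memLp _ (hf n)).1) (M.memLp _ hγ).1 hlim).exists_seq_tendsto_ae
  exact ⟨fun n => f (ns n), fun n => ⟨hf _, hfA _⟩, hae, hlim.comp hns.tendsto_atTop⟩

variable [IsProbabilityMeasure P]

/-- Countable additivity of `M` is in probability only. The remainders `∑ f n - g` share a support
and a sup bound, so their variances are bounded by `exists_variance_le`, and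
`tendsto_integral_of_variance_le` upgrades the convergence to the means. -/
lemma isInvariantFunctional_mean {M : RandomSignedMeasure d P} (hM : M.IsStationary)
    {S : Measure (E d)} (hS : M.IsSpectralMeasure S) :
    IsInvariantFunctional fun f => ∫ ω, M.I f ω ∂P := by
  have hint : ∀ f, IsTest f → Integrable (M.I f) P := fun f hf =>
    (M.memLp f hf).integrable one_le_two
  refine ⟨fun a b f g hf hg => ?_, fun x f hf => (hM x f hf).1, fun f g hf hg hf0 hsum => ?_⟩
  · rw [integral_congr_ae (M.linear a b f g hf hg),
      integral_add ((hint f hf).const_mul a) ((hint g hg).const_mul b), integral_const_mul,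
      integral_const_mul]
  · obtain ⟨R, -, hR⟩ := hg.exists_radius
    obtain ⟨C, hC⟩ := hg.bounded
    have hle : ∀ N x, ∑ n ∈ Finset.range N, f n x ≤ g x := fun N x =>
      sum_le_hasSum _ (fun n _ => hf0 n x) (hsum x)
    have h0 : ∀ N x, 0 ≤ ∑ n ∈ Finset.range N, f n x := fun N x =>
      Finset.sum_nonneg fun n _ => hf0 n x
    obtain ⟨V, hV⟩ := exists_variance_le hS R C
    have hsumT := IsTest.sum hf
    set Y : ℕ → Ω → ℝ := fun N => M.I fun x => ∑ n ∈ Finset.range N, f n x - g x with hY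
    have hYT : ∀ N, IsTest fun x => ∑ n ∈ Finset.range N, f n x - g x :=
      fun N => (hsumT N).sub hg
    have hYae : ∀ N, Y N =ᵐ[P] fun ω => ∑ n ∈ Finset.range N, M.I (f n) ω - M.I g ω := by
      intro N
      filter_upwards [M.I_sub (hsumT N) hg, M.I_sum hf N] with ω h1 h2
      rw [hY]; simp only
      rw [h1, h2]
    have hm : TendstoInMeasure P Y atTop fun _ => 0 := by
      have h1 := M.sigma_additive f g hf hg hf0 hsum
      rw [tendstoInMeasure_iff_norm] at h1 ⊢
      intro ε hε
      refine (h1 ε hε).congr fun N => measure_congr ?_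
      filter_upwards [hYae N] with ω h2
      apply propext
      change ε ≤ ‖_‖ ↔ ε ≤ ‖_‖
      rw [h2, sub_zero]
    have h3 := tendsto_integral_of_variance_le (fun N => M.memLp _ (hYT N)) (V := V)
      (fun N => hV _ (hYT N).measurable (fun x => by
        rw [abs_sub_comm, abs_of_nonneg (by linarith [hle N x])]
        linarith [hle N x, h0 N x, le_abs_self (g x), hC x])
        fun x hx => by
          have h1 := hle N x
          have h2 := h0 N x
          rw [hR x hx] at h1 ⊢
          linarith) hm
    have h4 : ∀ N, ∫ ω, Y N ω ∂P =
        ∑ n ∈ Finset.range N, ∫ ω, M.I (f n) ω ∂P - ∫ ω, M.I g ω ∂P := by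
      intro N
      rw [integral_congr_ae (hYae N), integral_sub (integrable_finsetSum _ fun n _ =>
        hint _ (hf n)) (hint g hg), integral_finsetSum _ fun n _ => hint _ (hf n)]
    have h5 := h3.congr h4
    simpa using h5.add_const (∫ ω, M.I g ω ∂P)

/-- The second moments are given by the spectral measure plus an atom at the origin. -/
lemma exists_second_moment {M : RandomSignedMeasure d P} (hM : M.IsStationary)
    {S : Measure (E d)} (hS : M.IsSpectralMeasure S) :
    ∃ c : ℝ≥0∞, c ≠ ∞ ∧ ∀ f, IsTest f →
      ∫⁻ ω, ‖M.I f ω‖ₑ ^ 2 ∂P = ∫⁻ u, ‖fourier f u‖ₑ ^ 2 ∂(S + c • Measure.dirac 0) := by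
  -- The squared mean is `m² |f̂ 0|²`, that is, an atom of mass `m²` at the origin.
  obtain ⟨m, hm⟩ := (isInvariantFunctional_mean hM hS).exists_eq_integral
  refine ⟨ENNReal.ofReal (m ^ 2), ENNReal.ofReal_ne_top, fun f hf => ?_⟩
  have hL := M.memLp f hf
  have h0 : fourier f 0 = ((∫ x, f x : ℝ) : ℂ) := by
    rw [fourier, ← integral_complex_ofReal]; simp
  have h1 : ∫⁻ ω, ‖M.I f ω‖ₑ ^ 2 ∂P = ENNReal.ofReal (∫ ω, (M.I f ω) ^ 2 ∂P) := by
    rw [ofReal_integral_eq_lintegral_ofReal hL.integrable_sq (ae_of_all _ fun ω => sq_nonneg _)]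
    congr 1; ext ω
    rw [← sq_abs, ENNReal.ofReal_pow (abs_nonneg _), ← Real.enorm_eq_ofReal_abs]
  have h2 := variance_eq_sub hL
  have h3 : ∫ ω, (M.I f ω) ^ 2 ∂P = variance (M.I f) P + m ^ 2 * (∫ x, f x) ^ 2 := by
    rw [h2, hm f hf]; simp [mul_pow]
  rw [h1, h3, ENNReal.ofReal_add (variance_nonneg _ _) (by positivity), lintegral_add_measure,
    hS.2 f hf, lintegral_smul_measure, lintegral_dirac, h0, ENNReal.ofReal_mul (by positivity)]
  congr 2
  rw [← sq_abs, ENNReal.ofReal_pow (abs_nonneg _), ← Real.enorm_eq_ofReal_abs, ← ofReal_norm,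
    ← ofReal_norm, Complex.norm_real]

end RandomSignedMeasure

/-- Reflection of the even measure `κ` exchanges the integrals of `|â + i b̂|²` and `|â - i b̂|²`,
and the parallelogram law bounds `|â|²` by their average. Hence the real part of a complex
approximant of a real function is at least as good an approximant. -/
lemma lintegral_cft_le_of_even {κ : Measure (E d)} (heven : κ.map (fun u => -u) = κ)
    {a b : E d → ℝ} (ha : IsTest a) (hb : IsTest b) :
    ∫⁻ u, ‖cft (fun t => (a t : ℂ)) u‖ₑ ^ 2 ∂κ ≤
      ∫⁻ u, ‖cft (fun t => (a t : ℂ) + Complex.I * (b t : ℂ)) u‖ₑ ^ 2 ∂κ := by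
  have hneg : ∀ f : E d → ℝ, ∀ u, cft (fun t => (f t : ℂ)) (-u) =
      (starRingEnd ℂ) (cft (fun t => (f t : ℂ)) u) := by
    intro f u
    rw [cft, cft, ← integral_conj]
    congr 1; ext t
    rw [map_mul, conj_chr, Complex.conj_ofReal]
  set A := cft fun t => (a t : ℂ) with hA
  set B := cft fun t => (b t : ℂ) with hB
  have hAm : Measurable A := (continuous_cft ha.integrable_ofReal).measurable
  have hBm : Measurable B := (continuous_cft hb.integrable_ofReal).measurable
  have hsum : ∀ u, cft (fun t => (a t : ℂ) + Complex.I * (b t : ℂ)) u = A u + Complex.I * B u := by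
    intro u
    rw [cft_add ha.integrable_ofReal (hb.integrable_ofReal.const_mul _), cft_const_mul]
  simp only [hsum]
  have hm : Measurable fun u => ‖A u + Complex.I * B u‖ₑ ^ 2 := by fun_prop
  have h1 : ∫⁻ u, ‖A u + Complex.I * B u‖ₑ ^ 2 ∂κ = ∫⁻ u, ‖A u - Complex.I * B u‖ₑ ^ 2 ∂κ := by
    conv_lhs => rw [← heven]
    rw [lintegral_map hm measurable_neg]
    congr 1; ext u
    rw [← ofReal_norm, ← ofReal_norm, hA, hB, hneg a, hneg b, ← hA, ← hB, ← Complex.norm_conj]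
    congr 3
    simp [sub_eq_add_neg]
  have h2 : 2 * ∫⁻ u, ‖A u‖ₑ ^ 2 ∂κ ≤ 2 * ∫⁻ u, ‖A u + Complex.I * B u‖ₑ ^ 2 ∂κ := by
    rw [two_mul (∫⁻ u, ‖A u + Complex.I * B u‖ₑ ^ 2 ∂κ)]
    nth_rewrite 2 [h1]
    rw [← lintegral_add_left hm, ← lintegral_const_mul _ (by fun_prop)]
    refine lintegral_mono fun u => ?_
    have h3 : 2 * ‖A u‖ ^ 2 ≤ ‖A u + Complex.I * B u‖ ^ 2 + ‖A u - Complex.I * B u‖ ^ 2 := by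
      have := parallelogram_law_with_norm ℝ (A u) (Complex.I * B u)
      nlinarith [sq_nonneg ‖Complex.I * B u‖]
    have := ENNReal.ofReal_le_ofReal h3
    rw [ENNReal.ofReal_add (by positivity) (by positivity), ENNReal.ofReal_mul (by positivity),
      ENNReal.ofReal_pow (by positivity), ENNReal.ofReal_pow (by positivity),
      ENNReal.ofReal_pow (by positivity)] at this
    simpa [ofReal_norm] using this
  exact (ENNReal.mul_le_mul_iff_right two_ne_zero ENNReal.ofNat_ne_top).1 h2

/-- Approximation in `L²(κ)` by Fourier transforms of functions vanishing on `A`, by duality. -/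
lemma exists_approx_of_specFun_eq_zero {κ : Measure (E d)} (hκ : Adm κ)
    (heven : κ.map (fun u => -u) = κ) {A : Set (E d)} {γ : E d → ℝ} (hγ : IsTest γ)
    (h : ∀ g : E d → ℂ, Measurable g → MemLp g 2 κ →
      (∀ R C (f : E d → ℂ), CTest R C f → (∀ x ∈ A, f x = 0) → specFun κ g f = 0) →
      specFun κ g (fun t => (γ t : ℂ)) = 0) {ε : ℝ≥0∞} (hε : 0 < ε) :
    ∃ f : E d → ℝ, IsTest f ∧ (∀ x ∈ A, f x = 0) ∧
      eLpNorm (cft fun t => ((f t - γ t : ℝ) : ℂ)) 2 κ < ε := by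
  obtain ⟨Rγ, Cγ, hγc⟩ := hγ.exists_ctest
  let K : Submodule ℂ (Lp ℂ 2 κ) :=
    { carrier := {φ | ∃ R C, ∃ f : E d → ℂ, CTest R C f ∧ (∀ x ∈ A, f x = 0) ∧ φ =ᵐ[κ] cft f}
      zero_mem' := ⟨0, 0, fun _ => 0, ⟨measurable_const, by simp, by simp⟩, by simp, by
        filter_upwards [Lp.coeFn_zero ℂ 2 κ] with u hu
        rw [hu]; simp [cft]⟩
      add_mem' := by
        rintro φ ψ ⟨R, C, f, hf, hfA, hφ⟩ ⟨R', C', f', hf', hfA', hψ⟩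
        refine ⟨_, _, _, hf.add hf', fun x hx => by rw [hfA x hx, hfA' x hx, add_zero], ?_⟩
        filter_upwards [Lp.coeFn_add φ ψ, hφ, hψ] with u h1 h2 h3
        rw [h1, Pi.add_apply, h2, h3, cft_add hf.integrable hf'.integrable]
      smul_mem' := by
        rintro c φ ⟨R, C, f, hf, hfA, hφ⟩
        refine ⟨_, _, _, hf.const_mul c, fun x hx => by rw [hfA x hx, mul_zero], ?_⟩
        filter_upwards [Lp.coeFn_smul c φ, hφ] with u h1 h2
        rw [h1, Pi.smul_apply, h2, cft_const_mul, smul_eq_mul] }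
  have hγL := hκ _ _ _ hγc
  -- In a Hilbert space the closure of `K` is its double orthogonal complement. The inner product is
  -- conjugate-linear in the first variable, so `y ∈ Kᗮ` yields the functional with `g = conj y`.
  have hmem : hγL.toLp ∈ K.topologicalClosure := by
    rw [← Submodule.orthogonal_orthogonal_eq_closure, Submodule.mem_orthogonal]
    intro y hy
    rw [Submodule.mem_orthogonal] at hy
    have hym : Measurable y := (Lp.stronglyMeasurable y).measurable
    have hg : MemLp (fun u => (starRingEnd ℂ) (y u)) 2 κ := (Lp.memLp y).star
    have hinner : ∀ (φ : Lp ℂ 2 κ) (f : E d → ℂ), φ =ᵐ[κ] cft f →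
        inner ℂ y φ = specFun κ (fun u => (starRingEnd ℂ) (y u)) f := by
      intro φ f hφ
      rw [L2.inner_def, specFun]
      refine integral_congr_ae ?_
      filter_upwards [hφ] with u hu
      rw [hu]; simp
    rw [hinner _ _ hγL.coeFn_toLp]
    refine h _ (Complex.continuous_conj.measurable.comp hym) hg fun R C f hf hfA => ?_
    have hfL := hκ _ _ _ hf
    rw [← hinner _ _ hfL.coeFn_toLp, ← inner_conj_symm, hy _ ⟨R, C, f, hf, hfA, hfL.coeFn_toLp⟩,
      map_zero]
  have hmem' : hγL.toLp ∈ closure (K : Set (Lp ℂ 2 κ)) := hmem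
  rw [EMetric.mem_closure_iff] at hmem'
  obtain ⟨φ, ⟨R, C, f, hf, hfA, hφ⟩, hdist⟩ := hmem' ε hε
  have hre : IsTest fun t => (f t).re :=
    IsTest.of_bound (Complex.measurable_re.comp hf.meas) (C := C) (R := R)
      (fun x => (Complex.abs_re_le_norm _).trans (hf.bdd x)) fun x hx => by simp [hf.supp x hx]
  have him : IsTest fun t => (f t).im :=
    IsTest.of_bound (Complex.measurable_im.comp hf.meas) (C := C) (R := R)
      (fun x => (Complex.abs_im_le_norm _).trans (hf.bdd x)) fun x hx => by simp [hf.supp x hx]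
  refine ⟨fun t => (f t).re, hre, fun x hx => by simp [hfA x hx], ?_⟩
  refine lt_of_le_of_lt ?_ hdist
  rw [edist_comm, Lp.edist_def]
  have hle := lintegral_cft_le_of_even heven (hre.sub hγ) him
  rw [← eLpNorm_two_sq, ← eLpNorm_two_sq] at hle
  refine ((ENNReal.pow_le_pow_left_iff two_ne_zero).1 hle).trans_eq (eLpNorm_congr_ae ?_)
  filter_upwards [hφ, hγL.coeFn_toLp] with u h1 h2
  rw [Pi.sub_apply, h1, h2, ← cft_sub hf.integrable hγc.integrable]
  congr 1; ext t
  conv_rhs => rw [← Complex.re_add_im (f t)]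
  push_cast
  ring

/-- The null set carries the singular part of `S` together with the atom coming from the mean. In
positive dimension the origin is Lebesgue null, so this atom does not affect the density. -/
lemma exists_null_restrict_eq [Nonempty (Fin d)] {S : Measure (E d)} [SigmaFinite S] (c : ℝ≥0∞) :
    ∃ N : Set (E d), MeasurableSet N ∧ volume N = 0 ∧
      (S + c • Measure.dirac 0).restrict Nᶜ =
        (volume.withDensity (spectralDensity S)).restrict Nᶜ := by
  obtain ⟨T, hT, hT1, hT2⟩ := S.mutuallySingular_singularPart (volume : Measure (E d))
  refine ⟨Tᶜ ∪ {0}, hT.compl.union (measurableSet_singleton 0), ?_, ?_⟩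
  · rw [measure_union_null_iff]
    exact ⟨hT2, measure_singleton 0⟩
  · have hS := S.haveLebesgueDecomposition_add (volume : Measure (E d))
    have h1 : (S.singularPart volume).restrict (Tᶜ ∪ {0})ᶜ = 0 := by
      rw [Measure.restrict_eq_zero]
      refine measure_mono_null (fun x hx => ?_) hT1
      by_contra hxT
      exact hx (Or.inl hxT)
    have h2 : (Measure.dirac (0 : E d)).restrict (Tᶜ ∪ {0})ᶜ = 0 := by
      rw [Measure.restrict_eq_zero, Measure.dirac_apply' _
        (hT.compl.union (measurableSet_singleton 0)).compl]
      simp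
    conv_lhs => rw [hS]
    rw [Measure.restrict_add, Measure.restrict_add, Measure.restrict_smul, h1, h2, smul_zero,
      zero_add, add_zero, spectralDensity]

lemma ofReal_indicator_monomial (η : ℝ) (k : Fin d →₀ ℕ) (t : E d) :
    (((Metric.ball (0 : E d) η).indicator (fun t => ∏ i, t i ^ k i) t : ℝ) : ℂ) =
      ballMonomial η k t := by
  unfold ballMonomial
  by_cases h : t ∈ Metric.ball (0 : E d) η <;> simp [h]

lemma isTest_indicator_monomial {η : ℝ} (hη : 0 < η) (k : Fin d →₀ ℕ) :
    IsTest ((Metric.ball (0 : E d) η).indicator fun t => ∏ i, t i ^ k i) := by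
  obtain ⟨C, hC⟩ := ctest_ballMonomial (d := d) hη k
  refine IsTest.of_bound (C := C) (R := η) ?_ (fun x => ?_) fun x hx => ?_
  · exact Measurable.indicator (by fun_prop) measurableSet_ball
  · have := hC.bdd x
    rwa [← ofReal_indicator_monomial, Complex.norm_real] at this
  · have := hC.supp x hx
    rw [← ofReal_indicator_monomial] at this
    exact_mod_cast this

/-- A pole of order `k` at `0` implies rigidity of order `k`. -/
theorem isLinRigidOfOrder_of_hasPole [IsProbabilityMeasure P] [Nonempty (Fin d)]
    {M : RandomSignedMeasure d P} (hM : M.IsStationary) {S : Measure (E d)} (hS : M.IsSpectralMeasure S)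
    (hord : HasFiniteOrder (spectralDensity S) 0) {k : Fin d →₀ ℕ}
    (hk : HasPole (spectralDensity S) 0 k) {η : ℝ} (hη : 0 < η) :
    M.IsLinRigidOfOrder k (Metric.ball 0 η) := by
  obtain ⟨c, hc, hmom⟩ := RandomSignedMeasure.exists_second_moment hM hS
  have hSadm := RandomSignedMeasure.adm_of_isSpectralMeasure hS
  have := hSadm.isLocallyFiniteMeasure
  set κ := S + c • Measure.dirac (0 : E d) with hκdef
  have hκ : Adm κ := by
    intro R C f hf
    refine memLp_two_of_lintegral (continuous_cft hf.integrable).aestronglyMeasurable ?_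
    rw [hκdef, lintegral_add_measure, lintegral_smul_measure, lintegral_dirac, ← eLpNorm_two_sq]
    refine ENNReal.add_ne_top.2 ⟨ENNReal.pow_ne_top (hSadm R C f hf).2.ne,
      ENNReal.mul_ne_top hc (by simp)⟩
  have heven : κ.map (fun u => -u) = κ := by
    rw [hκdef, Measure.map_add _ _ measurable_neg, hS.1, Measure.map_smul,
      Measure.map_dirac' measurable_neg, neg_zero]
  have := hκ.isLocallyFiniteMeasure
  obtain ⟨N, hNm, hN, hdec⟩ := exists_null_restrict_eq (S := S) c
  have hγ := isTest_indicator_monomial (d := d) hη k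
  refine RandomSignedMeasure.isLinRigid_of_approx (fun ε hε => ?_) hγ
  obtain ⟨f, hf, hfA, hfε⟩ := exists_approx_of_specFun_eq_zero hκ heven
    (A := Metric.ball 0 η) hγ (fun g hgm hg hkill => by
      simp only [ofReal_indicator_monomial]
      exact specFun_ballMonomial_eq_zero hκ hg hgm hη hkill (Measure.measurable_rnDeriv _ _)
        (Measure.rnDeriv_lt_top _ _) hNm hN hdec hord k hk) hε
  refine ⟨f, hf, hfA, lt_of_le_of_lt ?_ hfε⟩
  -- The second moment identity turns the distance in `L²(κ)` into the distance in `L²(P)`.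
  rw [← ENNReal.pow_le_pow_left_iff two_ne_zero, eLpNorm_two_sq, eLpNorm_two_sq,
    ← fourier_eq_cft (fun t => f t - (Metric.ball (0 : E d) η).indicator
      (fun t => ∏ i, t i ^ k i) t), ← hmom _ (hf.sub hγ)]
  refine (lintegral_congr_ae ?_).le
  filter_upwards [M.I_sub hf hγ] with ω hω
  rw [hω]

end Random

/-! ### Smooth functions with prescribed polynomial factors in their transforms, Parseval's identity
and decay. -/

section Derivatives

open scoped SchwartzMap LineDeriv

variable {d : ℕ}

/-- The complex monomial `t ^ k`. -/
noncomputable def mono (k : Fin d →₀ ℕ) (t : E d) : ℂ := ∏ j, (t j : ℂ) ^ k j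

lemma continuous_mono (k : Fin d →₀ ℕ) : Continuous (mono k : E d → ℂ) := by
  unfold mono; fun_prop

lemma eval_monomial_eq_mono (k : Fin d →₀ ℕ) (c : ℂ) (u : E d) :
    MvPolynomial.eval (fun i => ((u i : ℝ) : ℂ)) (MvPolynomial.monomial k c) = c * mono k u := by
  rw [MvPolynomial.eval_monomial, Finsupp.prod_fintype _ _ (by simp), mono]

lemma integral_mul_lineDeriv {φ : 𝓢(E d, ℂ)} (hφ : HasCompactSupport φ) {f f' : E d → ℂ}
    (hf : Continuous f) (hf' : Continuous f') (v : E d)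
    (h : ∀ x, HasLineDerivAt ℝ f (f' x) x v) :
    ∫ x, f x * (∂_{v} φ) x = - ∫ x, f' x * φ x := by
  have hφ' : HasCompactSupport (∂_{v} φ : 𝓢(E d, ℂ)) := by
    have := hφ.fderiv_apply (𝕜 := ℝ) v
    exact this
  refine integral_bilinear_hasLineDerivAt_right_eq_neg_left_of_integrable
    (B := ContinuousLinearMap.mul ℝ ℂ) (v := v) ?_ ?_ ?_ (fun x _ => h x) (fun x _ => ?_)
  · exact (hf'.mul φ.continuous).integrable_of_hasCompactSupport hφ.mul_left
  · exact (hf.mul (SchwartzMap.continuous _)).integrable_of_hasCompactSupport hφ'.mul_left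
  · exact (hf.mul φ.continuous).integrable_of_hasCompactSupport hφ.mul_left
  · exact (φ.differentiableAt.hasFDerivAt).hasLineDerivAt v

lemma hasLineDerivAt_chr (u : E d) (i : Fin d) (x : E d) :
    HasLineDerivAt ℝ (chr (-u)) (-(Complex.I * (u i : ℂ)) * chr (-u) x) x
      (EuclideanSpace.single i 1) := by
  unfold HasLineDerivAt
  have h : (fun s : ℝ => chr (-u) (x + s • EuclideanSpace.single i (1 : ℝ))) =
      fun s : ℝ => chr (-u) x * Complex.exp (-(Complex.I * (u i : ℂ)) * s) := by
    ext s
    rw [chr_add_right]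
    congr 1
    rw [chr, inner_smul_right, EuclideanSpace.inner_single_right]
    congr 1
    simp
    ring
  rw [h]
  have h1 : HasDerivAt (fun s : ℝ => -(Complex.I * (u i : ℂ)) * (s : ℂ))
      (-(Complex.I * (u i : ℂ))) 0 := by
    simpa using (Complex.ofRealCLM.hasDerivAt (x := (0 : ℝ))).const_mul (-(Complex.I * (u i : ℂ)))
  have h2 := (h1.cexp).const_mul (chr (-u) x)
  refine h2.congr_deriv ?_
  rw [Complex.ofReal_zero, mul_zero, Complex.exp_zero]
  ring

lemma hasLineDerivAt_mono (k : Fin d →₀ ℕ) (i : Fin d) (x : E d) :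
    HasLineDerivAt ℝ (mono k) ((k i : ℂ) * mono (k - Finsupp.single i 1) x) x
      (EuclideanSpace.single i 1) := by
  classical
  unfold HasLineDerivAt
  have h : (fun s : ℝ => mono k (x + s • EuclideanSpace.single i (1 : ℝ))) =
      fun s : ℝ => ((x i : ℂ) + s) ^ k i * ∏ j ∈ Finset.univ.erase i, (x j : ℂ) ^ k j := by
    ext s
    rw [mono, ← Finset.mul_prod_erase _ _ (Finset.mem_univ i)]
    congr 1
    · simp
    · refine Finset.prod_congr rfl fun j hj => ?_
      simp [Finset.ne_of_mem_erase hj]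
  rw [h]
  have h1 : HasDerivAt (fun s : ℝ => (x i : ℂ) + (s : ℂ)) 1 0 := by
    simpa using (Complex.ofRealCLM.hasDerivAt (x := (0 : ℝ))).const_add (x i : ℂ)
  have h2 := (h1.pow (k i)).mul_const (∏ j ∈ Finset.univ.erase i, (x j : ℂ) ^ k j)
  refine h2.congr_deriv ?_
  have : ∏ j ∈ Finset.univ.erase i, (x j : ℂ) ^ ((k - Finsupp.single i 1 : Fin d →₀ ℕ) j) =
      ∏ j ∈ Finset.univ.erase i, (x j : ℂ) ^ k j := by
    refine Finset.prod_congr rfl fun j hj => ?_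
    simp [Finsupp.single_eq_of_ne (Finset.ne_of_mem_erase hj)]
  rw [mono, ← Finset.mul_prod_erase _ _ (Finset.mem_univ i), this]
  simp only [Finsupp.coe_tsub, Pi.sub_apply, Finsupp.single_eq_same, Complex.ofReal_zero, add_zero]
  ring

/-- Multiplication of the Fourier transform by a coordinate. -/
lemma exists_schwartz_mul_coord {r : ℝ} {φ : 𝓢(E d, ℂ)} (hφ : tsupport φ ⊆ Metric.closedBall 0 r)
    (i : Fin d) : ∃ χ : 𝓢(E d, ℂ), tsupport χ ⊆ Metric.closedBall 0 r ∧
      (∀ u, cft χ u = (u i : ℂ) * cft φ u) ∧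
      ∀ k : Fin d →₀ ℕ, ∫ t, mono k t * χ t =
        Complex.I * (k i : ℂ) * ∫ t, mono (k - Finsupp.single i 1) t * φ t := by
  have hc : HasCompactSupport φ := (isCompact_closedBall (0 : E d) r).of_isClosed_subset
    (isClosed_tsupport _) hφ
  set e : E d := EuclideanSpace.single i 1
  have hsub : tsupport (∂_{e} φ : 𝓢(E d, ℂ)) ⊆ tsupport φ := by
    refine closure_minimal (fun x hx => ?_) (isClosed_tsupport _)
    by_contra hx'
    apply hx
    have h1 := image_eq_zero_of_notMem_tsupport
      (fun h => hx' (tsupport_fderiv_subset (𝕜 := ℝ) h) : x ∉ tsupport (fderiv ℝ φ))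
    rw [SchwartzMap.lineDerivOp_apply_eq_fderiv, h1]; rfl
  -- Both identities are integrations by parts, against a character and against a monomial. When `k
  -- i = 0` the truncated subtraction in the exponent is harmless, because of the factor `k i`.
  refine ⟨(-Complex.I) • (∂_{e} φ : 𝓢(E d, ℂ)), ?_, fun u => ?_, fun k => ?_⟩
  · refine Set.Subset.trans ?_ (hsub.trans hφ)
    exact tsupport_smul_subset_right (fun _ => -Complex.I) _
  · have h := integral_mul_lineDeriv hc (f' := fun x => -(Complex.I * (u i : ℂ)) * chr (-u) x)
      (continuous_chr_right (-u))
      ((continuous_const.mul (continuous_chr_right (-u)))) e (hasLineDerivAt_chr u i)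
    have h1 : cft ((-Complex.I) • (∂_{e} φ : 𝓢(E d, ℂ)) : 𝓢(E d, ℂ)) u =
        -Complex.I * ∫ x, chr (-u) x * (∂_{e} φ) x := by
      rw [← integral_const_mul, cft]
      congr 1; ext t
      simp only [smul_apply, smul_eq_mul]; ring
    have h2 : ∫ x, -(Complex.I * (u i : ℂ)) * chr (-u) x * φ x =
        -(Complex.I * (u i : ℂ)) * cft φ u := by
      rw [cft, ← integral_const_mul]
      congr 1; ext t; ring
    rw [h1, h, h2]
    linear_combination (-(u i : ℂ) * cft φ u) * Complex.I_mul_I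
  · have h := integral_mul_lineDeriv hc
      (f' := fun x => (k i : ℂ) * mono (k - Finsupp.single i 1) x) (continuous_mono k)
      (continuous_const.mul (continuous_mono (k - Finsupp.single i 1))) e
      (hasLineDerivAt_mono k i)
    have h1 : ∫ t, mono k t * ((-Complex.I) • (∂_{e} φ : 𝓢(E d, ℂ)) : 𝓢(E d, ℂ)) t =
        -Complex.I * ∫ x, mono k x * (∂_{e} φ) x := by
      rw [← integral_const_mul]
      congr 1; ext t
      simp only [smul_apply, smul_eq_mul]; ring
    have h2 : ∫ x, (k i : ℂ) * mono (k - Finsupp.single i 1) x * φ x =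
        (k i : ℂ) * ∫ t, mono (k - Finsupp.single i 1) t * φ t := by
      rw [← integral_const_mul]
      congr 1; ext t; ring
    rw [h1, h, h2]; ring

/-- Multiplication of the Fourier transform by a monomial. -/
lemma exists_schwartz_mul_mono {r : ℝ} {φ : 𝓢(E d, ℂ)} (hφ : tsupport φ ⊆ Metric.closedBall 0 r)
    (hφ0 : ∫ t, φ t ≠ 0) (m : Fin d →₀ ℕ) :
    ∃ χ : 𝓢(E d, ℂ), tsupport χ ⊆ Metric.closedBall 0 r ∧
      (∀ u, cft χ u = mono m u * cft φ u) ∧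
      (∀ k : Fin d →₀ ℕ, ¬ m ≤ k → ∫ t, mono k t * χ t = 0) ∧ ∫ t, mono m t * χ t ≠ 0 := by
  induction m using Finsupp.induction with
  | zero =>
    refine ⟨φ, hφ, fun u => by simp [mono], fun k hk => absurd (zero_le) hk, ?_⟩
    simpa [mono] using hφ0
  | single_add i b f hi hb ih =>
    -- The inner induction on the exponent of coordinate `i` goes through `b = 0` and uses neither
    -- condition.
    clear hb hi
    induction b with
    | zero => simpa using ih
    | succ b ihb =>
      obtain ⟨χ, h1, h2, h3, h4⟩ := ihb
      obtain ⟨χ', g1, g2, g3⟩ := exists_schwartz_mul_coord h1 i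
      have hm : Finsupp.single i (b + 1) + f = Finsupp.single i b + f + Finsupp.single i 1 := by
        rw [Finsupp.single_add, add_right_comm]
      rw [hm]
      set m := Finsupp.single i b + f
      refine ⟨χ', g1, fun u => ?_, fun k hk => ?_, ?_⟩
      · rw [g2, h2, ← mul_assoc]
        congr 1
        classical
        simp only [mono, Finsupp.add_apply, pow_add, Finset.prod_mul_distrib]
        rw [Finset.prod_eq_single i (f := fun j => (u j : ℂ) ^ (Finsupp.single i 1) j)
          (fun j _ hj => by simp [Finsupp.single_eq_of_ne hj]) (by simp)]
        simp [mul_comm]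
      · rw [g3]
        rcases Nat.eq_zero_or_pos (k i) with h0 | h0
        · simp [h0]
        · rw [h3, mul_zero]
          intro h
          apply hk
          have hle : Finsupp.single i 1 ≤ k := by
            rw [Finsupp.single_le_iff]; exact h0
          exact (le_tsub_iff_right hle).1 h
      · rw [g3, add_tsub_cancel_right]
        refine mul_ne_zero (mul_ne_zero Complex.I_ne_zero ?_) h4
        rw [Finsupp.add_apply, Finsupp.add_apply, Finsupp.single_eq_same, Finsupp.single_eq_same]
        exact_mod_cast (by omega : b + f i + 1 ≠ 0)

/-- Multiplication of the Fourier transform by a polynomial. -/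
lemma exists_schwartz_mul_poly {r : ℝ} {φ : 𝓢(E d, ℂ)} (hφ : tsupport φ ⊆ Metric.closedBall 0 r)
    (hφ0 : ∫ t, φ t ≠ 0) (p : MvPolynomial (Fin d) ℂ) {k : Fin d →₀ ℕ}
    (hp : ∀ m ≤ k, m ≠ k → p.coeff m = 0) (hpk : p.coeff k ≠ 0) :
    ∃ χ : 𝓢(E d, ℂ), tsupport χ ⊆ Metric.closedBall 0 r ∧
      (∀ u : E d, cft χ u = MvPolynomial.eval (fun i => ((u i : ℝ) : ℂ)) p * cft φ u) ∧
      ∫ t, mono k t * χ t ≠ 0 := by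
  choose χ h1 h2 h3 h4 using exists_schwartz_mul_mono hφ hφ0
  have hval : ∀ t, (∑ m ∈ p.support, p.coeff m • χ m : 𝓢(E d, ℂ)) t =
      ∑ m ∈ p.support, p.coeff m * χ m t := fun t => by
    simp
  refine ⟨∑ m ∈ p.support, p.coeff m • χ m, ?_, fun u => ?_, ?_⟩
  · refine closure_minimal (fun x hx => ?_) Metric.isClosed_closedBall
    by_contra hx'
    apply hx
    rw [hval]
    refine Finset.sum_eq_zero fun m _ => ?_
    rw [image_eq_zero_of_notMem_tsupport fun h => hx' (h1 m h), mul_zero]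
  · have : cft (∑ m ∈ p.support, p.coeff m • χ m : 𝓢(E d, ℂ)) u =
        ∑ m ∈ p.support, p.coeff m * cft (χ m) u := by
      rw [show ((∑ m ∈ p.support, p.coeff m • χ m : 𝓢(E d, ℂ)) : E d → ℂ) = _ from funext hval,
        cft_sum _ fun m _ => (χ m).integrable.const_mul _]
      refine Finset.sum_congr rfl fun m _ => ?_
      rw [cft_const_mul]
    rw [this]
    conv_rhs => rw [p.as_sum, map_sum, Finset.sum_mul]
    refine Finset.sum_congr rfl fun m _ => ?_
    rw [h2, eval_monomial_eq_mono]; ring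
  · have hint : ∀ m, Integrable fun t => mono k t * χ m t := fun m =>
      ((continuous_mono k).mul (χ m).continuous).integrable_of_hasCompactSupport
        (HasCompactSupport.mul_left ((isCompact_closedBall (0 : E d) r).of_isClosed_subset
          (isClosed_tsupport _) (h1 m)))
    have : ∫ t, mono k t * (∑ m ∈ p.support, p.coeff m • χ m : 𝓢(E d, ℂ)) t =
        ∑ m ∈ p.support, p.coeff m * ∫ t, mono k t * χ m t := by
      simp only [hval, Finset.mul_sum, ← integral_const_mul]
      rw [← integral_finsetSum _ fun m _ => (hint m).const_mul _]
      congr 1; ext t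
      refine Finset.sum_congr rfl fun m _ => ?_
      ring
    -- A term with `m ≤ k`, `m ≠ k` has zero coefficient in `p`, and one with `¬ m ≤ k` has zero
    -- `k`-th moment; only `m = k` survives.
    rw [this, Finset.sum_eq_single k]
    · exact mul_ne_zero hpk (h4 k)
    · intro m hm hmk
      by_cases hle : m ≤ k
      · exact absurd (hp m hle hmk) (MvPolynomial.mem_support_iff.1 hm)
      · rw [h3 m k hle, mul_zero]
    · intro h
      exact absurd (MvPolynomial.mem_support_iff.2 hpk) h

/-- Parseval's identity. -/
lemma integral_cft_mul_cft {R C : ℝ} {f : E d → ℂ} (hf : CTest R C f) (φ : 𝓢(E d, ℂ)) :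
    ∫ u, cft f u * cft φ u = (((2 * Real.pi) ^ d : ℝ) : ℂ) * ∫ t, f t * φ (-t) := by
  have hF := integrable_cft_schwartz φ
  have hprod : Integrable (fun p : E d × E d => cft φ p.1 * f p.2) (volume.prod volume) :=
    hF.mul_prod hf.integrable
  have hint : Integrable (Function.uncurry fun u t => chr (-u) t * f t * cft φ u)
      (volume.prod volume) := by
    have hm : AEStronglyMeasurable (fun p : E d × E d => chr (-p.1) p.2)
        (volume.prod volume) :=
      (continuous_chr.comp (continuous_fst.neg.prodMk continuous_snd)).aestronglyMeasurable
    have := hprod.bdd_mul (c := 1) hm (ae_of_all _ fun p => by simp [norm_chr])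
    refine this.congr (ae_of_all _ fun p => ?_)
    simp only [Function.uncurry]; ring
  calc ∫ u, cft f u * cft φ u = ∫ u, ∫ t, chr (-u) t * f t * cft φ u := by
        congr 1; ext u
        rw [integral_mul_const, cft]
    _ = ∫ t, ∫ u, chr (-u) t * f t * cft φ u := integral_integral_swap hint
    _ = _ := by
        rw [← integral_const_mul]
        congr 1; ext t
        rw [schwartz_eq_integral_cft φ (-t)]
        have h1 : ∫ u, chr (-u) t * f t * cft φ u = f t * ∫ v, chr v (-t) * cft φ v := by
          rw [← integral_const_mul]
          congr 1; ext u
          have : chr (-u) t = chr u (-t) := by simp [chr]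
          rw [this]; ring
        have h2 : (((2 * Real.pi) ^ d : ℝ) : ℂ) * ((((2 * Real.pi) ^ d)⁻¹ : ℝ) : ℂ) = 1 := by
          rw [← Complex.ofReal_mul, mul_inv_cancel₀ (by positivity), Complex.ofReal_one]
        rw [h1]
        linear_combination (-(f t * ∫ v, chr v (-t) * cft φ v)) * h2

lemma exists_norm_cft_schwartz_le (φ : 𝓢(E d, ℂ)) (n : ℕ) :
    ∃ C : ℝ, 0 ≤ C ∧ ∀ u, (1 + ‖u‖) ^ n * ‖cft φ u‖ ≤ C := by
  set Φ : 𝓢(E d, ℂ) := FourierTransform.fourier φ with hΦ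
  obtain ⟨C0, hC0, h0⟩ := Φ.decay 0 0
  obtain ⟨C1, hC1, h1⟩ := Φ.decay n 0
  simp only [norm_iteratedFDeriv_zero, pow_zero, one_mul] at h0 h1
  refine ⟨2 ^ n * (C0 + (2 * Real.pi) ^ n * C1), by positivity, fun u => ?_⟩
  have e : cft φ u = Φ ((2 * Real.pi)⁻¹ • u) := by
    rw [cft_eq_fourier, hΦ, SchwartzMap.fourier_coe]
  rw [e]
  have hb : (1 + ‖u‖) ^ n ≤ 2 ^ n * (1 + ‖u‖ ^ n) := by
    rcases le_total 1 ‖u‖ with h | h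
    · calc (1 + ‖u‖) ^ n ≤ (2 * ‖u‖) ^ n := by gcongr; linarith
        _ = 2 ^ n * ‖u‖ ^ n := by ring
        _ ≤ _ := by gcongr; linarith
    · calc (1 + ‖u‖) ^ n ≤ 2 ^ n := by gcongr; linarith
        _ ≤ _ := le_mul_of_one_le_right (by positivity) (by
          have : 0 ≤ ‖u‖ ^ n := by positivity
          linarith)
  have h2 := h1 ((2 * Real.pi)⁻¹ • u)
  rw [norm_smul, Real.norm_of_nonneg (by positivity), mul_pow, inv_pow] at h2
  have h3 : ‖u‖ ^ n * ‖Φ ((2 * Real.pi)⁻¹ • u)‖ ≤ (2 * Real.pi) ^ n * C1 := by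
    calc _ = (2 * Real.pi) ^ n * (((2 * Real.pi) ^ n)⁻¹ * ‖u‖ ^ n *
          ‖Φ ((2 * Real.pi)⁻¹ • u)‖) := by field_simp
      _ ≤ _ := by gcongr
  calc _ ≤ 2 ^ n * (1 + ‖u‖ ^ n) * ‖Φ ((2 * Real.pi)⁻¹ • u)‖ := by gcongr
    _ = 2 ^ n * (‖Φ ((2 * Real.pi)⁻¹ • u)‖ + ‖u‖ ^ n * ‖Φ ((2 * Real.pi)⁻¹ • u)‖) := by ring
    _ ≤ _ := by gcongr; exact h0 _

end Derivatives

/-! ### Local integrability against `s⁻¹` and construction of the polynomial. -/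

section Converse

open scoped SchwartzMap

variable {d : ℕ}

/-- Evaluation of a complex polynomial at a real vector. -/
noncomputable def polyEval (p : MvPolynomial (Fin d) ℂ) (u : E d) : ℂ :=
  MvPolynomial.eval (fun i => ((u i : ℝ) : ℂ)) p

lemma continuous_polyEval (p : MvPolynomial (Fin d) ℂ) : Continuous (polyEval p) :=
  (MvPolynomial.continuous_eval p).comp (by fun_prop)

lemma polyEval_mul (p q : MvPolynomial (Fin d) ℂ) (u : E d) :
    polyEval (p * q) u = polyEval p u * polyEval q u := map_mul _ _ _

lemma polyEval_zero_right (p : MvPolynomial (Fin d) ℂ) : polyEval p 0 = p.coeff 0 := by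
  simp [polyEval, MvPolynomial.eval_zero', MvPolynomial.constantCoeff_eq]

/-- `|g|² / s` is integrable around `x`. -/
def LocInt (s : E d → ℝ≥0∞) (g : E d → ℂ) (x : E d) : Prop :=
  ∃ ε : ℝ, 0 < ε ∧ ∫⁻ u in Metric.ball x ε, ‖g u‖ₑ ^ 2 * (s u)⁻¹ < ∞

variable {s : E d → ℝ≥0∞} {x : E d} {g g' : E d → ℂ}

lemma LocInt.of_isBigO (hg : LocInt s g x) (h : g' =O[𝓝 x] g) : LocInt s g' x := by
  obtain ⟨ε, hε, hfin⟩ := hg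
  obtain ⟨C, hC⟩ := h.bound
  obtain ⟨δ, hδ, hball⟩ := Metric.eventually_nhds_iff_ball.1 hC
  refine ⟨min ε δ, lt_min hε hδ, ?_⟩
  calc ∫⁻ u in Metric.ball x (min ε δ), ‖g' u‖ₑ ^ 2 * (s u)⁻¹
      ≤ ∫⁻ u in Metric.ball x (min ε δ), ENNReal.ofReal C ^ 2 * (‖g u‖ₑ ^ 2 * (s u)⁻¹) := by
        refine setLIntegral_mono' measurableSet_ball fun u hu => ?_
        rw [← mul_assoc, ← mul_pow]
        gcongr
        rw [← ofReal_norm, ← ofReal_norm, ← ENNReal.ofReal_mul' (norm_nonneg _)]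
        exact ENNReal.ofReal_le_ofReal
          (hball u (Metric.ball_subset_ball (min_le_right _ _) hu))
    _ = ENNReal.ofReal C ^ 2 *
          ∫⁻ u in Metric.ball x (min ε δ), ‖g u‖ₑ ^ 2 * (s u)⁻¹ :=
        lintegral_const_mul' _ _ (ENNReal.pow_ne_top ENNReal.ofReal_ne_top)
    _ < ∞ := ENNReal.mul_lt_top (ENNReal.pow_lt_top ENNReal.ofReal_lt_top)
        ((lintegral_mono_set (Metric.ball_subset_ball (min_le_left _ _))).trans_lt hfin)

lemma LocInt.mul_right (hg : LocInt s g x) (hg' : ContinuousAt g' x) :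
    LocInt s (fun u => g u * g' u) x := by
  refine hg.of_isBigO ?_
  simpa using (Asymptotics.isBigO_refl g (𝓝 x)).mul (hg'.tendsto.isBigO_one ℂ)

lemma LocInt.polyEval_mul {p : MvPolynomial (Fin d) ℂ} (hp : LocInt s (polyEval p) x)
    (r : MvPolynomial (Fin d) ℂ) : LocInt s (polyEval (p * r)) x := by
  have := hp.mul_right (continuous_polyEval r).continuousAt
  rwa [← funext (LinearRigidity.polyEval_mul p r)] at this

lemma LocInt.of_one (h : LocInt s (fun _ => 1) x) (hg : ContinuousAt g x) : LocInt s g x :=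
  h.of_isBigO (hg.tendsto.isBigO_one ℂ)

/-- The polynomial witnessing that `x` is not a pole has a nonzero constant term, so it is bounded
away from `0` near `x` and can be replaced by `1`. -/
lemma locInt_one_of_notMem_poles (hx : x ∉ poles s) : LocInt s (fun _ => 1) x := by
  simp only [poles, HasPole, Set.mem_ofPred_eq, not_forall] at hx
  obtain ⟨Q, hQ, hQ0⟩ := hx
  refine LocInt.of_isBigO (g := fun u => polyEval Q (u - x)) hQ ?_
  have h : Tendsto (fun u => polyEval Q (u - x)) (𝓝 x) (𝓝 (Q.coeff 0)) := by
    have hc : Continuous fun u => polyEval Q (u - x) :=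
      (continuous_polyEval Q).comp (continuous_id.sub continuous_const)
    simpa [polyEval_zero_right] using hc.tendsto x
  refine (Asymptotics.isBigO_const_left_iff_pos_le_norm one_ne_zero).2
    ⟨‖Q.coeff 0‖ / 2, by positivity, ?_⟩
  filter_upwards [h.norm.eventually_const_lt (half_lt_self (norm_pos_iff.2 hQ0))] with u hu
  exact hu.le

lemma hasFiniteOrder_iff_locInt :
    HasFiniteOrder s x ↔ ∃ q : ℕ, LocInt s (fun u => (‖u - x‖ : ℂ) ^ q) x := by
  have h : ∀ q : ℕ, ∀ u : E d, ‖(‖u - x‖ : ℂ) ^ q‖ₑ ^ 2 = ‖u - x‖ₑ ^ (2 * q) := fun q u => by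
    rw [enorm_pow, ← pow_mul, mul_comm 2 q, ← ofReal_norm, Complex.norm_real, norm_norm,
      ofReal_norm]
  simp only [HasFiniteOrder, LocInt, h]
  exact ⟨fun ⟨ε, q, a⟩ => ⟨q, ε, a⟩, fun ⟨q, ε, a⟩ => ⟨ε, q, a⟩⟩

lemma IsSimple.hasFiniteOrder (hs : IsSimple s) (x : E d) : HasFiniteOrder s x := by
  by_cases hx : x ∈ poles s
  · exact hs.2.1 x hx
  · exact hasFiniteOrder_iff_locInt.2 ⟨0, by simpa using locInt_one_of_notMem_poles hx⟩

lemma HasFiniteOrder.exists_coord_pow (hx : HasFiniteOrder s x) (i : Fin d) :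
    ∃ q : ℕ, LocInt s (fun u => ((u i : ℂ) - x i) ^ q) x := by
  obtain ⟨q, hq⟩ := hasFiniteOrder_iff_locInt.1 hx
  refine ⟨q, hq.of_isBigO (Asymptotics.IsBigO.pow (Asymptotics.isBigO_of_le _ fun u => ?_) q)⟩
  rw [← Complex.ofReal_sub, Complex.norm_real, Complex.norm_real, norm_norm]
  exact abs_apply_le_norm (u - x) i

/-- A polynomial not vanishing at `0` that cancels the singularities of `s⁻¹` off `0`. -/
lemma IsSimple.exists_poly (hs : IsSimple s) : ∃ p : MvPolynomial (Fin d) ℂ, p.coeff 0 ≠ 0 ∧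
    ∀ x : E d, x ≠ 0 → LocInt s (polyEval p) x := by
  have key : ∀ T : Finset (E d), (0 : E d) ∉ T → ∃ p : MvPolynomial (Fin d) ℂ, p.coeff 0 ≠ 0 ∧
      ∀ x ∈ T, LocInt s (polyEval p) x := by
    intro T
    induction T using Finset.cons_induction with
    | empty => exact fun _ => ⟨1, by simp, by simp⟩
    | cons y T hy ih =>
      intro hT
      rw [Finset.mem_cons, not_or] at hT
      obtain ⟨p, hp0, hp⟩ := ih hT.2
      obtain ⟨i, hi⟩ : ∃ i, y i ≠ 0 := by
        by_contra! h
        exact hT.1 (by ext i; simp [h i])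
      -- Since `y i ≠ 0`, the factor `(X i - y i) ^ q` cancels the pole at `y` without vanishing at
      -- `0`.
      obtain ⟨q, hq⟩ := (hs.hasFiniteOrder y).exists_coord_pow i
      set r : MvPolynomial (Fin d) ℂ := (MvPolynomial.X i - MvPolynomial.C (y i : ℂ)) ^ q
      have hr : ∀ u, polyEval r u = ((u i : ℂ) - y i) ^ q := fun u => by simp [polyEval, r]
      refine ⟨r * p, ?_, fun x hx => ?_⟩
      · rw [← polyEval_zero_right, polyEval_mul, hr, polyEval_zero_right]
        refine mul_ne_zero (pow_ne_zero _ ?_) hp0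
        simpa using hi
      · rcases Finset.mem_cons.1 hx with rfl | hx
        · rw [← funext hr] at hq
          exact hq.polyEval_mul p
        · exact mul_comm r p ▸ (hp x hx).polyEval_mul r
  obtain ⟨p, hp0, hp⟩ := key (hs.1.toFinset.erase 0) (Finset.notMem_erase _ _)
  refine ⟨p, hp0, fun x hx => ?_⟩
  by_cases hxp : x ∈ poles s
  · exact hp x (by simp [hx, hxp])
  · exact (locInt_one_of_notMem_poles hxp).of_one (continuous_polyEval p).continuousAt

/-- Take `j` minimal among the exponents of `Q` below `k` and multiply by the monomial of exponent
`k - j`: the exponent `j` moves to `k`, and any other exponent landing below `k` would come from one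
below `j`. -/
lemma exists_monomial_mul_coeff {Q : MvPolynomial (Fin d) ℂ} {k : Fin d →₀ ℕ}
    (hk : Q.coeff k ≠ 0) : ∃ r : MvPolynomial (Fin d) ℂ,
      (∀ m ≤ k, m ≠ k → (Q * r).coeff m = 0) ∧ (Q * r).coeff k ≠ 0 := by
  obtain ⟨j, hj⟩ := exists_minimal_of_wellFoundedLT
    (fun j => j ≤ k ∧ Q.coeff j ≠ 0) ⟨k, le_rfl, hk⟩
  obtain ⟨hjk, hj0⟩ := hj.prop
  refine ⟨MvPolynomial.monomial (k - j) 1, fun m hm hmk => ?_, ?_⟩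
  · rw [MvPolynomial.coeff_mul_monomial', mul_one]
    split_ifs with h
    · by_contra h0
      have hle : m - (k - j) ≤ j := by
        rw [tsub_le_iff_right, add_tsub_cancel_of_le hjk]
        exact hm
      have := hj.le_of_le ⟨hle.trans hjk, h0⟩ hle
      have heq : m - (k - j) = j := le_antisymm hle this
      apply hmk
      rw [← tsub_add_cancel_of_le h, heq, add_tsub_cancel_of_le hjk]
    · rfl
  · rw [MvPolynomial.coeff_mul_monomial', if_pos tsub_le_self, mul_one]
    have : k - (k - j) = j := by
      ext i
      have := hjk i
      simp only [Finsupp.tsub_apply]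
      omega
    rwa [this]

lemma coeff_mul_of_lower_eq_zero {p r : MvPolynomial (Fin d) ℂ} {k : Fin d →₀ ℕ}
    (hp : ∀ m ≤ k, m ≠ k → p.coeff m = 0) {m : Fin d →₀ ℕ} (hm : m ≤ k) :
    (p * r).coeff m = if m = k then p.coeff k * r.coeff 0 else 0 := by
  classical
  rw [MvPolynomial.coeff_mul]
  split_ifs with h
  · subst h
    rw [Finset.sum_eq_single (m, 0)]
    · rintro ⟨a, b⟩ hab hne
      rw [Finset.HasAntidiagonal.mem_antidiagonal] at hab
      simp only at hab
      have ha : a ≠ m := by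
        rintro rfl
        exact hne (by rw [add_eq_left.1 hab])
      rw [hp a (hab ▸ le_self_add) ha, zero_mul]
    · simp
  · refine Finset.sum_eq_zero ?_
    rintro ⟨a, b⟩ hab
    rw [Finset.HasAntidiagonal.mem_antidiagonal] at hab
    simp only at hab
    have hle : a ≤ m := hab ▸ le_self_add
    rw [hp a (hle.trans hm) (fun h' => h (le_antisymm hm (h' ▸ hle))), zero_mul]

/-- The order of the two corrections matters: once the coefficients strictly below `k` vanish, a
factor with nonzero constant term changes the coefficients at exponents `≤ k` only by scaling the
one at `k`. -/
lemma IsSimple.exists_poly_of_not_hasPole (hs : IsSimple s) {k : Fin d →₀ ℕ}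
    (hk : ¬ HasPole s 0 k) : ∃ p : MvPolynomial (Fin d) ℂ,
      (∀ m ≤ k, m ≠ k → p.coeff m = 0) ∧ p.coeff k ≠ 0 ∧
      ∀ x : E d, LocInt s (polyEval p) x := by
  simp only [HasPole, not_forall, sub_zero] at hk
  obtain ⟨Q, hQ, hQk⟩ := hk
  obtain ⟨r, hr, hrk⟩ := exists_monomial_mul_coeff hQk
  obtain ⟨p, hp0, hp⟩ := hs.exists_poly
  refine ⟨Q * r * p, fun m hm hmk => ?_, ?_, fun x => ?_⟩
  · rw [coeff_mul_of_lower_eq_zero hr hm, if_neg hmk]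
  · rw [coeff_mul_of_lower_eq_zero hr le_rfl, if_pos rfl]
    exact mul_ne_zero hrk hp0
  · by_cases hx : x = 0
    · subst hx
      have hQ' : LocInt s (polyEval Q) 0 := hQ
      exact mul_assoc Q r p ▸ hQ'.polyEval_mul (r * p)
    · exact mul_comm p (Q * r) ▸ (hp x hx).polyEval_mul (Q * r)

lemma IsSimple.exists_radius (hs : IsSimple s) : ∃ (R c : ℝ) (p : ℕ), 0 < c ∧
    ∀ᵐ u : E d, R ≤ ‖u‖ → ENNReal.ofReal (c * ((1 + ‖u‖) ^ p)⁻¹) ≤ s u := by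
  obtain ⟨hfin, -, ε, c, p, -, hc, h⟩ := hs
  obtain ⟨R, hR⟩ := hfin.isBounded.exists_norm_le
  refine ⟨R + ε, c, p, hc, ?_⟩
  filter_upwards [h] with u hu hle
  refine hu fun v hv => ?_
  have h1 := hR v hv
  have h2 := norm_sub_norm_le u v
  rw [dist_eq_norm]
  linarith

/-- Compactness turns local integrability into integrability on a large ball containing the poles.
Outside it, `s⁻¹` grows at most polynomially and rapid decay of `g` takes over. -/
lemma IsSimple.lintegral_lt_top (hs : IsSimple s) (hg : ∀ x, LocInt s g x)
    (hdec : ∀ n : ℕ, ∃ C : ℝ, 0 ≤ C ∧ ∀ u, (1 + ‖u‖) ^ n * ‖g u‖ ≤ C) :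
    ∫⁻ u, ‖g u‖ₑ ^ 2 * (s u)⁻¹ < ∞ := by
  obtain ⟨R, c, p, hc, hle⟩ := hs.exists_radius
  rw [← lintegral_add_compl _ (measurableSet_closedBall (x := (0 : E d)) (ε := R))]
  refine ENNReal.add_lt_top.2 ⟨?_, ?_⟩
  · refine (isCompact_closedBall (0 : E d) R).induction_on
      (p := fun t => ∫⁻ u in t, ‖g u‖ₑ ^ 2 * (s u)⁻¹ < ∞) (by simp)
      (fun t t' h h' => (lintegral_mono_set h).trans_lt h')
      (fun t t' h h' => (lintegral_union_le _ _ _).trans_lt (ENNReal.add_lt_top.2 ⟨h, h'⟩))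
      fun x _ => ?_
    obtain ⟨ε, hε, h⟩ := hg x
    exact ⟨_, mem_nhdsWithin_of_mem_nhds (Metric.ball_mem_nhds x hε), h⟩
  -- The exponent absorbs the growth `(1 + ‖u‖) ^ p` of `s⁻¹` and leaves the integrable weight `(1 +
  -- ‖u‖) ^ (-(d + 1))`.
  · obtain ⟨C, hC, hb⟩ := hdec (p + d + 1)
    calc ∫⁻ u in (Metric.closedBall (0 : E d) R)ᶜ, ‖g u‖ₑ ^ 2 * (s u)⁻¹
        ≤ ∫⁻ u in (Metric.closedBall (0 : E d) R)ᶜ,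
            ENNReal.ofReal (C ^ 2 * c⁻¹) * ENNReal.ofReal ((1 + ‖u‖) ^ (-(d + 1 : ℝ))) := by
          refine setLIntegral_mono_ae' measurableSet_closedBall.compl ?_
          filter_upwards [hle] with u hu hmem
          have hRu : R ≤ ‖u‖ := by
            have : R < ‖u‖ := by simpa using hmem
            exact this.le
          have h1 : (s u)⁻¹ ≤ ENNReal.ofReal (c⁻¹ * (1 + ‖u‖) ^ p) := by
            refine (ENNReal.inv_le_inv.2 (hu hRu)).trans_eq ?_
            rw [← ENNReal.ofReal_inv_of_pos (by positivity), mul_inv, inv_inv]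
          have h2 : ‖g u‖ₑ ^ 2 = ENNReal.ofReal (‖g u‖ ^ 2) := by
            rw [← ofReal_norm, ENNReal.ofReal_pow (norm_nonneg _)]
          rw [h2]
          refine (mul_le_mul_right h1 _).trans ?_
          rw [← ENNReal.ofReal_mul (by positivity), ← ENNReal.ofReal_mul (by positivity)]
          refine ENNReal.ofReal_le_ofReal ?_
          have hpos : 0 < 1 + ‖u‖ := by positivity
          have hone : 1 ≤ 1 + ‖u‖ := by linarith [norm_nonneg u]
          have e : (1 + ‖u‖) ^ (-(d + 1 : ℝ)) = ((1 + ‖u‖) ^ (d + 1))⁻¹ := by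
            rw [Real.rpow_neg hpos.le]
            norm_cast
          have h3 : ‖g u‖ ≤ C * ((1 + ‖u‖) ^ (p + d + 1))⁻¹ := by
            rw [← div_eq_mul_inv, le_div_iff₀ (by positivity), mul_comm]
            exact hb u
          rw [e]
          calc ‖g u‖ ^ 2 * (c⁻¹ * (1 + ‖u‖) ^ p)
              ≤ (C * ((1 + ‖u‖) ^ (p + d + 1))⁻¹) ^ 2 * (c⁻¹ * (1 + ‖u‖) ^ p) := by gcongr
            _ = C ^ 2 * c⁻¹ * ((1 + ‖u‖) ^ (d + 1))⁻¹ * ((1 + ‖u‖) ^ (p + d + 1))⁻¹ := by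
                field_simp
                ring
            _ ≤ C ^ 2 * c⁻¹ * ((1 + ‖u‖) ^ (d + 1))⁻¹ * 1 := by
                gcongr
                exact inv_le_one_of_one_le₀ (one_le_pow₀ hone)
            _ = _ := mul_one _
      _ ≤ ∫⁻ u, ENNReal.ofReal (C ^ 2 * c⁻¹) * ENNReal.ofReal ((1 + ‖u‖) ^ (-(d + 1 : ℝ))) :=
          setLIntegral_le_lintegral _ _
      _ = ENNReal.ofReal (C ^ 2 * c⁻¹) *
            ∫⁻ u : E d, ENNReal.ofReal ((1 + ‖u‖) ^ (-(d + 1 : ℝ))) :=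
          lintegral_const_mul' _ _ ENNReal.ofReal_ne_top
      _ < ∞ := ENNReal.mul_lt_top ENNReal.ofReal_lt_top
          (finite_integral_one_add_norm (by simp))

/-- The Cauchy-Schwarz inequality with weights `s` and `s⁻¹`. -/
lemma enorm_integral_mul_sq_le (hsm : Measurable s) (hfin : ∀ᵐ u : E d, s u < ∞)
    {F : E d → ℂ} (hF : Continuous F) (hg : Continuous g)
    (hgs : ∫⁻ u, ‖g u‖ₑ ^ 2 * (s u)⁻¹ < ∞) :
    ‖∫ u, F u * g u‖ₑ ^ 2 ≤ (∫⁻ u, ‖F u‖ₑ ^ 2 * s u) * ∫⁻ u, ‖g u‖ₑ ^ 2 * (s u)⁻¹ := by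
  have hh : AEMeasurable (fun u => ‖g u‖ₑ ^ 2 * (s u)⁻¹) := by fun_prop
  set a : E d → ℝ≥0∞ := fun u => ‖F u‖ₑ * s u ^ (1 / 2 : ℝ) with ha
  set b : E d → ℝ≥0∞ := fun u => ‖g u‖ₑ * (s u)⁻¹ ^ (1 / 2 : ℝ) with hb
  have hsq : ∀ x y : ℝ≥0∞, (x * y ^ (1 / 2 : ℝ)) ^ (2 : ℝ) = x ^ 2 * y := fun x y => by
    rw [ENNReal.mul_rpow_of_nonneg _ _ (by norm_num), ← ENNReal.rpow_mul]
    norm_num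
  have h1 : ‖∫ u, F u * g u‖ₑ ≤ ∫⁻ u, (a * b) u := by
    refine (enorm_integral_le_lintegral_enorm _).trans (lintegral_mono_ae ?_)
    filter_upwards [hfin, ae_lt_top' hh hgs.ne] with u h1 h2
    rw [enorm_mul, Pi.mul_apply, ha, hb]
    -- Where `s` vanishes, `s⁻¹ = ∞`, so finiteness of the integrand forces `g = 0`.
    by_cases h0 : s u = 0
    · have : ‖g u‖ₑ = 0 := by
        by_contra hne
        rw [h0, ENNReal.inv_zero, ENNReal.mul_top (by simpa using hne)] at h2
        exact lt_irrefl _ h2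
      rw [this, mul_zero]
      exact zero_le
    · have : s u ^ (1 / 2 : ℝ) * (s u)⁻¹ ^ (1 / 2 : ℝ) = 1 := by
        rw [← ENNReal.mul_rpow_of_nonneg _ _ (by norm_num), ENNReal.mul_inv_cancel h0 h1.ne,
          ENNReal.one_rpow]
      simp only
      rw [mul_mul_mul_comm, this, mul_one]
  have h2 := ENNReal.lintegral_mul_le_Lp_mul_Lq volume Real.HolderConjugate.two_two
    (f := a) (g := b) (by fun_prop) (by fun_prop)
  simp only [ha, hb, hsq] at h2
  have h3 := pow_le_pow_left' (h1.trans h2) 2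
  refine h3.trans_eq ?_
  rw [mul_pow, ← ENNReal.rpow_natCast, ← ENNReal.rpow_natCast, ← ENNReal.rpow_mul,
    ← ENNReal.rpow_mul]
  norm_num

end Converse

/-! ### Absence of rigidity when there is no pole, and the conclusion. -/

section Main

open scoped SchwartzMap

variable {d : ℕ}

lemma mono_neg (k : Fin d →₀ ℕ) (t : E d) : mono k (-t) = (∏ j, (-1 : ℂ) ^ k j) * mono k t := by
  rw [mono, mono, ← Finset.prod_mul_distrib]
  refine Finset.prod_congr rfl fun j _ => ?_
  rw [← mul_pow]
  simp

/-- By Parseval the pairing only involves `f` on the support of `χ(-·)`, which lies inside the open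
ball, where `f` is prescribed. The reflection in Parseval's identity produces the signs `(-1) ^ k
j`. -/
lemma integral_cft_mul_cft_of_eq_monomial {η : ℝ} (hη : 0 < η) {χ : 𝓢(E d, ℂ)}
    (hχ : tsupport χ ⊆ Metric.closedBall 0 (η / 2)) {f : E d → ℝ} (hf : IsTest f)
    {k : Fin d →₀ ℕ} (hfk : ∀ t ∈ Metric.ball (0 : E d) η, f t = -∏ i, t i ^ k i) :
    ∫ u, fourier f u * cft χ u =
      (((2 * Real.pi) ^ d : ℝ) : ℂ) * -((∏ j, (-1 : ℂ) ^ k j) * ∫ t, mono k t * χ t) := by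
  obtain ⟨R, C, hc⟩ := hf.exists_ctest
  rw [fourier_eq_cft, integral_cft_mul_cft hc]
  congr 1
  rw [← integral_const_mul, ← integral_neg]
  rw [← integral_neg_eq_self]
  congr 1; ext t
  rw [neg_neg, ← mul_assoc, ← mono_neg]
  by_cases ht : t ∈ Metric.ball (0 : E d) η
  · rw [hfk (-t) (by simpa using ht), mono]
    push_cast
    ring
  · have : χ t = 0 := image_eq_zero_of_notMem_tsupport fun h => ht (by
      have := hχ h
      simp only [mem_closedBall_zero_iff, mem_ball_zero_iff] at this ⊢
      linarith)
    rw [this]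
    simp

lemma lintegral_mul_spectralDensity_le (S : Measure (E d)) {F : E d → ℝ≥0∞} (hF : Measurable F) :
    ∫⁻ u, F u * spectralDensity S u ≤ ∫⁻ u, F u ∂S := by
  have h : ∫⁻ u, F u ∂(volume.withDensity (spectralDensity S)) =
      ∫⁻ u, F u * spectralDensity S u := by
    refine (lintegral_withDensity_eq_lintegral_mul _ (Measure.measurable_rnDeriv S volume)
      hF).trans ?_
    simp only [Pi.mul_apply, mul_comm, spectralDensity]
  rw [← h]
  exact lintegral_mono' (Measure.withDensity_rnDeriv_le _ _) le_rfl

variable {Ω : Type*} [MeasurableSpace Ω] {P : Measure Ω}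

lemma ofReal_variance_le [IsProbabilityMeasure P] {X : Ω → ℝ} (hX : MemLp X 2 P) :
    ENNReal.ofReal (variance X P) ≤ eLpNorm X 2 P ^ 2 := by
  rw [eLpNorm_two_sq]
  refine (ENNReal.ofReal_le_ofReal (variance_le_expectation_sq hX.aestronglyMeasurable)).trans ?_
  simp only [Pi.pow_apply]
  rw [ofReal_integral_eq_lintegral_ofReal hX.integrable_sq (ae_of_all _ fun _ => sq_nonneg _)]
  refine lintegral_mono fun ω => ?_
  beta_reduce
  rw [← sq_abs, ENNReal.ofReal_pow (abs_nonneg _), ← Real.norm_eq_abs, ofReal_norm]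

/-- Without pole of order `k`, there is no rigidity of order `k`. -/
theorem not_isLinRigidOfOrder [IsProbabilityMeasure P] {M : RandomSignedMeasure d P}
    {S : Measure (E d)} (hS : M.IsSpectralMeasure S) (hs : IsSimple (spectralDensity S))
    {k : Fin d →₀ ℕ} (hk : ¬ HasPole (spectralDensity S) 0 k) {η : ℝ} (hη : 0 < η) :
    ¬ M.IsLinRigidOfOrder k (Metric.ball 0 η) := by
  rintro ⟨h, hh, -, hlim⟩
  have := (RandomSignedMeasure.adm_of_isSpectralMeasure hS).isLocallyFiniteMeasure
  obtain ⟨p, hpm, hpk, hp⟩ := hs.exists_poly_of_not_hasPole hk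
  obtain ⟨φ, hφ, -, hφ0⟩ := exists_bump d (half_pos hη)
  obtain ⟨χ, hχ, hχp, hχk⟩ := exists_schwartz_mul_poly hφ hφ0 p hpm hpk
  have hχc : Continuous (cft χ) := continuous_cft χ.integrable
  have hB : ∫⁻ u, ‖cft χ u‖ₑ ^ 2 * (spectralDensity S u)⁻¹ < ∞ := by
    refine hs.lintegral_lt_top (fun x => ?_) (exists_norm_cft_schwartz_le χ)
    rw [funext hχp]
    exact (hp x).mul_right (continuous_cft φ.integrable).continuousAt
  set B := ∫⁻ u, ‖cft χ u‖ₑ ^ 2 * (spectralDensity S u)⁻¹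
  have hγ := isTest_indicator_monomial (d := d) hη k
  set γ := (Metric.ball (0 : E d) η).indicator fun t => ∏ i, t i ^ k i with hγdef
  set c : ℂ := (((2 * Real.pi) ^ d : ℝ) : ℂ) *
    -((∏ j, (-1 : ℂ) ^ k j) * ∫ t, mono k t * χ t) with hcdef
  have hc0 : c ≠ 0 := by
    refine mul_ne_zero ?_ (neg_ne_zero.2 (mul_ne_zero ?_ hχk))
    · exact_mod_cast (by positivity : (2 * Real.pi) ^ d ≠ 0)
    · exact Finset.prod_ne_zero_iff.2 fun j _ => pow_ne_zero _ (by simp)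
  -- The constant `c` does not depend on `n`, since `h n - γ` equals `-t^k` on the ball for every
  -- `n`. After Cauchy-Schwarz, the weight `s` is bounded by `S`, and the variance by the second
  -- moment.
  have hle : ∀ n, ‖c‖ₑ ^ 2 ≤ eLpNorm (fun ω => M.I (h n) ω - M.I γ ω) 2 P ^ 2 * B := fun n => by
    have hf : IsTest fun t => h n t - γ t := (hh n).1.sub hγ
    have hF : Continuous (fourier fun t => h n t - γ t) := by
      rw [fourier_eq_cft]; exact continuous_cft hf.integrable_ofReal
    have hc : ∫ u, fourier (fun t => h n t - γ t) u * cft χ u = c :=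
      integral_cft_mul_cft_of_eq_monomial hη hχ hf fun t ht => by
        simp [(hh n).2 t ht, hγdef, ht]
    rw [← hc]
    refine (enorm_integral_mul_sq_le (Measure.measurable_rnDeriv _ _)
      (Measure.rnDeriv_lt_top _ _) hF hχc hB).trans (mul_le_mul_left ?_ _)
    refine (lintegral_mul_spectralDensity_le S (by fun_prop)).trans ?_
    rw [hS.2 _ hf]
    refine (ofReal_variance_le (M.memLp _ hf)).trans_eq ?_
    rw [eLpNorm_congr_ae (M.I_sub (hh n).1 hγ)]
  have h0 : Tendsto (fun n => eLpNorm (fun ω => M.I (h n) ω - M.I γ ω) 2 P ^ 2 * B) atTop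
      (𝓝 0) := by
    have := ENNReal.Tendsto.mul_const (ENNReal.Tendsto.pow (n := 2) hlim)
      (Or.inr hB.ne : (0 : ℝ≥0∞) ^ 2 ≠ 0 ∨ B ≠ ∞)
    simpa using this
  have := ge_of_tendsto' h0 hle
  simp [hc0] at this

/-- A high power of one coordinate is square integrable against `s⁻¹` near `0`, and its own
coefficient is `1`. -/
lemma HasFiniteOrder.exists_not_hasPole {s : E d → ℝ≥0∞} (hs : HasFiniteOrder s 0) (i : Fin d) :
    ∃ k : Fin d →₀ ℕ, ¬ HasPole s 0 k := by
  obtain ⟨q, hq⟩ := hs.exists_coord_pow i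
  refine ⟨Finsupp.single i q, fun h => ?_⟩
  have := h (MvPolynomial.X i ^ q) (by simpa [LocInt] using hq)
  simp [MvPolynomial.coeff_X_pow] at this

/-- Maximal rigidity on a ball implies rigidity of all orders. -/
lemma RandomSignedMeasure.IsLinMaxRigid.isLinRigidOfOrder {M : RandomSignedMeasure d P} {η : ℝ}
    (hη : 0 < η) (h : M.IsLinMaxRigid (Metric.ball 0 η)) (k : Fin d →₀ ℕ) :
    M.IsLinRigidOfOrder k (Metric.ball 0 η) := by
  have := h _ (isTest_indicator_monomial hη k)
  unfold RandomSignedMeasure.IsLinRigid at this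
  rwa [Set.indicator_indicator, Set.inter_self] at this

end Main

end LinearRigidity

theorem proposition3p7 {d : ℕ} (hd : 0 < d) {Ω : Type*} [MeasurableSpace Ω] (P : Measure Ω)
    [IsProbabilityMeasure P] (M : LinearRigidity.RandomSignedMeasure d P) (hM : M.IsStationary)
    (S : Measure (LinearRigidity.E d)) (hS : M.IsSpectralMeasure S)
    (hs : LinearRigidity.IsSimple (LinearRigidity.spectralDensity S)) :
    (∀ η : ℝ, 0 < η → ¬ M.IsLinMaxRigid (Metric.ball 0 η)) ∧
    (∀ (k : Fin d →₀ ℕ) (η : ℝ), 0 < η →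
      (M.IsLinRigidOfOrder k (Metric.ball 0 η) ↔
        LinearRigidity.HasPole (LinearRigidity.spectralDensity S) 0 k)) := by
  have : Nonempty (Fin d) := ⟨⟨0, hd⟩⟩
  refine ⟨fun η hη hmax => ?_, fun k η hη => ⟨fun h => ?_, fun hk =>
    LinearRigidity.isLinRigidOfOrder_of_hasPole hM hS (hs.hasFiniteOrder 0) hk hη⟩⟩
  · obtain ⟨k, hk⟩ := (hs.hasFiniteOrder 0).exists_not_hasPole ⟨0, hd⟩
    exact LinearRigidity.not_isLinRigidOfOrder hS hs hk hη (hmax.isLinRigidOfOrder hη k)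
  · by_contra hk
    exact LinearRigidity.not_isLinRigidOfOrder hS hs hk hη h
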